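/- Let $(\Omega,\mathcal F,\mathbb P)$ be a probability space and let $L=\{L(B):B\in\mathcal B_b(\mathbb R^2)\}$ be a homogeneous Lévy basis on $\mathbb R^2$ with characteristic triplet $(\gamma,b,\nu)$. That is, for pairwise disjoint bounded Borel sets $B_1,B_2,\dots$ the random variables $L(B_i)$ are independent; if moreover $\bigcup_iB_i$ is bounded, then $L(\bigcup_iB_i)=\sum_iL(B_i)$ almost surely; and $\mathbb E\,e^{izL(B)}=e^{\mathrm{Leb}(B)\psi(z)}$ for all bounded Borel sets $B$ and $z\in\mathbb R$, where $$\psi(z)=i\gamma z-\tfrac12b^2z^2+\int_{\mathbb R\setminus\{0\}}\big(e^{izx}-1-izx\mathbf 1_{|x|\le1}\big)\,\nu(dx),$$ $\gamma\in\mathbb R$, $b\ge0$, $\nu(\{0\})=0$ and $\int(1\wedge x^2)\,\nu(dx)<\infty$. For a Borel set $B$ of finite Lebesgue measure, $L(B)$ denotes the limit in probability of $L(B\cap[-m,m]^2)$ as $m\to\infty$. Let $L'$ be the Lévy seed, i.e. a random variable with characteristic function $e^{\psi}$, and assume $\mathrm{Var}(L')=1$. Let $a:[0,\infty)\to[0,\infty)$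 be non-increasing, continuous and integrable, let $A=\{(r,y):r\le0,\ 0\le y\le a(-r)\}$ with $\mathrm{Leb}(A)>0$, and let $X_t=L(A+(t,0))$, $t\in\mathbb R$, be the associated trawl process. Let $\Delta_n>0$ satisfy $\Delta_n\to0$ and $n\Delta_n\to\infty$ as $n\to\infty$. For $0\le l\le n-1$ and $l\Delta_n\le t<(l+1)\Delta_n$ put $$\hat a(t)=-\frac1{n\Delta_n}\sum_{k=l}^{n-1}\big(X_{(k-l)\Delta_n}-\bar X_n\big)\big(X_{(k+1)\Delta_n}-X_{k\Delta_n}\big),\qquad \bar X_n=\frac1n\sum_{k=0}^{n-1}X_{k\Delta_n},$$ and, for a function $g:\mathbb R\to\mathbb R$, $$\Lambda^n_t(g)=\Delta_n\sum_{l=\lfloor t/\Delta_n\rfloor}^{n-1}g(\hat a(l\Delta_n)),\qquad \Lambda_t(g)=\int_t^\infty g(a(s))\,ds,\qquad t\ge0$$ (an empty sum is $0$). Let $p,q>1$ and let $g$ be of class $C^1$ with $g(0)=0$, $g'(x)=O(|x|^p)$ as $x\to0$ and $g'(x)=O(|x|^q)$ as $|x|\to\infty$. Assume that $\mathbb E\big(|L'|^{2(\max(p,q)+1)}\big)<\infty$.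 Then $s\mapsto g(a(s))$ is integrable on $[0,\infty)$, and $\Lambda^n(g)\to\Lambda(g)$ uniformly on compacts in probability: for all $T>0$ and $\varepsilon>0$, $$\lim_{n\to\infty}\mathbb P\Big(\sup_{0\le t\le T}|\Lambda^n_t(g)-\Lambda_t(g)|>\varepsilon\Big)=0 .$$ -/

import Mathlib

open MeasureTheory ProbabilityTheory Filter Set Topology

namespace Trawl

noncomputable section

/-- A characteristic triplet `(γ, b, ν)`, where `ν` is a Lévy measure on `ℝ`. -/
structure Triplet where
  γ : ℝ
  b : ℝ
  ν : Measure ℝ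
  b_nonneg : 0 ≤ b
  ν_zero : ν {0} = 0
  ν_levy : ∫⁻ x, ENNReal.ofReal (min 1 (x ^ 2)) ∂ν < ⊤

/-- The characteristic exponent
`ψ(z) = i γ z - b² z² / 2 + ∫ (e^{izx} - 1 - i z x 1_{|x| ≤ 1}) ν(dx)`. -/
def Triplet.exponent (τ : Triplet) (z : ℝ) : ℂ :=
  Complex.I * τ.γ * z - (τ.b : ℂ) ^ 2 * (z : ℂ) ^ 2 / 2
    + ∫ x : ℝ, (Complex.exp (Complex.I * z * x) - 1
        - (if |x| ≤ 1 then Complex.I * z * x else 0)) ∂τ.ν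

/-- `μ` is the law of the Lévy seed, i.e. of the infinitely divisible random variable with
characteristic triplet `τ`. -/
def Triplet.IsSeedLaw (τ : Triplet) (μ : Measure ℝ) : Prop :=
  IsProbabilityMeasure μ ∧ ∀ z : ℝ, charFun μ z = Complex.exp (τ.exponent z)

/-- A homogeneous Lévy basis on `ℝ²` with characteristic triplet `τ`, indexed by the bounded Borel
sets. (The values of `L` at other sets are irrelevant.) The series in `additive` converges almost
surely, in general not absolutely, so it is stated through its partial sums. -/
structure IsLevyBasis {Ω : Type*} [MeasurableSpace Ω] (P : Measure Ω) (τ : Triplet)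
    (L : Set (ℝ × ℝ) → Ω → ℝ) : Prop where
  measurable : ∀ B, MeasurableSet B → Bornology.IsBounded B → Measurable (L B)
  independent : ∀ B : ℕ → Set (ℝ × ℝ), (∀ i, MeasurableSet (B i)) →
    (∀ i, Bornology.IsBounded (B i)) → Pairwise (fun i j => Disjoint (B i) (B j)) →
    iIndepFun (fun i => L (B i)) P
  additive : ∀ B : ℕ → Set (ℝ × ℝ), (∀ i, MeasurableSet (B i)) →
    Bornology.IsBounded (⋃ i, B i) → Pairwise (fun i j => Disjoint (B i) (B j)) →
    ∀ᵐ ω ∂P, Tendsto (fun N : ℕ => ∑ i ∈ Finset.range N, L (B i) ω) atTop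
      (𝓝 (L (⋃ i, B i) ω))
  charFun_eq : ∀ B, MeasurableSet B → Bornology.IsBounded B → ∀ z : ℝ,
    charFun (P.map (L B)) z = Complex.exp ((volume B).toReal * τ.exponent z)

/-- `Y = L(B)` for a Borel set `B` of finite Lebesgue measure, not necessarily bounded: `L(B)` is
the limit in probability of `L(B ∩ [-m, m]²)` as `m → ∞`. -/
def IsValue {Ω : Type*} [MeasurableSpace Ω] (P : Measure Ω) (L : Set (ℝ × ℝ) → Ω → ℝ)
    (B : Set (ℝ × ℝ)) (Y : Ω → ℝ) : Prop :=
  TendstoInMeasure P (fun m : ℕ => L (B ∩ Icc (-(m : ℝ)) m ×ˢ Icc (-(m : ℝ)) m)) atTop Y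

/-- The trawl set `A = {(r, y) : r ≤ 0, 0 ≤ y ≤ a(-r)}`. -/
def trawlSet (a : ℝ → ℝ) : Set (ℝ × ℝ) :=
  {x | x.1 ≤ 0 ∧ 0 ≤ x.2 ∧ x.2 ≤ a (-x.1)}

/-- The translated trawl set `A_t = A + (t, 0)`. -/
def trawlSetAt (a : ℝ → ℝ) (t : ℝ) : Set (ℝ × ℝ) :=
  {x | x - (t, 0) ∈ trawlSet a}

/-- A trawl function on `[0, ∞)`; the values of `a` on `(-∞, 0)` are irrelevant. -/
structure IsTrawlFunction (a : ℝ → ℝ) : Prop where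
  nonneg : ∀ s, 0 ≤ s → 0 ≤ a s
  antitone : AntitoneOn a (Ici 0)
  continuous : ContinuousOn a (Ici 0)
  integrable : IntegrableOn a (Ici 0)
  nontrivial : 0 < volume (trawlSet a)

/-- `X` is the trawl process `X_t = L(A_t)`. -/
def IsTrawlProcess {Ω : Type*} [MeasurableSpace Ω] (P : Measure Ω) (L : Set (ℝ × ℝ) → Ω → ℝ)
    (a : ℝ → ℝ) (X : ℝ → Ω → ℝ) : Prop :=
  ∀ t : ℝ, IsValue P L (trawlSetAt a t) (X t)

/-- The sample mean of `x_0, x_δ, …, x_{(n-1)δ}` for a path `x`. -/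
def sampleMean (x : ℝ → ℝ) (δ : ℝ) (n : ℕ) : ℝ :=
  (∑ k ∈ Finset.range n, x (k * δ)) / n

/-- The estimator `â(t)` computed from the path `x` observed at `0, δ, …, nδ`:
`â(t) = -(nδ)⁻¹ ∑_{k=l}^{n-1} (x_{(k-l)δ} - x̄_n) (x_{(k+1)δ} - x_{kδ})` for
`lδ ≤ t < (l+1)δ`. -/
def aHat (x : ℝ → ℝ) (δ : ℝ) (n : ℕ) (t : ℝ) : ℝ :=
  -(1 / (n * δ)) * ∑ k ∈ Finset.Ico ⌊t / δ⌋₊ n,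
    (x (((k : ℝ) - (⌊t / δ⌋₊ : ℝ)) * δ) - sampleMean x δ n)
      * (x (((k : ℝ) + 1) * δ) - x (k * δ))

/-- `Λⁿ_t(g) = δ ∑_{l=⌊t/δ⌋}^{n-1} g(â(lδ))`, computed from the path `x`. -/
def lambdaHat (g : ℝ → ℝ) (x : ℝ → ℝ) (δ : ℝ) (n : ℕ) (t : ℝ) : ℝ :=
  δ * ∑ l ∈ Finset.Ico ⌊t / δ⌋₊ n, g (aHat x δ n (l * δ))

/-- `Λ_t(g) = ∫_t^∞ g(a(s)) ds`. -/
def lambda (g a : ℝ → ℝ) (t : ℝ) : ℝ :=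
  ∫ s in Ioi t, g (a s)

/-- The class `𝔆^d_{p,q}`: `g` is of class `C^d`, `g^{(j)}(0) = 0` for `j < d`,
`g^{(d)}(x) = O(|x|^p)` as `x → 0` and `g^{(d)}(x) = O(|x|^q)` as `|x| → ∞`. -/
structure TestClass (d : ℕ) (p q : ℝ) (g : ℝ → ℝ) : Prop where
  contDiff : ContDiff ℝ d g
  zero : ∀ j < d, iteratedDeriv j g 0 = 0
  near_zero : iteratedDeriv d g =O[𝓝 0] fun x => |x| ^ p
  near_infty : iteratedDeriv d g =O[cocompact ℝ] fun x => |x| ^ q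

/-- Uniform convergence on compacts in probability of processes on `[0, ∞)`: for all `T` and
`ε > 0`, `P(sup_{0 ≤ t ≤ T} |Zⁿ_t - Z_t| > ε) → 0`. -/
def TendstoUCP {Ω : Type*} [MeasurableSpace Ω] (P : Measure Ω) (Zn : ℕ → ℝ → Ω → ℝ)
    (Z : ℝ → Ω → ℝ) : Prop :=
  ∀ T : ℝ, 0 < T → ∀ ε : ℝ, 0 < ε →
    Tendsto (fun n => P {ω | ∃ t ∈ Icc 0 T, ε < |Zn n t ω - Z t ω|}) atTop (𝓝 0)

end

end Trawl

namespace Trawl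

/-! ### Power inequalities -/

lemma rpow_add_le_two (s : ℝ) (hs : 1 ≤ s) (x y : ℝ) :
    |x + y| ^ s ≤ 2 ^ (s - 1) * (|x| ^ s + |y| ^ s) := by
  have h := NNReal.rpow_add_le_mul_rpow_add_rpow (Real.nnabs x) (Real.nnabs y) hs
  have h' : ((|x| + |y|) ^ s : ℝ) ≤ 2 ^ (s - 1) * (|x| ^ s + |y| ^ s) := by exact_mod_cast h
  exact (Real.rpow_le_rpow (abs_nonneg _) (abs_add_le x y) (by linarith)).trans h'

lemma abs_rpow_le_sq_add_rpow {s t : ℝ} (hs : 2 ≤ s) (hst : s ≤ t) (x : ℝ) :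
    |x| ^ s ≤ x ^ 2 + |x| ^ t := by
  rcases le_total |x| 1 with h | h
  · have h1 : |x| ^ s ≤ |x| ^ (2 : ℝ) := by
      rcases (abs_nonneg x).eq_or_lt with h0 | h0
      · rw [← h0, Real.zero_rpow (by linarith), Real.zero_rpow (by norm_num)]
      · exact Real.rpow_le_rpow_of_exponent_ge h0 h hs
    rw [Real.rpow_two, sq_abs] at h1
    have := Real.rpow_nonneg (abs_nonneg x) t
    linarith
  · have h1 : |x| ^ s ≤ |x| ^ t := Real.rpow_le_rpow_of_exponent_le h hst
    nlinarith [sq_nonneg x]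

/-- Bernoulli's inequality, tangent at the far end point. -/
lemma one_add_rpow_le {s : ℝ} (hs : 1 ≤ s) {t : ℝ} (ht : -1 < t) :
    (1 + t) ^ s ≤ 1 + s * t * (1 + t) ^ (s - 1) := by
  have h0 : 0 < 1 + t := by linarith
  have h1 := one_add_mul_self_le_rpow_one_add (s := -t / (1 + t))
    (by rw [le_div_iff₀ h0]; linarith) hs
  have h2 : 1 + -t / (1 + t) = (1 + t)⁻¹ := by field_simp; ring
  rw [h2, Real.inv_rpow h0.le] at h1
  have h3 : (1 + t) ^ s = (1 + t) ^ (s - 1) * (1 + t) := by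
    rw [← Real.rpow_add_one h0.ne']; ring_nf
  have h4 : 0 < (1 + t) ^ s := Real.rpow_pos_of_pos h0 s
  have h5 := mul_le_mul_of_nonneg_right h1 h4.le
  rw [inv_mul_cancel₀ h4.ne'] at h5
  have h6 : (1 + s * (-t / (1 + t))) * (1 + t) ^ s
      = (1 + t) ^ s - s * t * (1 + t) ^ (s - 1) := by
    have : -t / (1 + t) * (1 + t) ^ s = -t * (1 + t) ^ (s - 1) := by
      rw [h3]; field_simp
    linear_combination s * this
  linarith

/-- `|1 + t| ^ s ≥ 1 + s t` for all real `t`. -/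
lemma one_add_mul_le_abs_rpow {s : ℝ} (hs : 1 ≤ s) (t : ℝ) : 1 + s * t ≤ |1 + t| ^ s := by
  rcases le_or_gt (-1) t with h | h
  · rw [abs_of_nonneg (by linarith)]; exact one_add_mul_self_le_rpow_one_add h hs
  · have := Real.rpow_nonneg (abs_nonneg (1 + t)) s
    nlinarith

lemma abs_one_add_rpow_le {r : ℝ} (hr : 2 ≤ r) (t : ℝ) :
    |1 + t| ^ r ≤ 1 + r * t + (r ^ 2 * 2 ^ r + 2 * r + 3 ^ r) * (t ^ 2 + |t| ^ r) := by
  have hpos3 : 0 < (3 : ℝ) ^ r := Real.rpow_pos_of_pos (by norm_num) r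
  have hpos2 : 1 ≤ (2 : ℝ) ^ r := Real.one_le_rpow (by norm_num) (by linarith)
  have htr : 0 ≤ |t| ^ r := Real.rpow_nonneg (abs_nonneg t) r
  rcases le_total |t| (1 / 2) with h | h
  · obtain ⟨h1, h2⟩ := abs_le.1 h
    have h0 : 0 < 1 + t := by linarith
    rw [abs_of_pos h0]
    have e1 := one_add_rpow_le (s := r) (by linarith) (t := t) (by linarith)
    have e2 : t * ((1 + t) ^ (r - 1) - 1) ≤ r * 2 ^ r * t ^ 2 := by
      rcases le_total 0 t with ht | ht
      · have e3 := one_add_rpow_le (s := r - 1) (by linarith) (t := t) (by linarith)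
        have e4 : (1 + t) ^ (r - 1 - 1) ≤ 2 ^ r :=
          (Real.rpow_le_rpow h0.le (by linarith) (by linarith)).trans
            (Real.rpow_le_rpow_of_exponent_le (by norm_num) (by linarith))
        have e5 : (r - 1) * t * (1 + t) ^ (r - 1 - 1) ≤ r * t * 2 ^ r := by
          apply mul_le_mul _ e4 (Real.rpow_nonneg h0.le _) (by positivity)
          nlinarith
        nlinarith
      · have e3 := one_add_mul_self_le_rpow_one_add (s := t) (by linarith) (p := r - 1)
          (by linarith)
        have e4 : t * ((1 + t) ^ (r - 1) - 1) ≤ (r - 1) * t ^ 2 := by nlinarith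
        have e5 : r * 1 ≤ r * 2 ^ r := by gcongr
        nlinarith [sq_nonneg t]
    have e6 : r * (t * ((1 + t) ^ (r - 1) - 1)) ≤ r * (r * 2 ^ r * t ^ 2) := by gcongr
    have e7 : r ^ 2 * 2 ^ r * t ^ 2 ≤
        (r ^ 2 * 2 ^ r + 2 * r + 3 ^ r) * (t ^ 2 + |t| ^ r) := by
      gcongr
      · linarith
      · linarith
    nlinarith
  · have e1 : |1 + t| ^ r ≤ 3 ^ r * |t| ^ r := by
      rw [← Real.mul_rpow (by norm_num) (abs_nonneg t)]
      apply Real.rpow_le_rpow (abs_nonneg _) _ (by linarith)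
      have := abs_add_le 1 t
      rw [abs_one] at this
      linarith
    have e2 : -(r * t) ≤ 2 * r * t ^ 2 := by
      have : -t ≤ |t| := neg_le_abs t
      have h3 : |t| ≤ 2 * t ^ 2 := by rw [← sq_abs t]; nlinarith [abs_nonneg t]
      nlinarith
    have e3 : 0 ≤ r ^ 2 * 2 ^ r * (t ^ 2 + |t| ^ r) := by positivity
    have e4 : 0 ≤ r * |t| ^ r := by positivity
    have e5 : 0 ≤ (3 : ℝ) ^ r * t ^ 2 := by positivity
    nlinarith

/-- Constant in the second order expansion of `|x + y| ^ r`. -/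
noncomputable def expansionConst (r : ℝ) : ℝ := r ^ 2 * 2 ^ r + 2 * r + 3 ^ r

lemma expansionConst_pos {r : ℝ} (hr : 2 ≤ r) : 0 < expansionConst r := by
  have hpos3 : 0 < (3 : ℝ) ^ r := Real.rpow_pos_of_pos (by norm_num) r
  unfold expansionConst; positivity

lemma abs_add_rpow_le_expansion {r : ℝ} (hr : 2 ≤ r) (x y : ℝ) :
    |x + y| ^ r ≤ |x| ^ r + r * (|x| ^ (r - 2) * x) * y
      + expansionConst r * (|x| ^ (r - 2) * y ^ 2 + |y| ^ r) := by
  have hC := expansionConst_pos hr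
  rcases eq_or_ne x 0 with rfl | hx
  · have hpos3 : 1 ≤ (3 : ℝ) ^ r := Real.one_le_rpow (by norm_num) (by linarith)
    have hC1 : 1 ≤ expansionConst r := by
      have : 0 ≤ r ^ 2 * 2 ^ r := by positivity
      unfold expansionConst; linarith
    have h1 : 0 ≤ |(0 : ℝ)| ^ (r - 2) * y ^ 2 := by positivity
    have h2 : 0 ≤ |y| ^ r := by positivity
    simp only [zero_add, mul_zero, zero_mul]
    rw [abs_zero, Real.zero_rpow (by linarith)]
    rw [abs_zero] at h1
    nlinarith
  · have hxp : 0 < |x| := abs_pos.2 hx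
    have key := abs_one_add_rpow_le hr (y / x)
    have hm := mul_le_mul_of_nonneg_left key (Real.rpow_nonneg hxp.le r)
    have e1 : |x| ^ r * |1 + y / x| ^ r = |x + y| ^ r := by
      rw [← Real.mul_rpow hxp.le (abs_nonneg _), ← abs_mul]
      congr 2; field_simp
    have e2 : |x| ^ r = |x| ^ (r - 2) * x ^ 2 := by
      rw [← sq_abs x, ← Real.rpow_natCast, ← Real.rpow_add hxp]; norm_num
    have e3 : |x| ^ r * |y / x| ^ r = |y| ^ r := by
      rw [← Real.mul_rpow hxp.le (abs_nonneg _), ← abs_mul]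
      congr 2; field_simp
    rw [e1] at hm
    have e4 : |x| ^ r * (1 + r * (y / x) + expansionConst r * ((y / x) ^ 2 + |y / x| ^ r))
        = |x| ^ r + r * (|x| ^ (r - 2) * x) * y
      + expansionConst r * (|x| ^ (r - 2) * y ^ 2 + |y| ^ r) := by
      have e5 : |x| ^ r * (r * (y / x)) = r * (|x| ^ (r - 2) * x) * y := by
        rw [e2]; field_simp
      have e6 : |x| ^ r * (y / x) ^ 2 = |x| ^ (r - 2) * y ^ 2 := by
        rw [e2]; field_simp
      linear_combination e5 + expansionConst r * e6 + expansionConst r * e3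
    rw [← e4]; exact hm

lemma tangent_le_abs_add_rpow {r : ℝ} (hr : 2 ≤ r) (x y : ℝ) :
    |x| ^ r + r * (|x| ^ (r - 2) * x) * y ≤ |x + y| ^ r := by
  rcases eq_or_ne x 0 with rfl | hx
  · have h2 : 0 ≤ |y| ^ r := by positivity
    simp only [zero_add, mul_zero, zero_mul]
    rw [abs_zero, Real.zero_rpow (by linarith)]
    linarith
  · have hxp : 0 < |x| := abs_pos.2 hx
    have key := one_add_mul_le_abs_rpow (s := r) (by linarith) (y / x)
    have hm := mul_le_mul_of_nonneg_left key (Real.rpow_nonneg hxp.le r)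
    have e1 : |x| ^ r * |1 + y / x| ^ r = |x + y| ^ r := by
      rw [← Real.mul_rpow hxp.le (abs_nonneg _), ← abs_mul]
      congr 2; field_simp
    have e2 : |x| ^ r = |x| ^ (r - 2) * x ^ 2 := by
      rw [← sq_abs x, ← Real.rpow_natCast, ← Real.rpow_add hxp]; norm_num
    have e5 : |x| ^ r * (r * (y / x)) = r * (|x| ^ (r - 2) * x) * y := by
      rw [e2]; field_simp
    rw [e1, mul_add, e5, mul_one] at hm
    exact hm

/-- Clarkson's inequality for real numbers. -/
lemma clarkson_real {r : ℝ} (hr : 2 ≤ r) (u v : ℝ) :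
    2 * |(u + v) / 2| ^ r + 2 * |(u - v) / 2| ^ r ≤ |u| ^ r + |v| ^ r := by
  have hr2 : 1 ≤ r / 2 := by linarith
  have e : ∀ x : ℝ, |x| ^ r = (x ^ 2) ^ (r / 2) := fun x => by
    rw [← sq_abs x, ← Real.rpow_natCast, ← Real.rpow_mul (abs_nonneg x)]; congr 1; push_cast; ring
  have h1 : (((u + v) / 2) ^ 2) ^ (r / 2) + (((u - v) / 2) ^ 2) ^ (r / 2)
      ≤ (((u + v) / 2) ^ 2 + ((u - v) / 2) ^ 2) ^ (r / 2) := by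
    have := NNReal.add_rpow_le_rpow_add ⟨((u + v) / 2) ^ 2, sq_nonneg _⟩
      ⟨((u - v) / 2) ^ 2, sq_nonneg _⟩ hr2
    exact_mod_cast this
  have h2 : ((u ^ 2 + v ^ 2) / 2) ^ (r / 2) ≤ ((u ^ 2) ^ (r / 2) + (v ^ 2) ^ (r / 2)) / 2 := by
    obtain ⟨-, hc⟩ := convexOn_rpow hr2
    have := hc (mem_Ici.2 (sq_nonneg u)) (mem_Ici.2 (sq_nonneg v))
      (show (0 : ℝ) ≤ 1 / 2 by norm_num) (show (0 : ℝ) ≤ 1 / 2 by norm_num) (by norm_num)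
    simp only [smul_eq_mul] at this
    calc _ = (1 / 2 * u ^ 2 + 1 / 2 * v ^ 2) ^ (r / 2) := by ring_nf
      _ ≤ _ := this
      _ = _ := by ring
  have h3 : ((u + v) / 2) ^ 2 + ((u - v) / 2) ^ 2 = (u ^ 2 + v ^ 2) / 2 := by ring
  rw [h3] at h1
  rw [e, e, e u, e v]
  linarith

lemma abs_add_rpow_ge_expansion {r : ℝ} (hr : 2 ≤ r) (x y : ℝ) :
    |x| ^ r + r * (|x| ^ (r - 2) * x) * y + 2 * |y / 2| ^ r ≤ |x + y| ^ r := by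
  have h1 := clarkson_real hr (x + y) x
  have h2 := tangent_le_abs_add_rpow hr x (y / 2)
  have h3 : (x + y + x) / 2 = x + y / 2 := by ring
  have h4 : (x + y - x) / 2 = y / 2 := by ring
  rw [h3, h4] at h1
  linarith

/-- Young's inequality with a scale. -/
lemma rpow_sub_two_mul_sq_le {r : ℝ} (hr : 2 ≤ r) {T : ℝ} (hT : 0 < T) (x y : ℝ) :
    |x| ^ (r - 2) * y ^ 2 ≤ T⁻¹ * |x| ^ r + T ^ (r / 2 - 1) * |y| ^ r := by
  set l : ℝ := T ^ (1 / 2 : ℝ) with hl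
  have hlp : 0 < l := Real.rpow_pos_of_pos hT _
  have hl2 : l ^ 2 = T := by
    rw [hl, ← Real.rpow_natCast, ← Real.rpow_mul hT.le]; norm_num
  have hlr : l ^ (r - 2) = T ^ (r / 2 - 1) := by
    rw [hl, ← Real.rpow_mul hT.le]; congr 1; ring
  have split : ∀ z : ℝ, |z| ^ r = |z| ^ (r - 2) * z ^ 2 := fun z => by
    rw [← sq_abs z, ← Real.rpow_natCast, ← Real.rpow_add_of_nonneg (abs_nonneg z) (by linarith)
      (by norm_num)]; norm_num
  rcases le_total |x| (l * |y|) with h | h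
  · have h1 : |x| ^ (r - 2) ≤ (l * |y|) ^ (r - 2) :=
      Real.rpow_le_rpow (abs_nonneg x) h (by linarith)
    rw [Real.mul_rpow hlp.le (abs_nonneg y), hlr] at h1
    have h2 := mul_le_mul_of_nonneg_right h1 (sq_nonneg y)
    have h3 : 0 ≤ T⁻¹ * |x| ^ r := by positivity
    rw [split y, ← mul_assoc]; linarith
  · have h1 : l ^ 2 * y ^ 2 ≤ x ^ 2 := by
      rw [← sq_abs x, ← sq_abs y, ← mul_pow]; gcongr
    rw [hl2] at h1
    have h2 : y ^ 2 ≤ T⁻¹ * x ^ 2 := by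
      rw [inv_mul_eq_div, le_div_iff₀ hT]; linarith
    have h3 := mul_le_mul_of_nonneg_left h2 (Real.rpow_nonneg (abs_nonneg x) (r - 2))
    have h4 : 0 ≤ T ^ (r / 2 - 1) * |y| ^ r := by positivity
    rw [split x]
    nlinarith

end Trawl

namespace Trawl

/-! ### Moments of sums of martingale differences -/

section Moments

variable {Ω : Type*} [MeasurableSpace Ω] {P : Measure Ω}

lemma memLp_ofReal_iff {f : Ω → ℝ} (hf : AEStronglyMeasurable f P) {s : ℝ} (hs : 0 < s) :
    MemLp f (ENNReal.ofReal s) P ↔ Integrable (fun ω => |f ω| ^ s) P := by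
  have := integrable_norm_rpow_iff (μ := P) hf (p := ENNReal.ofReal s)
    (by simpa using hs) ENNReal.ofReal_ne_top
  rw [← this, ENNReal.toReal_ofReal hs.le]
  rfl

lemma integrable_abs_rpow {f : Ω → ℝ} {s : ℝ} (hs : 0 < s)
    (hf : MemLp f (ENNReal.ofReal s) P) : Integrable (fun ω => |f ω| ^ s) P :=
  (memLp_ofReal_iff hf.1 hs).1 hf

lemma rpow_sub_two_mul_self_mul_le {r : ℝ} (hr : 2 ≤ r) (x y : ℝ) :
    |(|x| ^ (r - 2) * x) * y| ≤ |x| ^ r + |y| ^ r := by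
  have h0 := rpow_sub_two_mul_sq_le hr one_pos x y
  have h1 := rpow_sub_two_mul_sq_le hr one_pos x x
  have hp : 0 ≤ |x| ^ (r - 2) := by positivity
  simp only [inv_one, one_mul, Real.one_rpow] at h0 h1
  have split : |x| ^ r = |x| ^ (r - 2) * x ^ 2 := by
    rw [← sq_abs x, ← Real.rpow_natCast, ← Real.rpow_add_of_nonneg (abs_nonneg x) (by linarith)
      (by norm_num)]; norm_num
  have h2 : |x| * |y| ≤ (x ^ 2 + y ^ 2) / 2 := by
    rw [← sq_abs x, ← sq_abs y]; nlinarith [sq_nonneg (|x| - |y|)]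
  have h3 := mul_le_mul_of_nonneg_left h2 hp
  have hy : 0 ≤ |y| ^ r := by positivity
  have hx : 0 ≤ |x| ^ r := by positivity
  rw [abs_mul, abs_mul, abs_of_nonneg hp]
  nlinarith

lemma integrable_rpow_sub_two_mul_self_mul {r : ℝ} (hr : 2 ≤ r) {S Y : Ω → ℝ}
    (hS : MemLp S (ENNReal.ofReal r) P) (hY : MemLp Y (ENNReal.ofReal r) P) :
    Integrable (fun ω => (|S ω| ^ (r - 2) * S ω) * Y ω) P := by
  have hr0 : 0 < r := by linarith
  have hSm := hS.1
  have hYm := hY.1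
  refine ((integrable_abs_rpow hr0 hS).add (integrable_abs_rpow hr0 hY)).mono' ?_
    (ae_of_all _ fun ω => rpow_sub_two_mul_self_mul_le hr _ _)
  have hm : Measurable (fun x : ℝ => |x| ^ (r - 2)) := by fun_prop
  exact ((hm.comp_aemeasurable hSm.aemeasurable).mul hSm.aemeasurable).mul
    hYm.aemeasurable |>.aestronglyMeasurable

lemma integrable_rpow_sub_two_mul_sq {r : ℝ} (hr : 2 ≤ r) {S Y : Ω → ℝ}
    (hS : MemLp S (ENNReal.ofReal r) P) (hY : MemLp Y (ENNReal.ofReal r) P) :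
    Integrable (fun ω => |S ω| ^ (r - 2) * Y ω ^ 2) P := by
  have hr0 : 0 < r := by linarith
  have hSm := hS.1
  have hYm := hY.1
  refine ((integrable_abs_rpow hr0 hS).add (integrable_abs_rpow hr0 hY)).mono' ?_
    (ae_of_all _ fun ω => ?_)
  · have hm : Measurable (fun x : ℝ => |x| ^ (r - 2)) := by fun_prop
    exact ((hm.comp_aemeasurable hSm.aemeasurable).mul
      (hYm.aemeasurable.pow_const 2)).aestronglyMeasurable
  · have h0 := rpow_sub_two_mul_sq_le hr one_pos (S ω) (Y ω)
    simp only [inv_one, one_mul, Real.one_rpow] at h0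
    rw [Real.norm_of_nonneg (by positivity)]
    exact h0

lemma memLp_mul_of_indepFun {Y N : Ω → ℝ} {r : ℝ} (hr : 0 < r)
    (hY : MemLp Y (ENNReal.ofReal r) P) (hN : MemLp N (ENNReal.ofReal r) P)
    (h : IndepFun Y N P) : MemLp (fun ω => Y ω * N ω) (ENNReal.ofReal r) P := by
  refine (memLp_ofReal_iff (f := fun ω => Y ω * N ω) (hY.1.mul hN.1) hr).2 ?_
  have hm : Measurable (fun x : ℝ => |x| ^ r) := by fun_prop
  have := (h.comp hm hm).integrable_mul (integrable_abs_rpow hr hY) (integrable_abs_rpow hr hN)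
  refine this.congr (ae_of_all _ fun ω => ?_)
  simp [abs_mul, Real.mul_rpow]

variable [IsProbabilityMeasure P]

lemma MemLp_two_of_ofReal {f : Ω → ℝ} {s : ℝ} (hs : 2 ≤ s)
    (hf : MemLp f (ENNReal.ofReal s) P) : MemLp f 2 P := by
  refine hf.mono_exponent ?_
  rw [show (2 : ENNReal) = ENNReal.ofReal 2 by norm_num]
  exact ENNReal.ofReal_le_ofReal hs

/-- One step of the recursion for the `r`-th moment of a martingale. -/
lemma integral_abs_add_mul_rpow_le {r : ℝ} (hr : 2 ≤ r) {T : ℝ} (hT : 0 < T) {S Y N : Ω → ℝ}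
    (hS : MemLp S (ENNReal.ofReal r) P) (hY : MemLp Y (ENNReal.ofReal r) P)
    (hN : MemLp N (ENNReal.ofReal r) P)
    (hind : IndepFun (fun ω => (S ω, Y ω)) N P) (hmean : ∫ ω, N ω ∂P = 0) :
    ∫ ω, |S ω + Y ω * N ω| ^ r ∂P ≤ ∫ ω, |S ω| ^ r ∂P + expansionConst r *
      ((T⁻¹ * ∫ ω, |S ω| ^ r ∂P + T ^ (r / 2 - 1) * ∫ ω, |Y ω| ^ r ∂P) * ∫ ω, N ω ^ 2 ∂P
        + (∫ ω, |Y ω| ^ r ∂P) * ∫ ω, |N ω| ^ r ∂P) := by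
  have hr0 : 0 < r := by linarith
  have hYN : IndepFun Y N P := hind.comp measurable_snd measurable_id
  have hE := expansionConst_pos hr
  have iS := integrable_abs_rpow hr0 hS
  have iY := integrable_abs_rpow hr0 hY
  have iN := integrable_abs_rpow hr0 hN
  have iN2 : Integrable (fun ω => N ω ^ 2) P := (MemLp_two_of_ofReal hr hN).integrable_sq
  have iN1 : Integrable N P := (MemLp_two_of_ofReal hr hN).integrable (by norm_num)
  have i1 := integrable_rpow_sub_two_mul_self_mul hr hS hY
  have i2 := integrable_rpow_sub_two_mul_sq hr hS hY
  have d1 : IndepFun (fun ω => (|S ω| ^ (r - 2) * S ω) * Y ω) N P :=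
    hind.comp (φ := fun z : ℝ × ℝ => (|z.1| ^ (r - 2) * z.1) * z.2) (ψ := id)
      (by fun_prop) measurable_id
  have d2 : IndepFun (fun ω => |S ω| ^ (r - 2) * Y ω ^ 2) (fun ω => N ω ^ 2) P :=
    hind.comp (φ := fun z : ℝ × ℝ => |z.1| ^ (r - 2) * z.2 ^ 2) (ψ := fun x => x ^ 2)
      (by fun_prop) (by fun_prop)
  have d3 : IndepFun (fun ω => |Y ω| ^ r) (fun ω => |N ω| ^ r) P :=
    hYN.comp (φ := fun x : ℝ => |x| ^ r) (ψ := fun x : ℝ => |x| ^ r) (by fun_prop) (by fun_prop)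
  have j1 := d1.integrable_mul i1 iN1
  have j2 := d2.integrable_mul i2 iN2
  have j3 := d3.integrable_mul iY iN
  have v1 := d1.integral_mul_eq_mul_integral i1.1 iN1.1
  have v2 := d2.integral_mul_eq_mul_integral i2.1 iN2.1
  have v3 := d3.integral_mul_eq_mul_integral iY.1 iN.1
  simp only [Pi.mul_def] at j1 j2 j3 v1 v2 v3
  have hle : ∀ ω, |S ω + Y ω * N ω| ^ r ≤ |S ω| ^ r
      + r * ((|S ω| ^ (r - 2) * S ω) * Y ω * N ω)
      + expansionConst r * (|S ω| ^ (r - 2) * Y ω ^ 2 * N ω ^ 2 + |Y ω| ^ r * |N ω| ^ r) := by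
    intro ω
    have := abs_add_rpow_le_expansion hr (S ω) (Y ω * N ω)
    rw [abs_mul, Real.mul_rpow (abs_nonneg _) (abs_nonneg _)] at this
    refine this.trans (le_of_eq (by ring))
  have hSYN : MemLp (fun ω => S ω + Y ω * N ω) (ENNReal.ofReal r) P :=
    hS.add (memLp_mul_of_indepFun hr0 hY hN hYN)
  have hint := integral_mono (integrable_abs_rpow hr0 hSYN)
    ((iS.add (j1.const_mul r)).add ((j2.add j3).const_mul (expansionConst r))) hle
  have hval : ∫ ω, (|S ω| ^ r + r * ((|S ω| ^ (r - 2) * S ω) * Y ω * N ω)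
      + expansionConst r * (|S ω| ^ (r - 2) * Y ω ^ 2 * N ω ^ 2 + |Y ω| ^ r * |N ω| ^ r)) ∂P
      = ∫ ω, |S ω| ^ r ∂P + expansionConst r *
        ((∫ ω, |S ω| ^ (r - 2) * Y ω ^ 2 ∂P) * (∫ ω, N ω ^ 2 ∂P)
          + (∫ ω, |Y ω| ^ r ∂P) * ∫ ω, |N ω| ^ r ∂P) := by
    have k1 : Integrable (fun ω => |S ω| ^ r + r * ((|S ω| ^ (r - 2) * S ω) * Y ω * N ω)) P :=
      iS.add (j1.const_mul r)
    have k2 : Integrable (fun ω => expansionConst r *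
        (|S ω| ^ (r - 2) * Y ω ^ 2 * N ω ^ 2 + |Y ω| ^ r * |N ω| ^ r)) P :=
      (j2.add j3).const_mul _
    rw [integral_add k1 k2, integral_add iS (j1.const_mul r), integral_const_mul, integral_const_mul,
      integral_add j2 j3, v1, v2, v3, hmean]
    ring
  have hyoung : ∫ ω, |S ω| ^ (r - 2) * Y ω ^ 2 ∂P
      ≤ T⁻¹ * ∫ ω, |S ω| ^ r ∂P + T ^ (r / 2 - 1) * ∫ ω, |Y ω| ^ r ∂P := by
    rw [← integral_const_mul, ← integral_const_mul,
      ← integral_add (iS.const_mul _) (iY.const_mul _)]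
    exact integral_mono i2 ((iS.const_mul _).add (iY.const_mul _))
      fun ω => rpow_sub_two_mul_sq_le hr hT _ _
  have hN2 : 0 ≤ ∫ ω, N ω ^ 2 ∂P := integral_nonneg fun ω => sq_nonneg _
  refine hint.trans (hval.le.trans ?_)
  gcongr

/-- A Rosenthal type bound for a martingale whose increments are products `Y_k N_k` of a
predictable factor and an independent centred factor with moments of order `δ`. -/
theorem integral_abs_sum_mul_rpow_le {r K δ T : ℝ} (hr : 2 ≤ r) (hK : 0 ≤ K) (hδ : 0 ≤ δ)
    (hT : 1 ≤ T) (n : ℕ) (hn : n * δ ≤ T) (Y N : ℕ → Ω → ℝ)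
    (hY : ∀ k < n, MemLp (Y k) (ENNReal.ofReal r) P)
    (hN : ∀ k < n, MemLp (N k) (ENNReal.ofReal r) P)
    (hind : ∀ k < n, IndepFun (fun ω => (∑ j ∈ Finset.range k, Y j ω * N j ω, Y k ω)) (N k) P)
    (hmean : ∀ k < n, ∫ ω, N k ω ∂P = 0)
    (hN2 : ∀ k < n, ∫ ω, N k ω ^ 2 ∂P ≤ K * δ)
    (hNr : ∀ k < n, ∫ ω, |N k ω| ^ r ∂P ≤ K * δ)
    (hYr : ∀ k < n, ∫ ω, |Y k ω| ^ r ∂P ≤ K) :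
    MemLp (fun ω => ∑ j ∈ Finset.range n, Y j ω * N j ω) (ENNReal.ofReal r) P ∧
    ∫ ω, |∑ j ∈ Finset.range n, Y j ω * N j ω| ^ r ∂P
      ≤ Real.exp (expansionConst r * (K + 2 * K ^ 2)) * T ^ (r / 2) := by
  have hr0 : 0 < r := by linarith
  have hT0 : 0 < T := by linarith
  have hE := expansionConst_pos hr
  set c := expansionConst r * (K + 2 * K ^ 2) with hc
  have hc0 : 0 ≤ c := by positivity
  set x := c * δ / T with hx
  have hx0 : 0 ≤ x := by positivity
  have hTr : 1 ≤ T ^ (r / 2 - 1) := Real.one_le_rpow hT (by linarith)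
  have hTT : T ^ (r / 2) = T ^ (r / 2 - 1) * T := by
    rw [← Real.rpow_add_one hT0.ne']; ring_nf
  have key : ∀ k ≤ n,
      MemLp (fun ω => ∑ j ∈ Finset.range k, Y j ω * N j ω) (ENNReal.ofReal r) P ∧
      ∫ ω, |∑ j ∈ Finset.range k, Y j ω * N j ω| ^ r ∂P ≤ T ^ (r / 2) * ((1 + x) ^ k - 1) := by
    intro k
    induction k with
    | zero =>
      intro _
      simp [Real.zero_rpow hr0.ne']
    | succ k ih =>
      intro hk
      obtain ⟨ih1, ih2⟩ := ih (by omega)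
      have hk' : k < n := by omega
      have hYN : IndepFun (Y k) (N k) P := (hind k hk').comp measurable_snd measurable_id
      simp only [Finset.sum_range_succ]
      refine ⟨ih1.add (memLp_mul_of_indepFun hr0 (hY k hk') (hN k hk') hYN), ?_⟩
      have step := integral_abs_add_mul_rpow_le hr hT0 ih1 (hY k hk') (hN k hk') (hind k hk')
        (hmean k hk')
      set e := ∫ ω, |∑ j ∈ Finset.range k, Y j ω * N j ω| ^ r ∂P with he
      set y := ∫ ω, |Y k ω| ^ r ∂P with hy
      have he0 : 0 ≤ e := integral_nonneg fun ω => by positivity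
      have hy0 : 0 ≤ y := integral_nonneg fun ω => by positivity
      have hyK := hYr k hk'
      have hA : (T⁻¹ * e + T ^ (r / 2 - 1) * y) * ∫ ω, N k ω ^ 2 ∂P
          ≤ (T⁻¹ * e + T ^ (r / 2 - 1) * K) * (K * δ) := by
        gcongr
        exact hN2 k hk'
      have hB : y * ∫ ω, |N k ω| ^ r ∂P ≤ K * (K * δ) := by
        gcongr
        exact hNr k hk'
      have hB' : K * (K * δ) ≤ T ^ (r / 2 - 1) * (K * (K * δ)) :=
        le_mul_of_one_le_left (by positivity) hTr
      have hD : e + expansionConst r *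
          ((T⁻¹ * e + T ^ (r / 2 - 1) * K) * (K * δ) + T ^ (r / 2 - 1) * (K * (K * δ)))
          ≤ e * (1 + x) + x * T ^ (r / 2) := by
        have h1 : x * T ^ (r / 2) = c * δ * T ^ (r / 2 - 1) := by
          rw [hTT, hx]; field_simp
        have h2 : e * x = c * δ * (T⁻¹ * e) := by rw [hx]; field_simp
        have h3 : 0 ≤ expansionConst r * K * δ * T ^ (r / 2 - 1) := by positivity
        have h4 : 0 ≤ expansionConst r * (2 * K ^ 2) * δ * (T⁻¹ * e) := by positivity
        rw [mul_add e, h1, h2, hc]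
        nlinarith
      have hfin : e * (1 + x) + x * T ^ (r / 2) ≤ T ^ (r / 2) * ((1 + x) ^ (k + 1) - 1) := by
        have := mul_le_mul_of_nonneg_right ih2 (show 0 ≤ 1 + x by linarith)
        rw [pow_succ]
        nlinarith
      refine step.trans (le_trans ?_ (hD.trans hfin))
      have hAB := mul_le_mul_of_nonneg_left (add_le_add hA (hB.trans hB')) hE.le
      linarith
  obtain ⟨h1, h2⟩ := key n le_rfl
  refine ⟨h1, h2.trans ?_⟩
  have h3 : (1 + x) ^ n ≤ Real.exp c := by
    calc (1 + x) ^ n ≤ Real.exp x ^ n := by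
          gcongr; rw [add_comm]; exact Real.add_one_le_exp x
      _ = Real.exp (n * x) := by rw [← Real.exp_nat_mul]
      _ ≤ Real.exp c := by
          apply Real.exp_le_exp.2
          rw [hx]
          have : (n : ℝ) * (c * δ / T) = c * (n * δ / T) := by ring
          rw [this]
          have h4 : n * δ / T ≤ 1 := by rw [div_le_one hT0]; exact hn
          nlinarith
  have h5 : 0 ≤ T ^ (r / 2) := by positivity
  nlinarith

/-- Moments of a sum of independent centred variables dominate the sum of the moments. -/
theorem sum_moment_le_moment_sum {r : ℝ} (hr : 2 ≤ r) (n : ℕ) (S : Ω → ℝ) (N : ℕ → Ω → ℝ)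
    (hS : MemLp S (ENNReal.ofReal r) P) (hN : ∀ k < n, MemLp (N k) (ENNReal.ofReal r) P)
    (hind : ∀ k < n, IndepFun (fun ω => S ω + ∑ j ∈ Finset.range k, N j ω) (N k) P)
    (hmean : ∀ k < n, ∫ ω, N k ω ∂P = 0) :
    ∑ k ∈ Finset.range n, 2 * ∫ ω, |N k ω / 2| ^ r ∂P
      ≤ ∫ ω, |S ω + ∑ j ∈ Finset.range n, N j ω| ^ r ∂P := by
  have hr0 : 0 < r := by linarith
  have key : ∀ k ≤ n, MemLp (fun ω => S ω + ∑ j ∈ Finset.range k, N j ω) (ENNReal.ofReal r) P ∧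
      ∑ j ∈ Finset.range k, 2 * ∫ ω, |N j ω / 2| ^ r ∂P
      ≤ ∫ ω, |S ω + ∑ j ∈ Finset.range k, N j ω| ^ r ∂P := by
    intro k
    induction k with
    | zero =>
      intro _
      simp only [Finset.range_zero, Finset.sum_empty, add_zero]
      exact ⟨hS, integral_nonneg fun ω => by positivity⟩
    | succ k ih =>
      intro hk
      obtain ⟨ih1, ih2⟩ := ih (by omega)
      have hk' : k < n := by omega
      simp only [Finset.sum_range_succ, ← add_assoc]
      have hsum := ih1.add (hN k hk')
      refine ⟨hsum, ?_⟩
      set Z : Ω → ℝ := fun ω => S ω + ∑ j ∈ Finset.range k, N j ω with hZ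
      have iN1 : Integrable (N k) P :=
        (MemLp_two_of_ofReal hr (hN k hk')).integrable (by norm_num)
      have iZ := integrable_abs_rpow hr0 ih1
      have i1 : Integrable (fun ω => |Z ω| ^ (r - 2) * Z ω) P := by
        have := integrable_rpow_sub_two_mul_self_mul hr ih1 (memLp_const (1 : ℝ))
        simpa using this
      have d1 : IndepFun (fun ω => |Z ω| ^ (r - 2) * Z ω) (N k) P :=
        (hind k hk').comp (φ := fun z : ℝ => |z| ^ (r - 2) * z) (ψ := id)
          (by fun_prop) measurable_id
      have j1 := d1.integrable_mul i1 iN1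
      have v1 := d1.integral_mul_eq_mul_integral i1.1 iN1.1
      have iN : Integrable (fun ω => |N k ω / 2| ^ r) P := by
        have := integrable_abs_rpow hr0 ((hN k hk').const_mul (1 / 2))
        refine this.congr (ae_of_all _ fun ω => ?_)
        simp only
        congr 2; ring
      simp only [Pi.mul_def] at j1 v1
      have hle : ∀ ω, |Z ω| ^ r + r * (|Z ω| ^ (r - 2) * Z ω * N k ω) + 2 * |N k ω / 2| ^ r
          ≤ |Z ω + N k ω| ^ r := fun ω => by
        have := abs_add_rpow_ge_expansion hr (Z ω) (N k ω)
        rw [mul_assoc] at this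
        exact this
      have hint := integral_mono ((iZ.add (j1.const_mul r)).add (iN.const_mul 2))
        (integrable_abs_rpow hr0 hsum) hle
      refine le_trans ?_ hint
      have hval : ∫ ω, (|Z ω| ^ r + r * (|Z ω| ^ (r - 2) * Z ω * N k ω) + 2 * |N k ω / 2| ^ r) ∂P
          = ∫ ω, |Z ω| ^ r ∂P + 2 * ∫ ω, |N k ω / 2| ^ r ∂P := by
        have k1 : Integrable (fun ω => |Z ω| ^ r + r * (|Z ω| ^ (r - 2) * Z ω * N k ω)) P :=
          iZ.add (j1.const_mul r)
        rw [integral_add k1 (iN.const_mul 2), integral_add iZ (j1.const_mul r), integral_const_mul, integral_const_mul, v1,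
          hmean k hk']
        ring
      exact le_trans (by gcongr) hval.ge
  exact (key n le_rfl).2

end Moments

end Trawl

namespace Trawl

/-! ### Moments of a Lévy basis -/

section Basis

lemma memLp_left_of_add {Ω : Type*} [MeasurableSpace Ω] {P : Measure Ω} [IsProbabilityMeasure P]
    {X Y : Ω → ℝ} {s : ℝ} (hs : 1 ≤ s) (hX : Measurable X) (hY : Measurable Y)
    (hind : IndepFun X Y P) (h : MemLp (fun ω => X ω + Y ω) (ENNReal.ofReal s) P) :
    MemLp X (ENNReal.ofReal s) P := by
  have hs0 : 0 < s := by linarith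
  obtain ⟨M, hM⟩ : ∃ M : ℕ, ¬ (fun ω => (Icc (-(M : ℝ)) M).indicator (fun _ => (1 : ℝ)) (Y ω))
      =ᵐ[P] 0 := by
    by_contra! hcon
    have hall := ae_all_iff.2 hcon
    obtain ⟨ω, hω⟩ := hall.exists
    obtain ⟨M, hM⟩ := exists_nat_ge |Y ω|
    have := hω M
    have hmem : Y ω ∈ Icc (-(M : ℝ)) M := abs_le.1 hM
    simp [hmem] at this
  have hind' : IndepFun (fun ω => |X ω| ^ s)
      (fun ω => (Icc (-(M : ℝ)) M).indicator (fun _ => (1 : ℝ)) (Y ω)) P :=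
    hind.comp (φ := fun x : ℝ => |x| ^ s)
      (ψ := (Icc (-(M : ℝ)) M).indicator (fun _ => (1 : ℝ))) (by fun_prop)
      (measurable_const.indicator measurableSet_Icc)
  have hmX : Measurable (fun ω => |X ω| ^ s) :=
    (show Measurable (fun x : ℝ => |x| ^ s) by fun_prop).comp hX
  have hmY : Measurable (fun ω => (Icc (-(M : ℝ)) M).indicator (fun _ => (1 : ℝ)) (Y ω)) :=
    (measurable_const.indicator measurableSet_Icc).comp hY
  rw [memLp_ofReal_iff hX.aestronglyMeasurable hs0]
  refine hind'.integrable_left_of_integrable_op (fun x y => x * y) 1 one_ne_zero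
    (fun x y => by simp [enorm_mul]) ?_ hmX.aestronglyMeasurable hmY.aestronglyMeasurable hM
  have hdom : Integrable (fun ω => 2 ^ (s - 1) * (|X ω + Y ω| ^ s + (M : ℝ) ^ s)) P :=
    ((integrable_abs_rpow hs0 h).add (integrable_const _)).const_mul _
  refine hdom.mono' (hmX.mul hmY).aestronglyMeasurable (ae_of_all _ fun ω => ?_)
  by_cases hy : Y ω ∈ Icc (-(M : ℝ)) M
  · rw [indicator_of_mem hy, mul_one, Real.norm_of_nonneg (by positivity)]
    have h1 := rpow_add_le_two s hs (X ω + Y ω) (-Y ω)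
    rw [add_neg_cancel_right, abs_neg] at h1
    have h2 : |Y ω| ^ s ≤ (M : ℝ) ^ s := Real.rpow_le_rpow (abs_nonneg _) (abs_le.2 hy) hs0.le
    refine h1.trans ?_
    gcongr
  · rw [indicator_of_notMem hy, mul_zero, norm_zero]
    positivity

/-- A nonnegative additive function on `[0, ∞)` is linear. -/
lemma additive_nonneg_eq {f : ℝ → ℝ} (h0 : ∀ v, 0 ≤ v → 0 ≤ f v)
    (hadd : ∀ v w, 0 ≤ v → 0 ≤ w → f (v + w) = f v + f w) (h1 : f 1 = 1) {v : ℝ} (hv : 0 ≤ v) :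
    f v = v := by
  have hzero : f 0 = 0 := by have := hadd 0 0 le_rfl le_rfl; simp at this; exact this
  have hmul : ∀ (k : ℕ) (w : ℝ), 0 ≤ w → f (k * w) = k * f w := by
    intro k w hw
    induction k with
    | zero => simp [hzero]
    | succ k ih =>
      have : ((k + 1 : ℕ) : ℝ) * w = k * w + w := by push_cast; ring
      rw [this, hadd _ _ (by positivity) hw, ih]; push_cast; ring
  have hnat : ∀ k : ℕ, f k = k := fun k => by
    have := hmul k 1 zero_le_one
    rwa [mul_one, h1, mul_one] at this
  have hmono : ∀ u w, 0 ≤ u → u ≤ w → f u ≤ f w := fun u w hu huw => by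
    have := hadd u (w - u) hu (by linarith)
    rw [add_sub_cancel] at this
    have := h0 (w - u) (by linarith)
    linarith
  have hbound : ∀ k : ℕ, (k : ℝ) * |f v - v| ≤ 1 := by
    intro k
    have hkv : 0 ≤ (k : ℝ) * v := by positivity
    have a1 := Nat.floor_le hkv
    have a2 := Nat.lt_floor_add_one ((k : ℝ) * v)
    have b1 := hmono _ _ (by positivity) a1
    have b2 := hmono _ _ hkv a2.le
    have e : ((⌊(k : ℝ) * v⌋₊ : ℝ) + 1) = ((⌊(k : ℝ) * v⌋₊ + 1 : ℕ) : ℝ) := by push_cast; ring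
    rw [e, hnat] at b2
    rw [hnat] at b1
    rw [hmul k v hv] at b1 b2
    push_cast at b2
    rw [← abs_of_nonneg (Nat.cast_nonneg (α := ℝ) k), ← abs_mul, abs_le]
    constructor <;> nlinarith
  by_contra hne
  have hpos : 0 < |f v - v| := abs_pos.2 (sub_ne_zero.2 hne)
  obtain ⟨k, hk⟩ := exists_nat_gt (1 / |f v - v|)
  rw [div_lt_iff₀ hpos] at hk
  linarith [hbound k]

/-- The rectangle `[u, v) × [0, 1)`. -/
def strip (u v : ℝ) : Set (ℝ × ℝ) := Ico u v ×ˢ Ico 0 1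

lemma measurableSet_strip (u v : ℝ) : MeasurableSet (strip u v) :=
  measurableSet_Ico.prod measurableSet_Ico

lemma isBounded_strip (u v : ℝ) : Bornology.IsBounded (strip u v) :=
  (Metric.isBounded_Ico u v).prod (Metric.isBounded_Ico 0 1)

lemma volume_strip {u v : ℝ} (h : u ≤ v) : (volume (strip u v)).toReal = v - u := by
  rw [strip, Measure.volume_eq_prod, Measure.prod_prod]
  simp [Real.volume_Ico, h]

lemma strip_union {u v w : ℝ} (h : u ≤ v) (h' : v ≤ w) : strip u v ∪ strip v w = strip u w := by
  rw [strip, strip, strip, ← Set.union_prod, Ico_union_Ico_eq_Ico h h']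

lemma strip_disjoint {u v w x : ℝ} (h : v ≤ w) : Disjoint (strip u v) (strip w x) := by
  refine Set.disjoint_left.2 fun z hz hz' => ?_
  have h1 := hz.1.2
  have h2 := hz'.1.1
  linarith

variable {Ω : Type*} [MeasurableSpace Ω] {P : Measure Ω}
  {τ : Triplet} {L : Set (ℝ × ℝ) → Ω → ℝ}

namespace IsLevyBasis

lemma iIndepFun_of_countable {ι : Type*} (e : ι ≃ ℕ) (hL : IsLevyBasis P τ L)
    (C : ι → Set (ℝ × ℝ)) (hC : ∀ i, MeasurableSet (C i))
    (hCb : ∀ i, Bornology.IsBounded (C i))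
    (hd : Pairwise (fun i j => Disjoint (C i) (C j))) : iIndepFun (fun i => L (C i)) P := by
  have h := hL.independent (fun k => C (e.symm k)) (fun _ => hC _) (fun _ => hCb _)
    (fun i j hij => hd (fun h => hij (e.symm.injective h)))
  have := h.precomp e.injective
  simpa using this

lemma indepFun (hL : IsLevyBasis P τ L) {A B : Set (ℝ × ℝ)} (hA : MeasurableSet A)
    (hAb : Bornology.IsBounded A) (hB : MeasurableSet B) (hBb : Bornology.IsBounded B)
    (hd : Disjoint A B) : IndepFun (L A) (L B) P := by
  let C : ℕ → Set (ℝ × ℝ) := fun i => if i = 0 then A else if i = 1 then B else ∅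
  have hCm : ∀ i, MeasurableSet (C i) := fun i => by
    simp only [C]; split_ifs <;> simp [hA, hB]
  have hCb : ∀ i, Bornology.IsBounded (C i) := fun i => by
    simp only [C]; split_ifs <;> simp [hAb, hBb]
  have hdis : Pairwise (fun i j => Disjoint (C i) (C j)) := by
    intro i j hij
    simp only [C]
    split_ifs <;> simp_all [hd.symm]
  have h := (hL.independent C hCm hCb hdis).indepFun (i := 0) (j := 1) (by norm_num)
  simpa [C] using h

variable [IsProbabilityMeasure P]

lemma map_eq (hL : IsLevyBasis P τ L) {B C : Set (ℝ × ℝ)} (hB : MeasurableSet B)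
    (hBb : Bornology.IsBounded B) (hC : MeasurableSet C) (hCb : Bornology.IsBounded C)
    (h : (volume B).toReal = (volume C).toReal) : P.map (L B) = P.map (L C) := by
  have := Measure.isProbabilityMeasure_map (μ := P) (hL.measurable B hB hBb).aemeasurable
  have := Measure.isProbabilityMeasure_map (μ := P) (hL.measurable C hC hCb).aemeasurable
  refine Measure.ext_of_charFun (funext fun z => ?_)
  rw [hL.charFun_eq B hB hBb, hL.charFun_eq C hC hCb, h]

lemma map_eq_seed (hL : IsLevyBasis P τ L) {seed : Measure ℝ} (hseed : τ.IsSeedLaw seed)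
    {B : Set (ℝ × ℝ)} (hB : MeasurableSet B) (hBb : Bornology.IsBounded B)
    (h : (volume B).toReal = 1) : P.map (L B) = seed := by
  have := Measure.isProbabilityMeasure_map (μ := P) (hL.measurable B hB hBb).aemeasurable
  have := hseed.1
  refine Measure.ext_of_charFun (funext fun z => ?_)
  rw [hL.charFun_eq B hB hBb, hseed.2, h]
  simp

lemma null (hL : IsLevyBasis P τ L) {B : Set (ℝ × ℝ)} (hB : MeasurableSet B)
    (hBb : Bornology.IsBounded B) (h : (volume B).toReal = 0) : ∀ᵐ ω ∂P, L B ω = 0 := by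
  have hm := hL.measurable B hB hBb
  have := Measure.isProbabilityMeasure_map (μ := P) hm.aemeasurable
  have hd : P.map (L B) = Measure.dirac 0 := by
    refine Measure.ext_of_charFun (funext fun z => ?_)
    rw [hL.charFun_eq B hB hBb, h, charFun_dirac]
    simp
  have h1 : ∀ᵐ x ∂(P.map (L B)), x = 0 := by
    rw [hd, ae_dirac_eq]; simp
  exact ae_of_ae_map hm.aemeasurable h1

lemma union (hL : IsLevyBasis P τ L) {A B : Set (ℝ × ℝ)} (hA : MeasurableSet A)
    (hAb : Bornology.IsBounded A) (hB : MeasurableSet B) (hBb : Bornology.IsBounded B)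
    (hd : Disjoint A B) : ∀ᵐ ω ∂P, L (A ∪ B) ω = L A ω + L B ω := by
  let C : ℕ → Set (ℝ × ℝ) := fun i => if i = 0 then A else if i = 1 then B else ∅
  have hU : ⋃ i, C i = A ∪ B := by
    ext x
    simp only [C, mem_iUnion, mem_union]
    constructor
    · rintro ⟨i, hi⟩
      split_ifs at hi with h1 h2
      · exact Or.inl hi
      · exact Or.inr hi
      · exact hi.elim
    · rintro (h | h)
      · exact ⟨0, by simpa using h⟩
      · exact ⟨1, by simpa using h⟩
  have hCm : ∀ i, MeasurableSet (C i) := fun i => by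
    simp only [C]; split_ifs <;> simp [hA, hB]
  have hdis : Pairwise (fun i j => Disjoint (C i) (C j)) := by
    intro i j hij
    simp only [C]
    split_ifs <;> simp_all [hd.symm]
  have h1 := hL.additive C hCm (by rw [hU]; exact hAb.union hBb) hdis
  have h2 := hL.null MeasurableSet.empty Bornology.isBounded_empty (by simp)
  rw [hU] at h1
  filter_upwards [h1, h2] with ω h1 h2
  refine tendsto_nhds_unique h1 (tendsto_const_nhds.congr' ?_)
  filter_upwards [eventually_ge_atTop 2] with N hN
  obtain ⟨k, rfl⟩ := Nat.exists_eq_add_of_le hN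
  rw [Finset.sum_range_add]
  have hz : ∀ x : ℕ, C (2 + x) = ∅ := fun x => by
    simp only [C]
    rw [if_neg (by omega), if_neg (by omega)]
  simp [Finset.sum_range_succ, hz, h2]
  simp [C]

lemma biUnion {ι : Type*} (hL : IsLevyBasis P τ L) (C : ι → Set (ℝ × ℝ))
    (hC : ∀ i, MeasurableSet (C i)) (hCb : ∀ i, Bornology.IsBounded (C i))
    (hd : Pairwise (fun i j => Disjoint (C i) (C j))) (s : Finset ι) :
    ∀ᵐ ω ∂P, L (⋃ i ∈ s, C i) ω = ∑ i ∈ s, L (C i) ω := by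
  classical
  induction s using Finset.induction_on with
  | empty =>
    simpa using hL.null MeasurableSet.empty Bornology.isBounded_empty (by simp)
  | insert a s ha ih =>
    have h1 := hL.union (hC a) (hCb a) (Finset.measurableSet_biUnion s fun i _ => hC i)
      ((Bornology.isBounded_biUnion s.finite_toSet).2 fun i _ => hCb i)
      (by
        rw [disjoint_iUnion₂_right]
        intro i hi
        exact hd (fun h => ha (h ▸ hi)))
    filter_upwards [ih, h1] with ω h2 h1
    rw [Finset.set_biUnion_insert, h1, Finset.sum_insert ha, h2]

lemma integral_comp_eq (hL : IsLevyBasis P τ L) {B C : Set (ℝ × ℝ)} (hB : MeasurableSet B)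
    (hBb : Bornology.IsBounded B) (hC : MeasurableSet C) (hCb : Bornology.IsBounded C)
    (h : (volume B).toReal = (volume C).toReal) {f : ℝ → ℝ} (hf : Measurable f) :
    ∫ ω, f (L B ω) ∂P = ∫ ω, f (L C ω) ∂P := by
  rw [← integral_map (hL.measurable B hB hBb).aemeasurable hf.aestronglyMeasurable,
    ← integral_map (hL.measurable C hC hCb).aemeasurable hf.aestronglyMeasurable,
    hL.map_eq hB hBb hC hCb h]

lemma memLp_congr_volume (hL : IsLevyBasis P τ L) {B C : Set (ℝ × ℝ)} (hB : MeasurableSet B)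
    (hBb : Bornology.IsBounded B) (hC : MeasurableSet C) (hCb : Bornology.IsBounded C)
    (h : (volume B).toReal = (volume C).toReal) {s : ENNReal} (hC' : MemLp (L C) s P) :
    MemLp (L B) s P := by
  have hmB := (hL.measurable B hB hBb).aemeasurable (μ := P)
  have hmC := (hL.measurable C hC hCb).aemeasurable (μ := P)
  have h1 : MemLp id s (P.map (L C)) :=
    (memLp_map_measure_iff aestronglyMeasurable_id hmC).2 hC'
  rw [← hL.map_eq hB hBb hC hCb h] at h1
  exact (memLp_map_measure_iff aestronglyMeasurable_id hmB).1 h1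

lemma memLp_strip_nat (hL : IsLevyBasis P τ L) {seed : Measure ℝ} (hseed : τ.IsSeedLaw seed)
    {s : ℝ} (hs : 1 ≤ s) (hmom : Integrable (fun x : ℝ => |x| ^ s) seed) (N : ℕ) :
    MemLp (L (strip 0 N)) (ENNReal.ofReal s) P := by
  induction N with
  | zero =>
    have h0 := hL.null (measurableSet_strip 0 ((0 : ℕ) : ℝ)) (isBounded_strip _ _)
      (by rw [volume_strip (by simp)]; simp)
    exact (MemLp.zero (ε := ℝ)).ae_eq (h0.mono fun ω h => h.symm)
  | succ N ih =>
    have hN : (0 : ℝ) ≤ N := by positivity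
    have hN1 : (N : ℝ) ≤ (N + 1 : ℕ) := by push_cast; linarith
    have hone : MemLp (L (strip N (N + 1 : ℕ))) (ENNReal.ofReal s) P := by
      have hm := hL.measurable _ (measurableSet_strip N (N + 1 : ℕ)) (isBounded_strip _ _)
      have hmap := hL.map_eq_seed hseed (measurableSet_strip N (N + 1 : ℕ)) (isBounded_strip _ _)
        (by rw [volume_strip hN1]; push_cast; ring)
      rw [memLp_ofReal_iff hm.aestronglyMeasurable (by linarith)]
      rw [← hmap] at hmom
      exact (integrable_map_measure
        (show Measurable (fun x : ℝ => |x| ^ s) by fun_prop).aestronglyMeasurable hm.aemeasurable).1 hmom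
    have h1 := hL.union (measurableSet_strip 0 N) (isBounded_strip _ _)
      (measurableSet_strip N (N + 1 : ℕ)) (isBounded_strip _ _) (strip_disjoint le_rfl)
    rw [strip_union hN hN1] at h1
    exact (ih.add hone).ae_eq (h1.mono fun ω h => h.symm)

/-- `L(B)` inherits the moments of the seed. -/
lemma memLp (hL : IsLevyBasis P τ L) {seed : Measure ℝ} (hseed : τ.IsSeedLaw seed)
    {s : ℝ} (hs : 1 ≤ s) (hmom : Integrable (fun x : ℝ => |x| ^ s) seed)
    {B : Set (ℝ × ℝ)} (hB : MeasurableSet B) (hBb : Bornology.IsBounded B) :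
    MemLp (L B) (ENNReal.ofReal s) P := by
  set v := (volume B).toReal with hv
  have hv0 : 0 ≤ v := ENNReal.toReal_nonneg
  obtain ⟨N, hN⟩ := exists_nat_ge v
  refine hL.memLp_congr_volume hB hBb (measurableSet_strip 0 v) (isBounded_strip _ _)
    (by rw [volume_strip hv0, ← hv, sub_zero]) ?_
  have h1 := hL.union (measurableSet_strip 0 v) (isBounded_strip _ _)
    (measurableSet_strip v N) (isBounded_strip _ _) (strip_disjoint le_rfl)
  rw [strip_union hv0 hN] at h1
  refine memLp_left_of_add hs (hL.measurable _ (measurableSet_strip _ _) (isBounded_strip _ _))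
    (hL.measurable _ (measurableSet_strip v N) (isBounded_strip _ _))
    (hL.indepFun (measurableSet_strip 0 v) (isBounded_strip _ _)
      (measurableSet_strip v N) (isBounded_strip _ _) (strip_disjoint le_rfl)) ?_
  exact (hL.memLp_strip_nat hseed hs hmom N).ae_eq h1

end IsLevyBasis

end Basis

end Trawl

namespace Trawl

section Basis

variable {Ω : Type*} [MeasurableSpace Ω] {P : Measure Ω}
  {τ : Triplet} {L : Set (ℝ × ℝ) → Ω → ℝ}

lemma Triplet.exponent_zero (τ : Triplet) : τ.exponent 0 = 0 := by
  simp [Triplet.exponent]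

lemma hasDerivAt_charFun_zero {μ : Measure ℝ} [IsProbabilityMeasure μ] (h : MemLp id 1 μ) :
    HasDerivAt (charFun μ) (Complex.I * (∫ x, x ∂μ : ℝ)) 0 := by
  have h1 : MemLp id ((1 : ℕ) : ENNReal) μ := by simpa using h
  have hd : DifferentiableAt ℝ (charFun μ) 0 :=
    ((contDiff_charFun h1).differentiable (by norm_num)).differentiableAt
  have := hd.hasDerivAt
  have hv := iteratedDeriv_charFun_zero h1
  rw [iteratedDeriv_one] at hv
  rw [hv] at this
  simpa using this

lemma mul_integral_exp (c : ℂ) : c * ∫ v in (0 : ℝ)..1, Complex.exp (v * c) = Complex.exp c - 1 := by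
  rcases eq_or_ne c 0 with rfl | hc
  · simp
  · have h := integral_exp_mul_complex (a := 0) (b := 1) hc
    have e : (fun v : ℝ => Complex.exp (v * c)) = fun v : ℝ => Complex.exp (c * v) := by
      funext v; rw [mul_comm]
    rw [e, h]
    field_simp
    simp

namespace IsLevyBasis

/-- The mean of `L` per unit of volume. -/
noncomputable def meanRate (_ : IsLevyBasis P τ L) : ℝ := ∫ ω, L (strip 0 1) ω ∂P

/-- The centred Lévy basis. -/
noncomputable def centred (hL : IsLevyBasis P τ L) (B : Set (ℝ × ℝ)) (ω : Ω) : ℝ :=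
  L B ω - (volume B).toReal * hL.meanRate

lemma measurable_centred (hL : IsLevyBasis P τ L) {B : Set (ℝ × ℝ)} (hB : MeasurableSet B)
    (hBb : Bornology.IsBounded B) : Measurable (hL.centred B) :=
  (hL.measurable B hB hBb).sub_const _

lemma indepFun_centred (hL : IsLevyBasis P τ L) {A B : Set (ℝ × ℝ)} (hA : MeasurableSet A)
    (hAb : Bornology.IsBounded A) (hB : MeasurableSet B) (hBb : Bornology.IsBounded B)
    (hd : Disjoint A B) : IndepFun (hL.centred A) (hL.centred B) P :=
  (hL.indepFun hA hAb hB hBb hd).comp (φ := fun x => x - (volume A).toReal * hL.meanRate)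
    (ψ := fun x => x - (volume B).toReal * hL.meanRate) (by fun_prop) (by fun_prop)

variable [IsProbabilityMeasure P]

lemma memLp_one_map (hL : IsLevyBasis P τ L) {seed : Measure ℝ} (hseed : τ.IsSeedLaw seed)
    (hmom : Integrable (fun x : ℝ => |x| ^ (2 : ℝ)) seed)
    {B : Set (ℝ × ℝ)} (hB : MeasurableSet B) (hBb : Bornology.IsBounded B) :
    MemLp id 1 (P.map (L B)) := by
  have h := hL.memLp hseed one_le_two hmom hB hBb
  refine (memLp_map_measure_iff aestronglyMeasurable_id
    (hL.measurable B hB hBb).aemeasurable).2 ?_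
  refine h.mono_exponent ?_
  simp

lemma hasDerivAt_exp_exponent (hL : IsLevyBasis P τ L) {seed : Measure ℝ}
    (hseed : τ.IsSeedLaw seed) (hmom : Integrable (fun x : ℝ => |x| ^ (2 : ℝ)) seed)
    {B : Set (ℝ × ℝ)} (hB : MeasurableSet B) (hBb : Bornology.IsBounded B) :
    HasDerivAt (fun z : ℝ => Complex.exp ((volume B).toReal * τ.exponent z))
      (Complex.I * (∫ ω, L B ω ∂P : ℝ)) 0 := by
  have hm := (hL.measurable B hB hBb).aemeasurable (μ := P)
  have := Measure.isProbabilityMeasure_map hm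
  have h := hasDerivAt_charFun_zero (hL.memLp_one_map hseed hmom hB hBb)
  rw [integral_map hm (by fun_prop)] at h
  have e : charFun (P.map (L B)) = fun z : ℝ => Complex.exp ((volume B).toReal * τ.exponent z) :=
    funext fun z => hL.charFun_eq B hB hBb z
  rwa [e] at h

lemma hasDerivAt_exponent (hL : IsLevyBasis P τ L) {seed : Measure ℝ}
    (hseed : τ.IsSeedLaw seed) (hmom : Integrable (fun x : ℝ => |x| ^ (2 : ℝ)) seed) :
    HasDerivAt τ.exponent (Complex.I * (∫ ω, L (strip 0 1) ω ∂P : ℝ)) 0 := by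
  have hvol : ∀ v : ℝ, 0 ≤ v → (volume (strip 0 v)).toReal = v := fun v hv => by
    rw [volume_strip hv, sub_zero]
  have hd : ∀ v : ℝ, 0 ≤ v → HasDerivAt (fun z : ℝ => Complex.exp (v * τ.exponent z))
      (Complex.I * (∫ ω, L (strip 0 v) ω ∂P : ℝ)) 0 := fun v hv => by
    have := hL.hasDerivAt_exp_exponent hseed hmom (measurableSet_strip 0 v) (isBounded_strip _ _)
    rwa [hvol v hv] at this
  have hnorm : ∀ v : ℝ, 0 ≤ v → ∀ z, ‖Complex.exp (v * τ.exponent z)‖ ≤ 1 := fun v hv z => by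
    have hm := hL.measurable _ (measurableSet_strip 0 v) (isBounded_strip _ _)
    have := Measure.isProbabilityMeasure_map (μ := P) hm.aemeasurable
    have h := norm_charFun_le_one (μ := P.map (L (strip 0 v))) z
    rwa [hL.charFun_eq _ (measurableSet_strip 0 v) (isBounded_strip _ _), hvol v hv] at h
  have hI : Tendsto (fun z : ℝ => ∫ v in (0 : ℝ)..1, Complex.exp (v * τ.exponent z)) (𝓝 0)
      (𝓝 1) := by
    have h1 : Tendsto (fun z : ℝ => ∫ v in (0 : ℝ)..1, Complex.exp (v * τ.exponent z)) (𝓝 0)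
        (𝓝 (∫ v in (0 : ℝ)..1, (1 : ℂ))) := by
      refine intervalIntegral.tendsto_integral_filter_of_dominated_convergence (fun _ => 1)
        (Eventually.of_forall fun z => ?_) (Eventually.of_forall fun z => ?_) (by simp) ?_
      · exact Continuous.aestronglyMeasurable (by fun_prop)
      · refine ae_of_all _ fun v hv => hnorm v ?_ z
        rw [uIoc_of_le zero_le_one] at hv
        exact hv.1.le
      · refine ae_of_all _ fun v hv => ?_
        rw [uIoc_of_le zero_le_one] at hv
        have := (hd v hv.1.le).continuousAt.tendsto
        rwa [τ.exponent_zero, mul_zero, Complex.exp_zero] at this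
    simpa using h1
  have h1 := hasDerivAt_iff_tendsto_slope.1 (hd 1 zero_le_one)
  rw [hasDerivAt_iff_tendsto_slope]
  have h2 := h1.div (hI.mono_left nhdsWithin_le_nhds) one_ne_zero
  rw [div_one] at h2
  refine h2.congr' ?_
  have hne := (hI.mono_left nhdsWithin_le_nhds : Tendsto _ (𝓝[≠] (0 : ℝ)) _).eventually_ne
    one_ne_zero
  filter_upwards [hne] with z hz
  rw [Pi.div_apply, div_eq_iff hz, slope_def_module, slope_def_module]
  simp only [Complex.ofReal_one, one_mul, τ.exponent_zero, Complex.exp_zero, sub_zero]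
  rw [← mul_integral_exp, smul_mul_assoc]

/-- The mean of `L(B)` is proportional to the volume of `B`. -/
lemma integral_eq (hL : IsLevyBasis P τ L) {seed : Measure ℝ}
    (hseed : τ.IsSeedLaw seed) (hmom : Integrable (fun x : ℝ => |x| ^ (2 : ℝ)) seed)
    {B : Set (ℝ × ℝ)} (hB : MeasurableSet B) (hBb : Bornology.IsBounded B) :
    ∫ ω, L B ω ∂P = (volume B).toReal * ∫ ω, L (strip 0 1) ω ∂P := by
  have h1 := hL.hasDerivAt_exp_exponent hseed hmom hB hBb
  have h2 := ((hL.hasDerivAt_exponent hseed hmom).const_mul ((volume B).toReal : ℂ)).cexp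
  have h3 := h1.unique h2
  rw [τ.exponent_zero, mul_zero, Complex.exp_zero, one_mul] at h3
  have h4 : Complex.I * ((∫ ω, L B ω ∂P : ℝ) : ℂ)
      = Complex.I * (((volume B).toReal * ∫ ω, L (strip 0 1) ω ∂P : ℝ) : ℂ) := by
    rw [h3]; push_cast; ring
  exact_mod_cast mul_left_cancel₀ Complex.I_ne_zero h4

lemma variance_eq (hL : IsLevyBasis P τ L) {seed : Measure ℝ}
    (hseed : τ.IsSeedLaw seed) (hmom : Integrable (fun x : ℝ => |x| ^ (2 : ℝ)) seed)
    (hvar : Var[id; seed] = 1)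
    {B : Set (ℝ × ℝ)} (hB : MeasurableSet B) (hBb : Bornology.IsBounded B) :
    Var[L B; P] = (volume B).toReal := by
  have hvol : ∀ v : ℝ, 0 ≤ v → (volume (strip 0 v)).toReal = v := fun v hv => by
    rw [volume_strip hv, sub_zero]
  have hlaw : ∀ C D : Set (ℝ × ℝ), MeasurableSet C → Bornology.IsBounded C → MeasurableSet D →
      Bornology.IsBounded D → (volume C).toReal = (volume D).toReal →
      Var[L C; P] = Var[L D; P] := fun C D hC hCb hD hDb h => by
    rw [← variance_id_map (hL.measurable C hC hCb).aemeasurable,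
      ← variance_id_map (hL.measurable D hD hDb).aemeasurable, hL.map_eq hC hCb hD hDb h]
  have hv0 : 0 ≤ (volume B).toReal := ENNReal.toReal_nonneg
  rw [hlaw B (strip 0 (volume B).toReal) hB hBb (measurableSet_strip _ _) (isBounded_strip _ _)
    (hvol _ hv0).symm]
  refine additive_nonneg_eq (f := fun v => Var[L (strip 0 v); P])
    (fun v _ => variance_nonneg _ _) (fun v w hv hw => ?_) ?_ hv0
  · have h1 := hL.union (measurableSet_strip 0 v) (isBounded_strip _ _)
      (measurableSet_strip v (v + w)) (isBounded_strip _ _) (strip_disjoint le_rfl)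
    rw [strip_union hv (by linarith)] at h1
    have hM : ∀ u v, MemLp (L (strip u v)) 2 P := fun u v =>
      MemLp_two_of_ofReal le_rfl
        (hL.memLp hseed one_le_two hmom (measurableSet_strip u v) (isBounded_strip _ _))
    rw [variance_congr h1, hlaw (strip 0 w) (strip v (v + w)) (measurableSet_strip _ _)
      (isBounded_strip _ _) (measurableSet_strip _ _) (isBounded_strip _ _)
      (by rw [volume_strip hw, volume_strip (by linarith)]; ring)]
    exact IndepFun.variance_fun_add (hM _ _) (hM _ _)
      (hL.indepFun (measurableSet_strip 0 v) (isBounded_strip _ _)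
      (measurableSet_strip v (v + w)) (isBounded_strip _ _) (strip_disjoint le_rfl))
  · rw [← variance_id_map (hL.measurable _ (measurableSet_strip _ _)
      (isBounded_strip _ _)).aemeasurable, hL.map_eq_seed hseed (measurableSet_strip _ _)
      (isBounded_strip _ _) (hvol 1 zero_le_one), hvar]

lemma memLp_centred (hL : IsLevyBasis P τ L) {seed : Measure ℝ} (hseed : τ.IsSeedLaw seed)
    {s : ℝ} (hs : 1 ≤ s) (hmom : Integrable (fun x : ℝ => |x| ^ s) seed)
    {B : Set (ℝ × ℝ)} (hB : MeasurableSet B) (hBb : Bornology.IsBounded B) :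
    MemLp (hL.centred B) (ENNReal.ofReal s) P :=
  (hL.memLp hseed hs hmom hB hBb).sub (memLp_const _)

lemma integral_centred (hL : IsLevyBasis P τ L) {seed : Measure ℝ} (hseed : τ.IsSeedLaw seed)
    (hmom : Integrable (fun x : ℝ => |x| ^ (2 : ℝ)) seed)
    {B : Set (ℝ × ℝ)} (hB : MeasurableSet B) (hBb : Bornology.IsBounded B) :
    ∫ ω, hL.centred B ω ∂P = 0 := by
  have hi : Integrable (L B) P :=
    (MemLp_two_of_ofReal le_rfl (hL.memLp hseed one_le_two hmom hB hBb)).integrable (by norm_num)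
  unfold centred
  rw [integral_sub hi (integrable_const _), hL.integral_eq hseed hmom hB hBb]
  simp [meanRate]

lemma integral_centred_sq (hL : IsLevyBasis P τ L) {seed : Measure ℝ} (hseed : τ.IsSeedLaw seed)
    (hmom : Integrable (fun x : ℝ => |x| ^ (2 : ℝ)) seed) (hvar : Var[id; seed] = 1)
    {B : Set (ℝ × ℝ)} (hB : MeasurableSet B) (hBb : Bornology.IsBounded B) :
    ∫ ω, hL.centred B ω ^ 2 ∂P = (volume B).toReal := by
  rw [← hL.variance_eq hseed hmom hvar hB hBb,
    variance_eq_integral (hL.measurable B hB hBb).aemeasurable,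
    hL.integral_eq hseed hmom hB hBb]
  rfl

lemma centred_union (hL : IsLevyBasis P τ L) {A B : Set (ℝ × ℝ)} (hA : MeasurableSet A)
    (hAb : Bornology.IsBounded A) (hB : MeasurableSet B) (hBb : Bornology.IsBounded B)
    (hd : Disjoint A B) :
    ∀ᵐ ω ∂P, hL.centred (A ∪ B) ω = hL.centred A ω + hL.centred B ω := by
  filter_upwards [hL.union hA hAb hB hBb hd] with ω h
  rw [centred, centred, centred, h, measure_union hd hB,
    ENNReal.toReal_add hAb.measure_lt_top.ne hBb.measure_lt_top.ne]
  ring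

lemma centred_null (hL : IsLevyBasis P τ L) {B : Set (ℝ × ℝ)} (hB : MeasurableSet B)
    (hBb : Bornology.IsBounded B) (h : (volume B).toReal = 0) :
    ∀ᵐ ω ∂P, hL.centred B ω = 0 := by
  filter_upwards [hL.null hB hBb h] with ω h'
  rw [centred, h', h]; ring

/-- Moments of order at least two of `L(B)`, centred, are of the order of the volume of `B`. -/
theorem exists_moment_le (hL : IsLevyBasis P τ L) {seed : Measure ℝ} (hseed : τ.IsSeedLaw seed)
    {s : ℝ} (hs : 2 ≤ s) (hmom2 : Integrable (fun x : ℝ => |x| ^ (2 : ℝ)) seed)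
    (hmom : Integrable (fun x : ℝ => |x| ^ s) seed) (V : ℝ) :
    ∃ K : ℝ, 0 ≤ K ∧ ∀ B, MeasurableSet B → Bornology.IsBounded B → (volume B).toReal ≤ V →
      ∫ ω, |hL.centred B ω| ^ s ∂P ≤ K * (volume B).toReal := by
  have hs0 : 0 < s := by linarith
  obtain ⟨N, hN⟩ := exists_nat_ge (max V 1)
  have hNV : V ≤ N := (le_max_left _ _).trans hN
  have hN1 : (1 : ℝ) ≤ N := (le_max_right _ _).trans hN
  have hms := measurableSet_strip
  have hbs := isBounded_strip
  set KN := ∫ ω, |hL.centred (strip 0 N) ω| ^ s ∂P with hKN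
  have hKN0 : 0 ≤ KN := integral_nonneg fun ω => by positivity
  refine ⟨2 ^ s * KN / N, by positivity, fun B hB hBb hBV => ?_⟩
  set v := (volume B).toReal with hv
  have hv0 : 0 ≤ v := ENNReal.toReal_nonneg
  rcases hv0.eq_or_lt with h0 | hvpos
  · have h1 : ∫ ω, |hL.centred B ω| ^ s ∂P = ∫ _, (0 : ℝ) ∂P := by
      refine integral_congr_ae ((hL.centred_null hB hBb (by rw [← hv, ← h0])).mono fun ω h => ?_)
      simp [h, Real.zero_rpow hs0.ne']
    rw [h1, ← h0]; simp
  have hcomp : ∀ u, ∫ ω, |hL.centred (strip u (u + v)) ω| ^ s ∂P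
      = ∫ ω, |hL.centred B ω| ^ s ∂P := fun u => by
    have hvol : (volume (strip u (u + v))).toReal = v := by
      rw [volume_strip (by linarith)]; ring
    have := hL.integral_comp_eq (hms u (u + v)) (hbs _ _) hB hBb (by rw [hvol])
      (f := fun x => |x - v * hL.meanRate| ^ s) (by fun_prop)
    simp only [centred, hvol, ← hv]
    exact this
  set m := ⌊N / v⌋₊ with hm
  have hm1 : 1 ≤ m := by
    rw [hm, Nat.one_le_floor_iff, one_le_div hvpos]; linarith
  have hmv : m * v ≤ N := by
    rw [← le_div_iff₀ hvpos]; exact Nat.floor_le (by positivity)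
  have hm2 : N / v ≤ 2 * m := by
    have h1 := Nat.lt_floor_add_one (N / v)
    have h2 : (1 : ℝ) ≤ m := by exact_mod_cast hm1
    rw [← hm] at h1
    linarith
  have hsum : ∀ k : ℕ, ∀ᵐ ω ∂P, hL.centred (strip 0 (k * v)) ω
      = ∑ j ∈ Finset.range k, hL.centred (strip (j * v) (j * v + v)) ω := by
    intro k
    induction k with
    | zero =>
      simpa using hL.centred_null (hms 0 0) (hbs _ _) (by rw [volume_strip le_rfl]; simp)
    | succ k ih =>
      have h1 := hL.centred_union (hms 0 (k * v)) (hbs _ _) (hms (k * v) (k * v + v)) (hbs _ _)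
        (strip_disjoint le_rfl)
      rw [strip_union (by positivity) (by linarith)] at h1
      filter_upwards [ih, h1] with ω h2 h1
      rw [Finset.sum_range_succ, ← h2, ← h1]
      congr 2; push_cast; ring
  have hkey := sum_moment_le_moment_sum hs m (hL.centred (strip (m * v) N))
    (fun j => hL.centred (strip (j * v) (j * v + v)))
    (hL.memLp_centred hseed (by linarith) hmom (hms _ _) (hbs _ _))
    (fun k _ => hL.memLp_centred hseed (by linarith) hmom (hms _ _) (hbs _ _))
    (fun k hk => by
      have hkm : (k : ℝ) * v + v ≤ m * v := by
        have : (k : ℝ) + 1 ≤ m := by exact_mod_cast hk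
        nlinarith
      have hdis : Disjoint (strip (m * v) N) (strip 0 (k * v)) :=
        (strip_disjoint (by linarith)).symm
      have hi := hL.indepFun_centred ((hms (m * v) N).union (hms 0 (k * v)))
        ((hbs _ _).union (hbs _ _)) (hms (k * v) (k * v + v)) (hbs _ _)
        (Set.disjoint_union_left.2 ⟨(strip_disjoint hkm).symm, strip_disjoint le_rfl⟩)
      refine hi.congr ?_ (ae_eq_refl _)
      filter_upwards [hsum k, hL.centred_union (hms (m * v) N) (hbs _ _) (hms 0 (k * v))
        (hbs _ _) hdis] with ω h1 h2
      rw [h2, h1])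
    (fun k _ => hL.integral_centred hseed hmom2 (hms _ _) (hbs _ _))
  have htot : ∫ ω, |hL.centred (strip (m * v) N) ω
      + ∑ j ∈ Finset.range m, hL.centred (strip (j * v) (j * v + v)) ω| ^ s ∂P = KN := by
    rw [hKN]
    refine integral_congr_ae ?_
    have h1 := hL.centred_union (hms 0 (m * v)) (hbs _ _) (hms (m * v) N) (hbs _ _)
        (strip_disjoint le_rfl)
    rw [strip_union (by positivity) hmv] at h1
    filter_upwards [hsum m, h1] with ω h2 h1
    rw [← h2, h1, add_comm]
  rw [htot] at hkey
  have hhalf : ∀ j : ℕ, ∫ ω, |hL.centred (strip (j * v) (j * v + v)) ω / 2| ^ s ∂P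
      = (2 ^ s)⁻¹ * ∫ ω, |hL.centred B ω| ^ s ∂P := fun j => by
    rw [← hcomp (j * v), ← integral_const_mul]
    congr 1; funext ω
    rw [abs_div, Real.div_rpow (abs_nonneg _) (abs_nonneg _), abs_two]; ring
  simp only [hhalf, Finset.sum_const, Finset.card_range, nsmul_eq_mul] at hkey
  set I := ∫ ω, |hL.centred B ω| ^ s ∂P with hI
  have hI0 : 0 ≤ I := integral_nonneg fun ω => by positivity
  have h2s : 0 < (2 : ℝ) ^ s := by positivity
  have e1 : N / v * I ≤ 2 ^ s * KN := by
    calc N / v * I ≤ 2 * m * I := by gcongr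
      _ = 2 ^ s * (m * (2 * ((2 ^ s)⁻¹ * I))) := by field_simp
      _ ≤ _ := by gcongr
  rw [div_mul_eq_mul_div, div_le_iff₀ hvpos] at e1
  rw [div_mul_eq_mul_div, le_div_iff₀ (by linarith)]
  linarith

end IsLevyBasis

end Basis

end Trawl

namespace Trawl

/-! ### Quadratic forms in independent cells

The cell `(i, j)` collects the part of the Lévy basis that is alive exactly at the observation
times `i, i + 1, …, j`. -/

section Cells

variable {Ω : Type*}

/-- The cells `(i, j)` with `i, j ≤ n` that satisfy `p`. -/
def cells (n : ℕ) (p : ℕ × ℕ → Prop) [DecidablePred p] : Finset (ℕ × ℕ) :=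
  (Finset.range (n + 1) ×ˢ Finset.range (n + 1)).filter p

/-- The total weight of the cells that satisfy `p`. -/
def cellSum (n : ℕ) (ξ : ℕ × ℕ → Ω → ℝ) (p : ℕ × ℕ → Prop) [DecidablePred p] (ω : Ω) : ℝ :=
  ∑ c ∈ cells n p, ξ c ω

/-- The σ-algebra generated by the cells in `S`. -/
abbrev cellSigma (ξ : ℕ × ℕ → Ω → ℝ) (S : Set (ℕ × ℕ)) : MeasurableSpace Ω :=
  ⨆ c ∈ S, MeasurableSpace.comap (ξ c) inferInstance

lemma measurable_cellSum_cellSigma {n : ℕ} {ξ : ℕ × ℕ → Ω → ℝ} {S : Set (ℕ × ℕ)}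
    {p : ℕ × ℕ → Prop} [DecidablePred p] (hp : ∀ c, p c → c ∈ S) :
    Measurable[cellSigma ξ S] (cellSum n ξ p) := by
  refine Finset.measurable_sum (cells n p) (f := ξ) (fun c hc => ?_) 
  have hcS : c ∈ S := hp c (Finset.mem_filter.1 hc).2
  have h1 : MeasurableSpace.comap (ξ c) inferInstance ≤ cellSigma ξ S :=
    le_iSup₂_of_le c hcS le_rfl
  exact fun t ht => h1 _ ⟨t, ht, rfl⟩

/-- The cells alive at time `k`. -/
abbrev alive (k : ℕ) : ℕ × ℕ → Prop := fun c => c.1 ≤ k ∧ k ≤ c.2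

/-- The cells born between the times `k` and `k + 1`. -/
abbrev born (k : ℕ) : ℕ × ℕ → Prop := fun c => c.1 = k + 1 ∧ k + 1 ≤ c.2

/-- The cells that die between the times `k` and `k + 1`. -/
abbrev dies (k : ℕ) : ℕ × ℕ → Prop := fun c => c.1 ≤ k ∧ c.2 = k

/-- The cells alive at time `i` that die before time `k`. -/
abbrev diesBefore (i k : ℕ) : ℕ × ℕ → Prop := fun c => c.1 ≤ i ∧ i ≤ c.2 ∧ c.2 < k

/-- The cells alive at time `i` that are still alive after time `k`. -/
abbrev survives (i k : ℕ) : ℕ × ℕ → Prop := fun c => c.1 ≤ i ∧ k < c.2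

/-- The cells alive at time `i` that die between the times `k` and `k + 1`. -/
abbrev aliveDies (i k : ℕ) : ℕ × ℕ → Prop := fun c => c.1 ≤ i ∧ c.2 = k

lemma cellSum_increment (n : ℕ) (ξ : ℕ × ℕ → Ω → ℝ) (k : ℕ) (ω : Ω) :
    cellSum n ξ (alive (k + 1)) ω - cellSum n ξ (alive k) ω
      = cellSum n ξ (born k) ω - cellSum n ξ (dies k) ω := by
  simp only [cellSum, cells, Finset.sum_filter]
  rw [← Finset.sum_sub_distrib, ← Finset.sum_sub_distrib]
  refine Finset.sum_congr rfl fun c _ => ?_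
  split_ifs <;> first | (exfalso; omega) | ring

lemma cellSum_alive (n : ℕ) (ξ : ℕ × ℕ → Ω → ℝ) (l i : ℕ) (ω : Ω) :
    cellSum n ξ (alive i) ω = cellSum n ξ (diesBefore i (l + i)) ω
      + cellSum n ξ (survives i (l + i)) ω + cellSum n ξ (aliveDies i (l + i)) ω := by
  simp only [cellSum, cells, Finset.sum_filter]
  rw [← Finset.sum_add_distrib, ← Finset.sum_add_distrib]
  refine Finset.sum_congr rfl fun c _ => ?_
  split_ifs <;> first | (exfalso; omega) | ring

variable [MeasurableSpace Ω]

/-- Independent centred cells with variances `w`, whose moments of order `s` are controlled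
by `K` times the variance. -/
structure CellModel (P : Measure Ω) (n : ℕ) (ξ : ℕ × ℕ → Ω → ℝ) (w : ℕ × ℕ → ℝ)
    (s K V : ℝ) : Prop where
  meas : ∀ c, Measurable (ξ c)
  indep : iIndepFun ξ P
  w_nonneg : ∀ c, 0 ≤ w c
  memLp : ∀ S : Finset (ℕ × ℕ), MemLp (fun ω => ∑ c ∈ S, ξ c ω) (ENNReal.ofReal s) P
  mean : ∀ S : Finset (ℕ × ℕ), ∫ ω, ∑ c ∈ S, ξ c ω ∂P = 0
  sq : ∀ S : Finset (ℕ × ℕ), ∫ ω, (∑ c ∈ S, ξ c ω) ^ 2 ∂P = ∑ c ∈ S, w c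
  moment : ∀ S : Finset (ℕ × ℕ), ∑ c ∈ S, w c ≤ V →
    ∫ ω, |∑ c ∈ S, ξ c ω| ^ s ∂P ≤ K * ∑ c ∈ S, w c

namespace CellModel

variable {P : Measure Ω} {n : ℕ} {ξ : ℕ × ℕ → Ω → ℝ} {w : ℕ × ℕ → ℝ} {s K V : ℝ}

lemma indepFun_of_disjoint (h : CellModel P n ξ w s K V) {β : Type*} [MeasurableSpace β]
    {S T : Set (ℕ × ℕ)} (hST : Disjoint S T) {X : Ω → β} {N : Ω → ℝ}
    (hX : Measurable[cellSigma ξ S] X) (hN : Measurable[cellSigma ξ T] N) : IndepFun X N P := by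
  have h1 : Indep (cellSigma ξ S) (cellSigma ξ T) P :=
    indep_iSup_of_disjoint (fun c => (h.meas c).comap_le) h.indep hST
  exact indep_of_indep_of_le_left (indep_of_indep_of_le_right h1 hN.comap_le) hX.comap_le

lemma weight_mono (h : CellModel P n ξ w s K V) {p q : ℕ × ℕ → Prop} [DecidablePred p]
    [DecidablePred q] (hpq : ∀ c, p c → q c) :
    ∑ c ∈ cells n p, w c ≤ ∑ c ∈ cells n q, w c :=
  Finset.sum_le_sum_of_subset_of_nonneg
    (Finset.monotone_filter_right _ fun c _ => hpq c) fun c _ _ => h.w_nonneg c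

lemma weight_nonneg (h : CellModel P n ξ w s K V) (p : ℕ × ℕ → Prop) [DecidablePred p] :
    0 ≤ ∑ c ∈ cells n p, w c := Finset.sum_nonneg fun c _ => h.w_nonneg c

variable [IsProbabilityMeasure P]

lemma memLp_cellSum (h : CellModel P n ξ w s K V) (p : ℕ × ℕ → Prop) [DecidablePred p] {r : ℝ}
    (hrs : r ≤ s) : MemLp (cellSum n ξ p) (ENNReal.ofReal r) P :=
  (h.memLp (cells n p)).mono_exponent (ENNReal.ofReal_le_ofReal hrs)

lemma moment_cellSum (h : CellModel P n ξ w s K V) (p : ℕ × ℕ → Prop) [DecidablePred p] {r : ℝ}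
    (hr : 2 ≤ r) (hrs : r ≤ s) (hV : ∑ c ∈ cells n p, w c ≤ V) :
    ∫ ω, |cellSum n ξ p ω| ^ r ∂P ≤ (1 + K) * ∑ c ∈ cells n p, w c := by
  have h1 := h.memLp_cellSum p (r := r) hrs
  have h2 := h.memLp_cellSum p (r := s) le_rfl
  have i2 := (MemLp_two_of_ofReal hr h1).integrable_sq
  have is := integrable_abs_rpow (by linarith) h2
  calc ∫ ω, |cellSum n ξ p ω| ^ r ∂P
      ≤ ∫ ω, (cellSum n ξ p ω ^ 2 + |cellSum n ξ p ω| ^ s) ∂P :=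
        integral_mono (integrable_abs_rpow (by linarith) h1) (i2.add is)
          fun ω => abs_rpow_le_sq_add_rpow hr hrs _
    _ = ∫ ω, cellSum n ξ p ω ^ 2 ∂P + ∫ ω, |cellSum n ξ p ω| ^ s ∂P := integral_add i2 is
    _ ≤ ∑ c ∈ cells n p, w c + K * ∑ c ∈ cells n p, w c :=
        add_le_add (h.sq _).le (h.moment _ hV)
    _ = _ := by ring

end CellModel

/-- A bound for all the moments that enter the quadratic form. -/
noncomputable def momentConst (K V κ r : ℝ) : ℝ :=
  1 + (1 + K) * (κ + V) + 2 ^ r * ((1 + K) + V ^ (r - 1)) * κ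

namespace CellModel

variable {P : Measure Ω} {n : ℕ} {ξ : ℕ × ℕ → Ω → ℝ} {w : ℕ × ℕ → ℝ} {s K V : ℝ}
  [IsProbabilityMeasure P]

/-- Linear sums `∑ Y_i N_i` with `N_i` independent of the past. -/
lemma moment_sum_mul (h : CellModel P n ξ w s K V) {κ δ T r : ℝ} (hK : 0 ≤ K)
    (hV : 0 ≤ V) (hκ : 0 ≤ κ) (hδ : 0 ≤ δ) (hT : 1 ≤ T) (hr : 2 ≤ r) (hrs : r ≤ s)
    (m : ℕ) (hm : m * δ ≤ T) (p q : ℕ → ℕ × ℕ → Prop) [∀ i, DecidablePred (p i)]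
    [∀ i, DecidablePred (q i)] (A B : ℕ → Set (ℕ × ℕ)) (hAB : ∀ i, Disjoint (A i) (B i))
    (hpA : ∀ i < m, ∀ j ≤ i, ∀ c, p j c → c ∈ A i)
    (hqA : ∀ i < m, ∀ j < i, ∀ c, q j c → c ∈ A i) (hqB : ∀ i < m, ∀ c, q i c → c ∈ B i)
    (hpV : ∀ i < m, ∑ c ∈ cells n (p i), w c ≤ V) (hqV : ∀ i < m, ∑ c ∈ cells n (q i), w c ≤ V)
    (hqδ : ∀ i < m, ∑ c ∈ cells n (q i), w c ≤ κ * δ) :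
    MemLp (fun ω => ∑ i ∈ Finset.range m, cellSum n ξ (p i) ω * cellSum n ξ (q i) ω)
      (ENNReal.ofReal r) P ∧
    ∫ ω, |∑ i ∈ Finset.range m, cellSum n ξ (p i) ω * cellSum n ξ (q i) ω| ^ r ∂P
      ≤ Real.exp (expansionConst r * (momentConst K V κ r + 2 * momentConst K V κ r ^ 2))
        * T ^ (r / 2) := by
  have hVr : 0 ≤ V ^ (r - 1) := by positivity
  have h0 : 0 ≤ 2 ^ r * ((1 + K) + V ^ (r - 1)) * κ := by positivity
  have hM : (1 + K) * (κ + V) ≤ momentConst K V κ r := by unfold momentConst; linarith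
  have hMκ : (1 + K) * κ ≤ momentConst K V κ r := le_trans (by gcongr; linarith) hM
  have hMV : (1 + K) * V ≤ momentConst K V κ r := le_trans (by gcongr; linarith) hM
  refine integral_abs_sum_mul_rpow_le hr (by unfold momentConst; positivity) hδ hT m hm
    (fun i => cellSum n ξ (p i)) (fun i => cellSum n ξ (q i))
    (fun i _ => h.memLp_cellSum _ hrs) (fun i _ => h.memLp_cellSum _ hrs)
    (fun i hi => ?_) (fun i _ => h.mean _) (fun i hi => ?_) (fun i hi => ?_) (fun i hi => ?_)
  · refine h.indepFun_of_disjoint (hAB i) ?_ (measurable_cellSum_cellSigma (hqB i hi))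
    refine Measurable.prodMk (Finset.measurable_fun_sum _ fun j hj => ?_)
      (measurable_cellSum_cellSigma (hpA i hi i le_rfl))
    rw [Finset.mem_range] at hj
    exact (measurable_cellSum_cellSigma (hpA i hi j hj.le)).mul
      (measurable_cellSum_cellSigma (hqA i hi j hj))
  · refine (h.sq _).le.trans ((hqδ i hi).trans ?_)
    gcongr
    refine le_trans ?_ hMκ
    nlinarith
  · refine (h.moment_cellSum _ hr hrs (hqV i hi)).trans ?_
    calc (1 + K) * ∑ c ∈ cells n (q i), w c ≤ (1 + K) * (κ * δ) := by gcongr; exact hqδ i hi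
      _ = (1 + K) * κ * δ := by ring
      _ ≤ _ := by gcongr
  · refine (h.moment_cellSum _ hr hrs (hpV i hi)).trans (le_trans ?_ hMV)
    gcongr
    exact hpV i hi

lemma integral_aliveDies_mul_dies (h : CellModel P n ξ w s K V) (hs : 2 ≤ s) (i k : ℕ)
    (hik : i ≤ k) :
    ∫ ω, cellSum n ξ (aliveDies i k) ω * cellSum n ξ (dies k) ω ∂P
      = ∑ c ∈ cells n (aliveDies i k), w c := by
  let p : ℕ × ℕ → Prop := fun c => i < c.1 ∧ c.1 ≤ k ∧ c.2 = k
  have hdec : ∀ ω, cellSum n ξ (dies k) ω = cellSum n ξ (aliveDies i k) ω + cellSum n ξ p ω := by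
    intro ω
    simp only [cellSum, cells, Finset.sum_filter]
    rw [← Finset.sum_add_distrib]
    refine Finset.sum_congr rfl fun c _ => ?_
    simp only [p]
    split_ifs <;> first | (exfalso; omega) | ring
  have hind : IndepFun (cellSum n ξ (aliveDies i k)) (cellSum n ξ p) P :=
    h.indepFun_of_disjoint (S := {c | c.1 ≤ i}) (T := {c | i < c.1})
      (Set.disjoint_left.2 fun c h1 h2 => by
        simp only [mem_ofPred_eq] at h1 h2; omega)
      (measurable_cellSum_cellSigma fun c hc => hc.1)
      (measurable_cellSum_cellSigma fun c hc => hc.1)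
  have m1 := MemLp_two_of_ofReal hs (h.memLp_cellSum (aliveDies i k) (r := s) le_rfl)
  have m2 := MemLp_two_of_ofReal hs (h.memLp_cellSum p (r := s) le_rfl)
  have hprod := hind.integral_mul_eq_mul_integral m1.1 m2.1
  have hmean : ∫ ω, cellSum n ξ p ω ∂P = 0 := h.mean _
  have hmul := hind.integrable_mul (m1.integrable (by norm_num)) (m2.integrable (by norm_num))
  simp only [Pi.mul_def] at hprod hmul
  calc _ = ∫ ω, (cellSum n ξ (aliveDies i k) ω ^ 2
        + cellSum n ξ (aliveDies i k) ω * cellSum n ξ p ω) ∂P := by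
        congr 1; funext ω; rw [hdec]; ring
    _ = _ := by
        rw [integral_add m1.integrable_sq hmul, hprod, hmean, mul_zero, add_zero]
        exact h.sq _

/-- The diagonal part of the quadratic form. -/
lemma moment_sum_diag (h : CellModel P n ξ w s K V) {κ δ T r : ℝ} (hK : 0 ≤ K)
    (hV : 0 ≤ V) (hκ : 0 ≤ κ) (hδ : 0 ≤ δ) (hT : 1 ≤ T) (hr : 2 ≤ r) (hrs : 2 * r ≤ s)
    (l m : ℕ) (hm : m * δ ≤ T)
    (hqV : ∀ i < m, ∑ c ∈ cells n (dies (l + i)), w c ≤ V)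
    (hqδ : ∀ i < m, ∑ c ∈ cells n (dies (l + i)), w c ≤ κ * δ) :
    MemLp (fun ω => ∑ i ∈ Finset.range m, (cellSum n ξ (aliveDies i (l + i)) ω
      * cellSum n ξ (dies (l + i)) ω - ∑ c ∈ cells n (aliveDies i (l + i)), w c))
      (ENNReal.ofReal r) P ∧
    ∫ ω, |∑ i ∈ Finset.range m, (cellSum n ξ (aliveDies i (l + i)) ω
      * cellSum n ξ (dies (l + i)) ω - ∑ c ∈ cells n (aliveDies i (l + i)), w c)| ^ r ∂P
      ≤ Real.exp (expansionConst r * (momentConst K V κ r + 2 * momentConst K V κ r ^ 2))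
        * T ^ (r / 2) := by
  have hr0 : 0 < r := by linarith
  have hVr : 0 ≤ V ^ (r - 1) := by positivity
  have h0 : 0 ≤ 2 ^ r * ((1 + K) + V ^ (r - 1)) * κ := by positivity
  have h0' : 0 ≤ (1 + K) * (κ + V) := by positivity
  have hM1 : 1 ≤ momentConst K V κ r := by unfold momentConst; linarith
  have hMκ : (1 + K) * κ ≤ momentConst K V κ r := by
    have : (1 + K) * κ ≤ (1 + K) * (κ + V) := by gcongr; linarith
    unfold momentConst; linarith
  set Y : ℕ → Ω → ℝ := fun i => cellSum n ξ (aliveDies i (l + i)) with hY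
  set D : ℕ → Ω → ℝ := fun i => cellSum n ξ (dies (l + i)) with hD
  set e : ℕ → ℝ := fun i => ∑ c ∈ cells n (aliveDies i (l + i)), w c with he
  set N : ℕ → Ω → ℝ := fun i ω => Y i ω * D i ω - e i with hN
  have hsub : ∀ i, ∑ c ∈ cells n (aliveDies i (l + i)), w c
      ≤ ∑ c ∈ cells n (dies (l + i)), w c := fun i =>
    h.weight_mono fun c hc => ⟨by have := hc.1; omega, hc.2⟩
  have he0 : ∀ i, 0 ≤ e i := fun i => h.weight_nonneg _
  have hprodle : ∀ x y : ℝ, ∀ t : ℝ, 0 < t →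
      |x * y| ^ t ≤ |x| ^ (2 * t) + |y| ^ (2 * t) := by
    intro x y t ht
    rw [abs_mul, Real.mul_rpow (abs_nonneg _) (abs_nonneg _), two_mul,
      Real.rpow_add_of_nonneg (abs_nonneg _) ht.le ht.le,
      Real.rpow_add_of_nonneg (abs_nonneg _) ht.le ht.le]
    nlinarith [sq_nonneg (|x| ^ t - |y| ^ t), Real.rpow_nonneg (abs_nonneg x) t,
      Real.rpow_nonneg (abs_nonneg y) t]
  have hYm : ∀ i, MemLp (Y i) (ENNReal.ofReal (2 * r)) P := fun i => h.memLp_cellSum _ hrs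
  have hDm : ∀ i, MemLp (D i) (ENNReal.ofReal (2 * r)) P := fun i => h.memLp_cellSum _ hrs
  have hYDmeas : ∀ i, AEStronglyMeasurable (fun ω => Y i ω * D i ω) P :=
    fun i => (hYm i).1.mul (hDm i).1
  have hYDint : ∀ i, ∀ t : ℝ, 1 ≤ t → t ≤ r → Integrable (fun ω => |Y i ω * D i ω| ^ t) P := by
    intro i t ht htr
    have a1 := integrable_abs_rpow (s := 2 * t) (by linarith)
      (h.memLp_cellSum (aliveDies i (l + i)) (r := 2 * t) (by linarith))
    have a2 := integrable_abs_rpow (s := 2 * t) (by linarith)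
      (h.memLp_cellSum (dies (l + i)) (r := 2 * t) (by linarith))
    refine (a1.add a2).mono' ?_ (ae_of_all _ fun ω => ?_)
    · exact ((show Measurable (fun x : ℝ => |x| ^ t) by fun_prop).comp_aemeasurable
        (hYDmeas i).aemeasurable).aestronglyMeasurable
    · rw [Real.norm_of_nonneg (by positivity)]
      exact hprodle _ _ _ (by linarith)
  have hYDmom : ∀ i < m, ∀ t : ℝ, 1 ≤ t → t ≤ r →
      ∫ ω, |Y i ω * D i ω| ^ t ∂P ≤ 2 * ((1 + K) * (κ * δ)) := by
    intro i hi t ht htr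
    have a1 := integrable_abs_rpow (s := 2 * t) (by linarith)
      (h.memLp_cellSum (aliveDies i (l + i)) (r := 2 * t) (by linarith))
    have a2 := integrable_abs_rpow (s := 2 * t) (by linarith)
      (h.memLp_cellSum (dies (l + i)) (r := 2 * t) (by linarith))
    have b1 := h.moment_cellSum (aliveDies i (l + i)) (r := 2 * t) (by linarith) (by linarith)
      ((hsub i).trans (hqV i hi))
    have b2 := h.moment_cellSum (dies (l + i)) (r := 2 * t) (by linarith) (by linarith) (hqV i hi)
    have c1 : (1 + K) * ∑ c ∈ cells n (aliveDies i (l + i)), w c ≤ (1 + K) * (κ * δ) := by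
      gcongr; exact (hsub i).trans (hqδ i hi)
    have c2 : (1 + K) * ∑ c ∈ cells n (dies (l + i)), w c ≤ (1 + K) * (κ * δ) := by
      gcongr; exact hqδ i hi
    have := integral_mono (hYDint i t ht htr) (a1.add a2)
      fun ω => hprodle (Y i ω) (D i ω) t (by linarith)
    have hsum : ∫ ω, (|Y i ω| ^ (2 * t) + |D i ω| ^ (2 * t)) ∂P
      = ∫ ω, |Y i ω| ^ (2 * t) ∂P + ∫ ω, |D i ω| ^ (2 * t) ∂P := integral_add a1 a2
    refine this.trans (hsum.le.trans ?_)
    linarith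
  have hNm : ∀ i, MemLp (N i) (ENNReal.ofReal r) P := fun i =>
    ((memLp_ofReal_iff (hYDmeas i) hr0).2 (hYDint i r (by linarith) le_rfl)).sub (memLp_const _)
  have hYD1 : ∀ i, Integrable (fun ω => Y i ω * D i ω) P := fun i =>
    (MemLp_two_of_ofReal hr ((memLp_ofReal_iff (hYDmeas i) hr0).2
      (hYDint i r (by linarith) le_rfl))).integrable (by norm_num)
  have hmean : ∀ i, ∫ ω, Y i ω * D i ω ∂P = e i := fun i =>
    h.integral_aliveDies_mul_dies (by linarith) i (l + i) (by omega)
  have key := integral_abs_sum_mul_rpow_le (P := P) hr (K := momentConst K V κ r) (by linarith)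
    hδ hT m hm (fun _ _ => 1) N (fun i _ => memLp_const _) (fun i _ => hNm i)
    (fun i hi => ?_) (fun i _ => ?_) (fun i hi => ?_) (fun i hi => ?_) (fun i hi => ?_)
  · simpa only [one_mul] using key
  · refine h.indepFun_of_disjoint (S := {c | c.2 < l + i}) (T := {c | c.2 = l + i})
      (Set.disjoint_left.2 fun c h1 h2 => by
        simp only [mem_ofPred_eq] at h1 h2; omega) ?_ ?_
    · refine Measurable.prodMk (Finset.measurable_fun_sum _ fun j hj => ?_) measurable_const
      rw [Finset.mem_range] at hj
      refine measurable_const.mul (Measurable.sub (Measurable.mul ?_ ?_) measurable_const)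
      · exact measurable_cellSum_cellSigma fun c hc => by
          have := hc.2; simp only [mem_ofPred_eq]; omega
      · exact measurable_cellSum_cellSigma fun c hc => by
          have := hc.2; simp only [mem_ofPred_eq]; omega
    · refine Measurable.sub (Measurable.mul ?_ ?_) measurable_const
      · exact measurable_cellSum_cellSigma fun c hc => hc.2
      · exact measurable_cellSum_cellSigma fun c hc => hc.2
  · simp only [hN]
    rw [integral_sub (hYD1 i) (integrable_const _), hmean]
    simp
  · have i2 : MemLp (fun ω => Y i ω * D i ω) 2 P := MemLp_two_of_ofReal hr
      ((memLp_ofReal_iff (hYDmeas i) hr0).2 (hYDint i r (by linarith) le_rfl))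
    have hvar : ∫ ω, N i ω ^ 2 ∂P ≤ ∫ ω, |Y i ω * D i ω| ^ (2 : ℝ) ∂P := by
      have h1 := variance_le_expectation_sq (X := fun ω => Y i ω * D i ω) (hYDmeas i)
      rw [variance_eq_integral (hYDmeas i).aemeasurable, hmean] at h1
      simpa only [hN, Real.rpow_two, sq_abs, Pi.pow_apply] using h1
    refine hvar.trans ((hYDmom i hi 2 (by norm_num) hr).trans ?_)
    have h2r : (2 : ℝ) ≤ 2 ^ r := by
      calc (2 : ℝ) = 2 ^ (1 : ℝ) := by simp
        _ ≤ 2 ^ r := Real.rpow_le_rpow_of_exponent_le (by norm_num) (by linarith)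
    calc 2 * ((1 + K) * (κ * δ)) = 2 * ((1 + K) * κ) * δ := by ring
      _ ≤ momentConst K V κ r * δ := by
        gcongr
        have : 2 * ((1 + K) * κ) ≤ 2 ^ r * ((1 + K) + V ^ (r - 1)) * κ := by
          have h3 : 2 * (1 + K) ≤ 2 ^ r * ((1 + K) + V ^ (r - 1)) :=
            mul_le_mul h2r (by linarith) (by linarith) (by positivity)
          nlinarith
        unfold momentConst; linarith
  · have hei : e i ^ r ≤ V ^ (r - 1) * (κ * δ) := by
      have h1 : e i ^ r = e i ^ (r - 1) * e i := by
        conv_lhs => rw [show r = (r - 1) + 1 by ring]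
        rw [Real.rpow_add_of_nonneg (he0 i) (by linarith) zero_le_one, Real.rpow_one]
      rw [h1]
      have h2 : e i ≤ V := (hsub i).trans (hqV i hi)
      have h3 : e i ≤ κ * δ := (hsub i).trans (hqδ i hi)
      exact mul_le_mul (Real.rpow_le_rpow (he0 i) h2 (by linarith)) h3 (he0 i) hVr
    have hle : ∀ ω, |N i ω| ^ r ≤ 2 ^ (r - 1) * (|Y i ω * D i ω| ^ r + e i ^ r) := fun ω => by
      have := rpow_add_le_two r (by linarith) (Y i ω * D i ω) (-e i)
      rwa [abs_neg, abs_of_nonneg (he0 i), ← sub_eq_add_neg] at this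
    have hint := integral_mono (integrable_abs_rpow hr0 (hNm i))
      (((hYDint i r (by linarith) le_rfl).add (integrable_const (e i ^ r))).const_mul
        (2 ^ (r - 1))) hle
    have hval : ∫ ω, 2 ^ (r - 1) * (|Y i ω * D i ω| ^ r + e i ^ r) ∂P
        = 2 ^ (r - 1) * (∫ ω, |Y i ω * D i ω| ^ r ∂P + e i ^ r) := by
      rw [integral_const_mul, integral_add (hYDint i r (by linarith) le_rfl)
        (integrable_const _)]
      simp
    refine hint.trans (hval.le.trans ?_)
    have h2 : (2 : ℝ) ^ r = 2 * 2 ^ (r - 1) := by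
      conv_lhs => rw [show r = 1 + (r - 1) by ring]
      rw [Real.rpow_add two_pos, Real.rpow_one]
    calc 2 ^ (r - 1) * (∫ ω, |Y i ω * D i ω| ^ r ∂P + e i ^ r)
        ≤ 2 ^ (r - 1) * (2 * ((1 + K) * (κ * δ)) + 2 * (V ^ (r - 1) * (κ * δ))) := by
          have h5 := hYDmom i hi r (by linarith) le_rfl
          have h6 : 0 ≤ V ^ (r - 1) * (κ * δ) := by positivity
          gcongr
          linarith
      _ = 2 ^ r * ((1 + K) + V ^ (r - 1)) * κ * δ := by rw [h2]; ring
      _ ≤ _ := by gcongr; unfold momentConst; linarith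
  · simpa using hM1

/-- Constant in the moment bound for the quadratic form. -/
noncomputable def _root_.Trawl.quadConst (K V κ r : ℝ) : ℝ :=
  4 ^ r * Real.exp (expansionConst r * (momentConst K V κ r + 2 * momentConst K V κ r ^ 2))

/-- Moment bound for the lagged sums of products of the process and its increments. -/
theorem moment_quadratic (h : CellModel P n ξ w s K V) {κ δ T r : ℝ} (hK : 0 ≤ K)
    (hV : 0 ≤ V) (hκ : 0 ≤ κ) (hδ : 0 ≤ δ) (hT : 1 ≤ T) (hr : 2 ≤ r) (hrs : 2 * r ≤ s)
    (hn : n * δ ≤ T) (l : ℕ)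
    (hlive : ∀ k ≤ n, ∑ c ∈ cells n (alive k), w c ≤ V)
    (hborn : ∀ k < n, ∑ c ∈ cells n (born k), w c ≤ κ * δ)
    (hdies : ∀ k < n, ∑ c ∈ cells n (dies k), w c ≤ κ * δ) :
    MemLp (fun ω => ∑ i ∈ Finset.range (n - l), (cellSum n ξ (alive i) ω *
      (cellSum n ξ (alive (l + i + 1)) ω - cellSum n ξ (alive (l + i)) ω)
        + ∑ c ∈ cells n (aliveDies i (l + i)), w c)) (ENNReal.ofReal r) P ∧
    ∫ ω, |∑ i ∈ Finset.range (n - l), (cellSum n ξ (alive i) ω *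
      (cellSum n ξ (alive (l + i + 1)) ω - cellSum n ξ (alive (l + i)) ω)
        + ∑ c ∈ cells n (aliveDies i (l + i)), w c)| ^ r ∂P
      ≤ quadConst K V κ r * T ^ (r / 2) := by
  set m := n - l with hm
  have hr0 : 0 < r := by linarith
  have hmn : (m : ℝ) * δ ≤ T := le_trans (by gcongr; omega) hn
  have hlm : ∀ i < m, l + i < n := fun i hi => by omega
  have dV : ∀ k < n, ∑ c ∈ cells n (dies k), w c ≤ V := fun k hk =>
    (h.weight_mono fun c hc => ⟨hc.1, hc.2.ge⟩).trans (hlive k hk.le)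
  have bV : ∀ k < n, ∑ c ∈ cells n (born k), w c ≤ V := fun k hk =>
    (h.weight_mono fun c hc => ⟨hc.1.le, hc.2⟩).trans (hlive (k + 1) hk)
  obtain ⟨a1, b1⟩ := h.moment_sum_mul hK hV hκ hδ hT hr (by linarith) m hmn
    (fun i => alive i) (fun i => born (l + i)) (fun i => {c | c.1 ≤ l + i})
    (fun i => {c | c.1 = l + i + 1})
    (fun i => Set.disjoint_left.2 fun c h1 h2 => by simp only [mem_ofPred_eq] at h1 h2; omega)
    (fun i _ j hj c hc => by have := hc.1; simp only [mem_ofPred_eq]; omega)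
    (fun i _ j hj c hc => by have := hc.1; simp only [mem_ofPred_eq]; omega)
    (fun i _ c hc => hc.1) (fun i hi => hlive i (by omega))
    (fun i hi => bV _ (hlm i hi)) (fun i hi => hborn _ (hlm i hi))
  obtain ⟨a2, b2⟩ := h.moment_sum_mul hK hV hκ hδ hT hr (by linarith) m hmn
    (fun i => diesBefore i (l + i)) (fun i => dies (l + i)) (fun i => {c | c.2 < l + i})
    (fun i => {c | c.2 = l + i})
    (fun i => Set.disjoint_left.2 fun c h1 h2 => by simp only [mem_ofPred_eq] at h1 h2; omega)
    (fun i _ j hj c hc => by have := hc.2.2; simp only [mem_ofPred_eq]; omega)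
    (fun i _ j hj c hc => by have := hc.2; simp only [mem_ofPred_eq]; omega)
    (fun i _ c hc => hc.2)
    (fun i hi => (h.weight_mono fun c hc => ⟨hc.1, hc.2.1⟩).trans (hlive i (by omega)))
    (fun i hi => dV _ (hlm i hi)) (fun i hi => hdies _ (hlm i hi))
  obtain ⟨a3, b3⟩ := h.moment_sum_mul hK hV hκ hδ hT hr (by linarith) m hmn
    (fun i => survives (m - 1 - i) (l + (m - 1 - i))) (fun i => dies (l + (m - 1 - i)))
    (fun i => {c | l + (m - 1 - i) < c.2}) (fun i => {c | c.2 = l + (m - 1 - i)})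
    (fun i => Set.disjoint_left.2 fun c h1 h2 => by simp only [mem_ofPred_eq] at h1 h2; omega)
    (fun i hi j hj c hc => by have := hc.2; simp only [mem_ofPred_eq]; omega)
    (fun i hi j hj c hc => by have := hc.2; simp only [mem_ofPred_eq]; omega)
    (fun i _ c hc => hc.2)
    (fun i hi => (h.weight_mono fun c hc => ⟨hc.1, by have := hc.2; omega⟩).trans
      (hlive (m - 1 - i) (by omega)))
    (fun i hi => dV _ (hlm _ (by omega))) (fun i hi => hdies _ (hlm _ (by omega)))
  have hrefl : ∀ ω, ∑ i ∈ Finset.range m, cellSum n ξ (survives (m - 1 - i) (l + (m - 1 - i))) ω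
      * cellSum n ξ (dies (l + (m - 1 - i))) ω
      = ∑ i ∈ Finset.range m, cellSum n ξ (survives i (l + i)) ω * cellSum n ξ (dies (l + i)) ω :=
    fun ω => Finset.sum_range_reflect
      (fun i => cellSum n ξ (survives i (l + i)) ω * cellSum n ξ (dies (l + i)) ω) m
  simp only [hrefl] at a3 b3
  obtain ⟨a4, b4⟩ := h.moment_sum_diag hK hV hκ hδ hT hr hrs l m hmn
    (fun i hi => dV _ (hlm i hi)) (fun i hi => hdies _ (hlm i hi))
  set S1 : Ω → ℝ := fun ω => ∑ i ∈ Finset.range m,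
    cellSum n ξ (alive i) ω * cellSum n ξ (born (l + i)) ω with hS1
  set S2 : Ω → ℝ := fun ω => ∑ i ∈ Finset.range m,
    cellSum n ξ (diesBefore i (l + i)) ω * cellSum n ξ (dies (l + i)) ω with hS2
  set S3 : Ω → ℝ := fun ω => ∑ i ∈ Finset.range m,
    cellSum n ξ (survives i (l + i)) ω * cellSum n ξ (dies (l + i)) ω with hS3
  set S4 : Ω → ℝ := fun ω => ∑ i ∈ Finset.range m, (cellSum n ξ (aliveDies i (l + i)) ω
      * cellSum n ξ (dies (l + i)) ω - ∑ c ∈ cells n (aliveDies i (l + i)), w c) with hS4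
  have hdecomp : (fun ω => ∑ i ∈ Finset.range m, (cellSum n ξ (alive i) ω *
      (cellSum n ξ (alive (l + i + 1)) ω - cellSum n ξ (alive (l + i)) ω)
        + ∑ c ∈ cells n (aliveDies i (l + i)), w c))
      = fun ω => (S1 ω + -S2 ω) + (-S3 ω + -S4 ω) := by
    funext ω
    simp only [hS1, hS2, hS3, hS4]
    rw [← Finset.sum_neg_distrib, ← Finset.sum_neg_distrib, ← Finset.sum_neg_distrib,
      ← Finset.sum_add_distrib, ← Finset.sum_add_distrib, ← Finset.sum_add_distrib]
    refine Finset.sum_congr rfl fun i _ => ?_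
    have e1 := cellSum_alive n ξ l i ω
    rw [cellSum_increment]
    linear_combination (-cellSum n ξ (dies (l + i)) ω) * e1
  have hmem : MemLp (fun ω => (S1 ω + -S2 ω) + (-S3 ω + -S4 ω)) (ENNReal.ofReal r) P :=
    (a1.add a2.neg).add (a3.neg.add a4.neg)
  have hdec' : ∀ ω, ∑ i ∈ Finset.range m, (cellSum n ξ (alive i) ω *
      (cellSum n ξ (alive (l + i + 1)) ω - cellSum n ξ (alive (l + i)) ω)
        + ∑ c ∈ cells n (aliveDies i (l + i)), w c)
      = (S1 ω + -S2 ω) + (-S3 ω + -S4 ω) := fun ω => congrFun hdecomp ω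
  simp only [hdec']
  refine ⟨hmem, ?_⟩
  have i1 := integrable_abs_rpow hr0 a1
  have i2 := integrable_abs_rpow hr0 a2
  have i3 := integrable_abs_rpow hr0 a3
  have i4 := integrable_abs_rpow hr0 a4
  set c := (2 : ℝ) ^ (r - 1) with hc
  have hc0 : 0 < c := by positivity
  have hle : ∀ ω, |(S1 ω + -S2 ω) + (-S3 ω + -S4 ω)| ^ r
      ≤ c * (c * (|S1 ω| ^ r + |S2 ω| ^ r) + c * (|S3 ω| ^ r + |S4 ω| ^ r)) := fun ω => by
    have h1 := rpow_add_le_two r (by linarith) (S1 ω + -S2 ω) (-S3 ω + -S4 ω)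
    have h2 := rpow_add_le_two r (by linarith) (S1 ω) (-S2 ω)
    have h3 := rpow_add_le_two r (by linarith) (-S3 ω) (-S4 ω)
    simp only [abs_neg] at h2 h3
    refine h1.trans ?_
    gcongr
  have hint := integral_mono (integrable_abs_rpow hr0 hmem)
    ((((i1.add i2).const_mul c).add ((i3.add i4).const_mul c)).const_mul c) hle
  have k12 : Integrable (fun ω => c * (|S1 ω| ^ r + |S2 ω| ^ r)) P := (i1.add i2).const_mul c
  have k34 : Integrable (fun ω => c * (|S3 ω| ^ r + |S4 ω| ^ r)) P := (i3.add i4).const_mul c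
  have hval : ∫ ω, c * (c * (|S1 ω| ^ r + |S2 ω| ^ r) + c * (|S3 ω| ^ r + |S4 ω| ^ r)) ∂P
      = c * (c * (∫ ω, |S1 ω| ^ r ∂P + ∫ ω, |S2 ω| ^ r ∂P)
        + c * (∫ ω, |S3 ω| ^ r ∂P + ∫ ω, |S4 ω| ^ r ∂P)) := by
    rw [integral_const_mul, integral_add k12 k34, integral_const_mul, integral_const_mul,
      integral_add i1 i2, integral_add i3 i4]
  refine hint.trans (hval.le.trans ?_)
  set M := Real.exp (expansionConst r * (momentConst K V κ r + 2 * momentConst K V κ r ^ 2))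
        * T ^ (r / 2) with hMdef
  have h4 : (4 : ℝ) ^ r = 4 * (c * c) := by
    have : (4 : ℝ) ^ r = 2 ^ r * 2 ^ r := by
      rw [← Real.mul_rpow (by norm_num) (by norm_num)]; norm_num
    have h2 : (2 : ℝ) ^ r = 2 * c := by
      rw [hc]
      conv_lhs => rw [show r = 1 + (r - 1) by ring]
      rw [Real.rpow_add two_pos, Real.rpow_one]
    rw [this, h2]; ring
  calc c * (c * (∫ ω, |S1 ω| ^ r ∂P + ∫ ω, |S2 ω| ^ r ∂P)
        + c * (∫ ω, |S3 ω| ^ r ∂P + ∫ ω, |S4 ω| ^ r ∂P))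
      ≤ c * (c * (M + M) + c * (M + M)) := by gcongr
    _ = 4 * (c * c) * M := by ring
    _ = _ := by rw [quadConst, h4, hMdef]; ring

end CellModel

end Cells

end Trawl

namespace Trawl

/-! ### Geometry of trawl sets -/

section Geometry

lemma mem_trawlSetAt {a : ℝ → ℝ} {t : ℝ} {x : ℝ × ℝ} :
    x ∈ trawlSetAt a t ↔ x.1 ≤ t ∧ 0 ≤ x.2 ∧ x.2 ≤ a (t - x.1) := by
  simp [trawlSetAt, trawlSet]

variable {a : ℝ → ℝ}

lemma measurableSet_trawlSetAt (hc : Continuous a) (t : ℝ) :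
    MeasurableSet (trawlSetAt a t) := by
  have e : trawlSetAt a t = {x | x.1 ≤ t} ∩ ({x | 0 ≤ x.2} ∩ {x | x.2 ≤ a (t - x.1)}) := by
    ext x; exact mem_trawlSetAt
  rw [e]
  exact (measurableSet_le measurable_fst measurable_const).inter
    ((measurableSet_le measurable_const measurable_snd).inter
      (measurableSet_le measurable_snd (hc.measurable.comp (by fun_prop))))

lemma trawlSetAt_interval (ha : Antitone a) {s t u : ℝ} (hst : s ≤ t) (htu : t ≤ u) :
    trawlSetAt a s ∩ trawlSetAt a u ⊆ trawlSetAt a t := by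
  rintro x ⟨h1, h2⟩
  rw [mem_trawlSetAt] at *
  exact ⟨h1.1.trans hst, h1.2.1, h2.2.2.trans (ha (by linarith))⟩

/-- The integral of `a` over `[τ, ∞)`. -/
noncomputable def tailMass (a : ℝ → ℝ) (τ : ℝ) : ENNReal := ∫⁻ u in Ici τ, ENNReal.ofReal (a u)

lemma tailMass_lt_top (hi : IntegrableOn a (Ici 0)) {τ : ℝ} (hτ : 0 ≤ τ) : tailMass a τ < ⊤ := by
  have h1 : tailMass a τ ≤ tailMass a 0 := lintegral_mono_set (Ici_subset_Ici.2 hτ)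
  refine h1.trans_lt ?_
  have := hi.lintegral_lt_top
  exact this

lemma volume_trawlSetAt (hc : Continuous a) (t : ℝ) :
    volume (trawlSetAt a t) = tailMass a 0 := by
  have hm := measurableSet_trawlSetAt hc t
  rw [Measure.volume_eq_prod, Measure.prod_apply hm, tailMass,
    ← lintegral_indicator measurableSet_Ici,
    ← lintegral_sub_left_eq_self (μ := volume)
      ((Ici 0).indicator fun u => ENNReal.ofReal (a u)) t]
  refine lintegral_congr fun x => ?_
  by_cases hx : x ≤ t
  · have e : Prod.mk x ⁻¹' trawlSetAt a t = Icc 0 (a (t - x)) := by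
      ext y
      simp only [mem_preimage, mem_trawlSetAt, mem_Icc]
      tauto
    rw [e, Real.volume_Icc, sub_zero, indicator_of_mem (by simpa using hx)]
  · have e : Prod.mk x ⁻¹' trawlSetAt a t = ∅ := by
      ext y
      simp only [mem_preimage, mem_trawlSetAt, mem_empty_iff_false]
      tauto
    rw [e, measure_empty, indicator_of_notMem (by simpa using hx)]

lemma volume_trawl_loss (hc : Continuous a) (ha : Antitone a) (h0 : ∀ u, 0 ≤ a u)
    {s t d : ℝ} (hst : s ≤ t) (hd : 0 ≤ d) :
    volume ((trawlSetAt a s ∩ trawlSetAt a t) \ trawlSetAt a (t + d))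
      = ∫⁻ u in Ici (t - s), ENNReal.ofReal (a u - a (u + d)) := by
  have hm := ((measurableSet_trawlSetAt hc s).inter (measurableSet_trawlSetAt hc t)).diff
    (measurableSet_trawlSetAt hc (t + d))
  rw [Measure.volume_eq_prod, Measure.prod_apply hm,
    ← lintegral_indicator measurableSet_Ici,
    ← lintegral_sub_left_eq_self (μ := volume)
      ((Ici (t - s)).indicator fun u => ENNReal.ofReal (a u - a (u + d))) t]
  refine lintegral_congr fun x => ?_
  by_cases hx : x ≤ s
  · have e : Prod.mk x ⁻¹' ((trawlSetAt a s ∩ trawlSetAt a t) \ trawlSetAt a (t + d))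
        = Ioc (a (t - x + d)) (a (t - x)) := by
      ext y
      simp only [mem_preimage, Set.mem_sdiff, mem_inter_iff, mem_trawlSetAt, mem_Ioc]
      rw [show t + d - x = t - x + d by ring]
      constructor
      · rintro ⟨⟨⟨-, h1, -⟩, -, -, h2⟩, h3⟩
        refine ⟨?_, h2⟩
        by_contra! h4
        exact h3 ⟨by linarith, h1, h4⟩
      · rintro ⟨h1, h2⟩
        have h3 : 0 ≤ y := (h0 _).trans h1.le
        exact ⟨⟨⟨hx, h3, h2.trans (ha (by linarith))⟩, by linarith, h3, h2⟩,
          fun h => absurd h.2.2 (not_le.2 h1)⟩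
    rw [e, Real.volume_Ioc, indicator_of_mem (mem_Ici.2 (by linarith))]
  · have e : Prod.mk x ⁻¹' ((trawlSetAt a s ∩ trawlSetAt a t) \ trawlSetAt a (t + d)) = ∅ := by
      ext y
      simp only [mem_preimage, Set.mem_sdiff, mem_inter_iff, mem_trawlSetAt, mem_empty_iff_false]
      tauto
    rw [e, measure_empty, indicator_of_notMem (fun h => hx (by linarith [mem_Ici.1 h]))]

lemma lintegral_loss_eq (hc : Continuous a) (ha : Antitone a) (h0 : ∀ u, 0 ≤ a u)
    (hi : IntegrableOn a (Ici 0)) {τ d : ℝ} (hτ : 0 ≤ τ) (hd : 0 ≤ d) :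
    ∫⁻ u in Ici τ, ENNReal.ofReal (a u - a (u + d))
      = ∫⁻ u in Ico τ (τ + d), ENNReal.ofReal (a u) := by
  have hshift : ∫⁻ u in Ici τ, ENNReal.ofReal (a (u + d)) = tailMass a (τ + d) := by
    rw [tailMass, ← lintegral_indicator measurableSet_Ici, ← lintegral_indicator measurableSet_Ici,
      ← lintegral_add_right_eq_self (μ := volume)
        ((Ici (τ + d)).indicator fun u => ENNReal.ofReal (a u)) d]
    refine lintegral_congr fun u => ?_
    by_cases hu : τ ≤ u
    · rw [indicator_of_mem (by simpa using hu), indicator_of_mem (by simpa using hu)]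
    · rw [indicator_of_notMem (by simpa using hu), indicator_of_notMem (by simpa using hu)]
  have hsplit : tailMass a τ
      = (∫⁻ u in Ici τ, ENNReal.ofReal (a u - a (u + d))) + tailMass a (τ + d) := by
    rw [← hshift, ← lintegral_add_left (by fun_prop), tailMass]
    refine lintegral_congr fun u => ?_
    rw [← ENNReal.ofReal_add (sub_nonneg.2 (ha (by linarith))) (h0 _), sub_add_cancel]
  have hunion : tailMass a τ
      = (∫⁻ u in Ico τ (τ + d), ENNReal.ofReal (a u)) + tailMass a (τ + d) := by
    rw [tailMass, tailMass, ← Ico_union_Ici_eq_Ici (show τ ≤ τ + d by linarith),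
      lintegral_union measurableSet_Ici (Set.disjoint_left.2 fun x h1 h2 => by
        have := h1.2; have := mem_Ici.1 h2; linarith)]
  have hfin : tailMass a (τ + d) ≠ ⊤ := (tailMass_lt_top hi (by linarith)).ne
  exact (ENNReal.add_left_inj hfin).1 (hsplit.symm.trans hunion)

lemma volume_trawl_loss_le (hc : Continuous a) (ha : Antitone a) (h0 : ∀ u, 0 ≤ a u)
    (hi : IntegrableOn a (Ici 0)) {s t d : ℝ} (hst : s ≤ t) (hd : 0 ≤ d) :
    volume ((trawlSetAt a s ∩ trawlSetAt a t) \ trawlSetAt a (t + d))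
      ≤ ENNReal.ofReal (a (t - s) * d) := by
  rw [volume_trawl_loss hc ha h0 hst hd, lintegral_loss_eq hc ha h0 hi (by linarith) hd]
  calc ∫⁻ u in Ico (t - s) (t - s + d), ENNReal.ofReal (a u)
      ≤ ∫⁻ _ in Ico (t - s) (t - s + d), ENNReal.ofReal (a (t - s)) :=
        setLIntegral_mono measurable_const fun u hu => ENNReal.ofReal_le_ofReal (ha hu.1)
    _ = _ := by
        rw [setLIntegral_const, Real.volume_Ico, add_sub_cancel_left,
          ← ENNReal.ofReal_mul (h0 _)]

lemma le_volume_trawl_loss (hc : Continuous a) (ha : Antitone a) (h0 : ∀ u, 0 ≤ a u)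
    (hi : IntegrableOn a (Ici 0)) {s t d : ℝ} (hst : s ≤ t) (hd : 0 ≤ d) :
    ENNReal.ofReal (a (t - s + d) * d)
      ≤ volume ((trawlSetAt a s ∩ trawlSetAt a t) \ trawlSetAt a (t + d)) := by
  rw [volume_trawl_loss hc ha h0 hst hd, lintegral_loss_eq hc ha h0 hi (by linarith) hd]
  calc _ = ∫⁻ _ in Ico (t - s) (t - s + d), ENNReal.ofReal (a (t - s + d)) := by
        rw [setLIntegral_const, Real.volume_Ico, add_sub_cancel_left,
          ← ENNReal.ofReal_mul (h0 _)]
    _ ≤ ∫⁻ u in Ico (t - s) (t - s + d), ENNReal.ofReal (a u) :=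
        setLIntegral_mono (by fun_prop) fun u hu => ENNReal.ofReal_le_ofReal (ha hu.2.le)

lemma volume_trawl_gain_le (ha : Antitone a) {t d : ℝ} (hd : 0 ≤ d) :
    volume (trawlSetAt a (t + d) \ trawlSetAt a t) ≤ ENNReal.ofReal (a 0 * d) := by
  have hsub : trawlSetAt a (t + d) \ trawlSetAt a t ⊆ Icc t (t + d) ×ˢ Icc 0 (a 0) := by
    rintro x ⟨h1, h2⟩
    rw [mem_trawlSetAt] at h1 h2
    have h3 : t ≤ x.1 := by
      by_contra! h3
      exact h2 ⟨h3.le, h1.2.1, h1.2.2.trans (ha (by linarith))⟩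
    exact ⟨⟨h3, h1.1⟩, h1.2.1, h1.2.2.trans (ha (by linarith [h1.1]))⟩
  refine (measure_mono hsub).trans (le_of_eq ?_)
  rw [Measure.volume_eq_prod, Measure.prod_prod, Real.volume_Icc, Real.volume_Icc,
    ← ENNReal.ofReal_mul (by linarith)]
  congr 1; ring

/-- The square `[-m, m]²`. -/
def box (m : ℕ) : Set (ℝ × ℝ) := Icc (-(m : ℝ)) m ×ˢ Icc (-(m : ℝ)) m

lemma measurableSet_box (m : ℕ) : MeasurableSet (box m) := measurableSet_Icc.prod measurableSet_Icc

lemma isBounded_box (m : ℕ) : Bornology.IsBounded (box m) :=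
  (Metric.isBounded_Icc _ _).prod (Metric.isBounded_Icc _ _)

lemma tendsto_volume_inter_box (B : Set (ℝ × ℝ)) :
    Tendsto (fun m => volume (B ∩ box m)) atTop (𝓝 (volume B)) := by
  have hmono : Monotone fun m => B ∩ box m := by
    intro m m' h
    have : (m : ℝ) ≤ m' := by exact_mod_cast h
    refine inter_subset_inter_right _ (prod_mono ?_ ?_) <;>
      exact Icc_subset_Icc (by linarith) this
  have hU : ⋃ m, B ∩ box m = B := by
    rw [← inter_iUnion]
    refine inter_eq_left.2 fun x _ => ?_
    obtain ⟨m, hm⟩ := exists_nat_ge (max |x.1| |x.2|)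
    exact mem_iUnion.2 ⟨m, abs_le.1 ((le_max_left _ _).trans hm),
      abs_le.1 ((le_max_right _ _).trans hm)⟩
  have := tendsto_measure_iUnion_atTop (μ := volume) hmono
  rwa [hU] at this

end Geometry

/-! ### The cells of a family of sets -/

section CellSets

/-- The points that belong to `E k` exactly for `c.1 ≤ k ≤ c.2`. -/
def cellSet (n : ℕ) (E : ℕ → Set (ℝ × ℝ)) (c : ℕ × ℕ) : Set (ℝ × ℝ) :=
  {x | c.1 ≤ c.2 ∧ c.2 ≤ n ∧ ∀ k ≤ n, x ∈ E k ↔ c.1 ≤ k ∧ k ≤ c.2}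

variable {n : ℕ} {E : ℕ → Set (ℝ × ℝ)}

lemma pairwise_disjoint_cellSet :
    Pairwise (fun c d => Disjoint (cellSet n E c) (cellSet n E d)) := by
  intro c d hcd
  refine Set.disjoint_left.2 fun x ⟨h1, h2, h3⟩ ⟨h4, h5, h6⟩ => hcd ?_
  have a1 := (h6 c.1 (by omega)).1 ((h3 c.1 (by omega)).2 ⟨le_rfl, h1⟩)
  have a2 := (h6 c.2 (by omega)).1 ((h3 c.2 (by omega)).2 ⟨h1, le_rfl⟩)
  have a3 := (h3 d.1 (by omega)).1 ((h6 d.1 (by omega)).2 ⟨le_rfl, h4⟩)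
  have a4 := (h3 d.2 (by omega)).1 ((h6 d.2 (by omega)).2 ⟨h4, le_rfl⟩)
  exact Prod.ext (by omega) (by omega)

lemma cellSet_subset (c : ℕ × ℕ) : cellSet n E c ⊆ E c.1 := fun _ h =>
  (h.2.2 c.1 (h.1.trans h.2.1)).2 ⟨le_rfl, h.1⟩

lemma measurableSet_cellSet (hE : ∀ k, MeasurableSet (E k)) (c : ℕ × ℕ) :
    MeasurableSet (cellSet n E c) := by
  have e : cellSet n E c = {_x | c.1 ≤ c.2} ∩ ({_x | c.2 ≤ n} ∩
      ⋂ k, ⋂ (_ : k ≤ n), {x | x ∈ E k ↔ c.1 ≤ k ∧ k ≤ c.2}) := by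
    ext x; simp [cellSet]
  rw [e]
  refine (MeasurableSet.const _).inter ((MeasurableSet.const _).inter
    (MeasurableSet.iInter fun k => MeasurableSet.iInter fun _ => ?_))
  by_cases h : c.1 ≤ k ∧ k ≤ c.2
  · simpa [h] using hE k
  · have : {x : ℝ × ℝ | x ∈ E k ↔ c.1 ≤ k ∧ k ≤ c.2} = (E k)ᶜ := by
      ext x; simp only [mem_ofPred_eq, mem_compl_iff]; tauto
    rw [this]; exact (hE k).compl

/-- Every point of some `E k` lies in a cell, if the times at which a point is alive form
an interval. -/
lemma exists_mem_cellSet (hint : ∀ i k j, i ≤ k → k ≤ j → E i ∩ E j ⊆ E k) {k : ℕ} (hk : k ≤ n)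
    {x : ℝ × ℝ} (hx : x ∈ E k) : ∃ c : ℕ × ℕ, c.1 ≤ k ∧ k ≤ c.2 ∧ c.2 ≤ n ∧ x ∈ cellSet n E c := by
  classical
  let F : Finset ℕ := (Finset.range (n + 1)).filter fun k => x ∈ E k
  have hmem : ∀ j, j ∈ F ↔ j ≤ n ∧ x ∈ E j := fun j => by simp [F]
  have hkF : k ∈ F := (hmem k).2 ⟨hk, hx⟩
  have hne : F.Nonempty := ⟨k, hkF⟩
  have h1 := (hmem _).1 (F.min'_mem hne)
  have h2 := (hmem _).1 (F.max'_mem hne)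
  refine ⟨(F.min' hne, F.max' hne), F.min'_le k hkF, F.le_max' k hkF, h2.1, ?_, h2.1, ?_⟩
  · exact (F.min'_le k hkF).trans (F.le_max' k hkF)
  · intro j hj
    constructor
    · intro hxj
      have := (hmem j).2 ⟨hj, hxj⟩
      exact ⟨F.min'_le j this, F.le_max' j this⟩
    · rintro ⟨h3, h4⟩
      exact hint _ _ _ h3 h4 ⟨h1.2, h2.2⟩

lemma mem_cells {p : ℕ × ℕ → Prop} [DecidablePred p] {c : ℕ × ℕ} :
    c ∈ cells n p ↔ c.1 ≤ n ∧ c.2 ≤ n ∧ p c := by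
  simp [cells, and_assoc]

lemma biUnion_alive (hint : ∀ i k j, i ≤ k → k ≤ j → E i ∩ E j ⊆ E k) {k : ℕ} (hk : k ≤ n) :
    ⋃ c ∈ cells n (alive k), cellSet n E c = E k := by
  ext x
  simp only [mem_iUnion, exists_prop]
  constructor
  · rintro ⟨c, hc, hx⟩
    exact (hx.2.2 k hk).2 (mem_cells.1 hc).2.2
  · intro hx
    obtain ⟨c, h1, h2, h3, h4⟩ := exists_mem_cellSet hint hk hx
    exact ⟨c, mem_cells.2 ⟨by omega, h3, h1, h2⟩, h4⟩

lemma biUnion_born_subset {k : ℕ} (hk : k < n) :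
    ⋃ c ∈ cells n (born k), cellSet n E c ⊆ E (k + 1) \ E k := by
  refine iUnion₂_subset fun c hc x hx => ?_
  obtain ⟨-, -, h1, h2⟩ := mem_cells.1 hc
  refine ⟨(hx.2.2 (k + 1) hk).2 ⟨h1.le, h2⟩, fun h => ?_⟩
  have := (hx.2.2 k hk.le).1 h
  omega

lemma biUnion_dies_subset {k : ℕ} (hk : k < n) :
    ⋃ c ∈ cells n (dies k), cellSet n E c ⊆ E k \ E (k + 1) := by
  refine iUnion₂_subset fun c hc x hx => ?_
  obtain ⟨-, -, h1, h2⟩ := mem_cells.1 hc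
  refine ⟨(hx.2.2 k hk.le).2 ⟨h1, h2.ge⟩, fun h => ?_⟩
  have := (hx.2.2 (k + 1) hk).1 h
  omega

lemma biUnion_aliveDies (hint : ∀ i k j, i ≤ k → k ≤ j → E i ∩ E j ⊆ E k) {i k : ℕ}
    (hik : i ≤ k) (hk : k < n) :
    ⋃ c ∈ cells n (aliveDies i k), cellSet n E c = (E i ∩ E k) \ E (k + 1) := by
  ext x
  simp only [mem_iUnion, exists_prop]
  constructor
  · rintro ⟨c, hc, hx⟩
    obtain ⟨-, -, h1, h2⟩ := mem_cells.1 hc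
    refine ⟨⟨(hx.2.2 i (by omega)).2 ⟨h1, by omega⟩, (hx.2.2 k hk.le).2 ⟨by omega, h2.ge⟩⟩,
      fun h => ?_⟩
    have := (hx.2.2 (k + 1) hk).1 h
    omega
  · rintro ⟨⟨h1, h2⟩, h3⟩
    obtain ⟨c, h4, h5, h6, hx⟩ := exists_mem_cellSet hint hk.le h2
    have h7 := (hx.2.2 i (by omega)).1 h1
    have h8 : ¬ (c.1 ≤ k + 1 ∧ k + 1 ≤ c.2) := fun h => h3 ((hx.2.2 (k + 1) hk).2 h)
    exact ⟨c, mem_cells.2 ⟨by omega, h6, h7.1, by omega⟩, hx⟩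

variable {Ω : Type*} [MeasurableSpace Ω] {P : Measure Ω} [IsProbabilityMeasure P]
  {τ : Triplet} {L : Set (ℝ × ℝ) → Ω → ℝ}

lemma sum_volume_cellSet (hE : ∀ k, MeasurableSet (E k)) (hEb : ∀ k, Bornology.IsBounded (E k))
    (S : Finset (ℕ × ℕ)) :
    ∑ c ∈ S, (volume (cellSet n E c)).toReal = (volume (⋃ c ∈ S, cellSet n E c)).toReal := by
  rw [measure_biUnion_finset (fun c _ d _ h => pairwise_disjoint_cellSet h)
    (fun c _ => measurableSet_cellSet hE c),
    ENNReal.toReal_sum fun c _ => ((hEb c.1).subset (cellSet_subset c)).measure_lt_top.ne]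

lemma sum_centred_cellSet (hL : IsLevyBasis P τ L) (hE : ∀ k, MeasurableSet (E k))
    (hEb : ∀ k, Bornology.IsBounded (E k)) (S : Finset (ℕ × ℕ)) :
    ∀ᵐ ω ∂P, ∑ c ∈ S, hL.centred (cellSet n E c) ω = hL.centred (⋃ c ∈ S, cellSet n E c) ω := by
  filter_upwards [hL.biUnion (cellSet n E) (measurableSet_cellSet hE)
    (fun c => (hEb c.1).subset (cellSet_subset c)) pairwise_disjoint_cellSet S] with ω h
  simp only [IsLevyBasis.centred]
  rw [h, Finset.sum_sub_distrib, ← Finset.sum_mul, sum_volume_cellSet hE hEb]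

lemma cellModel_cellSet (hL : IsLevyBasis P τ L) {seed : Measure ℝ} (hseed : τ.IsSeedLaw seed)
    (hvar : Var[id; seed] = 1) {s : ℝ} (hs : 2 ≤ s)
    (hmom2 : Integrable (fun x : ℝ => |x| ^ (2 : ℝ)) seed)
    (hmom : Integrable (fun x : ℝ => |x| ^ s) seed) {K V : ℝ}
    (hKV : ∀ B, MeasurableSet B → Bornology.IsBounded B → (volume B).toReal ≤ V →
      ∫ ω, |hL.centred B ω| ^ s ∂P ≤ K * (volume B).toReal)
    (hE : ∀ k, MeasurableSet (E k)) (hEb : ∀ k, Bornology.IsBounded (E k)) :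
    CellModel P n (fun c => hL.centred (cellSet n E c))
      (fun c => (volume (cellSet n E c)).toReal) s K V := by
  have hm := fun c => measurableSet_cellSet (n := n) hE c
  have hb := fun c => (hEb c.1).subset (cellSet_subset (n := n) (E := E) c)
  have hmU : ∀ S : Finset (ℕ × ℕ), MeasurableSet (⋃ c ∈ S, cellSet n E c) := fun S =>
    Finset.measurableSet_biUnion S fun c _ => hm c
  have hbU : ∀ S : Finset (ℕ × ℕ), Bornology.IsBounded (⋃ c ∈ S, cellSet n E c) := fun S =>
    (Bornology.isBounded_biUnion S.finite_toSet).2 fun c _ => hb c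
  refine ⟨fun c => hL.measurable_centred (hm c) (hb c), ?_, fun c => ENNReal.toReal_nonneg,
    fun S => ?_, fun S => ?_, fun S => ?_, fun S hS => ?_⟩
  · have h1 := hL.iIndepFun_of_countable Nat.pairEquiv (cellSet n E) hm hb
      pairwise_disjoint_cellSet
    exact h1.comp (fun c x => x - (volume (cellSet n E c)).toReal * hL.meanRate)
      fun c => by fun_prop
  · exact memLp_finsetSum S fun c _ => hL.memLp_centred hseed (by linarith) hmom (hm c) (hb c)
  · rw [integral_congr_ae (sum_centred_cellSet hL hE hEb S)]
    exact hL.integral_centred hseed hmom2 (hmU S) (hbU S)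
  · rw [sum_volume_cellSet hE hEb, ← hL.integral_centred_sq hseed hmom2 hvar (hmU S) (hbU S)]
    refine integral_congr_ae ((sum_centred_cellSet (n := n) hL hE hEb S).mono fun ω h => ?_)
    simp only [h]
  · rw [sum_volume_cellSet hE hEb] at hS ⊢
    refine le_trans (le_of_eq ?_) (hKV _ (hmU S) (hbU S) hS)
    refine integral_congr_ae ((sum_centred_cellSet (n := n) hL hE hEb S).mono fun ω h => ?_)
    simp only [h]

end CellSets

end Trawl

namespace Trawl

/-! ### Moments of the estimator -/

section Grid

lemma aHat_grid (x : ℝ → ℝ) {δ : ℝ} (hδ : 0 < δ) (n l : ℕ) :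
    aHat x δ n (l * δ) = -(1 / (n * δ)) * ∑ i ∈ Finset.range (n - l),
      (x (i * δ) - sampleMean x δ n) * (x ((l + i + 1 : ℕ) * δ) - x ((l + i : ℕ) * δ)) := by
  have hfl : ⌊(l : ℝ) * δ / δ⌋₊ = l := by
    rw [mul_div_cancel_right₀ _ hδ.ne', Nat.floor_natCast]
  rw [aHat, hfl, Finset.sum_Ico_eq_sum_range]
  congr 1
  refine Finset.sum_congr rfl fun i _ => ?_
  congr 3
  · push_cast; ring_nf
  · push_cast; ring_nf

lemma sampleMean_sub_const (x : ℝ → ℝ) (c δ : ℝ) {n : ℕ} (hn : 0 < n) :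
    sampleMean (fun s => x s - c) δ n = sampleMean x δ n - c := by
  have : (n : ℝ) ≠ 0 := by positivity
  simp only [sampleMean, Finset.sum_sub_distrib, Finset.sum_const, Finset.card_range,
    nsmul_eq_mul]
  rw [sub_div, mul_div_cancel_left₀ _ this]

lemma aHat_sub_const (x : ℝ → ℝ) (c δ : ℝ) {n : ℕ} (hn : 0 < n) (t : ℝ) :
    aHat (fun s => x s - c) δ n t = aHat x δ n t := by
  simp only [aHat, sampleMean_sub_const x c δ hn]
  congr 1
  refine Finset.sum_congr rfl fun k _ => ?_
  ring

lemma aHat_eq_quadratic (x : ℝ → ℝ) {δ : ℝ} (hδ : 0 < δ) {n l : ℕ} (hl : l ≤ n) (v : ℕ → ℝ) :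
    aHat x δ n (l * δ) - (1 / (n * δ)) * ∑ i ∈ Finset.range (n - l), v i
      = (1 / (n * δ)) * (sampleMean x δ n * (x (n * δ) - x (l * δ))
        + -∑ i ∈ Finset.range (n - l),
          (x (i * δ) * (x ((l + i + 1 : ℕ) * δ) - x ((l + i : ℕ) * δ)) + v i)) := by
  have htel : ∑ i ∈ Finset.range (n - l), (x ((l + i + 1 : ℕ) * δ) - x ((l + i : ℕ) * δ))
      = x (n * δ) - x (l * δ) := by
    have := Finset.sum_range_sub (fun i => x ((l + i : ℕ) * δ)) (n - l)
    simp only [Nat.add_sub_cancel' hl, add_zero] at this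
    rw [← this]
    rfl
  rw [aHat_grid x hδ, ← htel]
  simp only [sub_mul, Finset.sum_sub_distrib, Finset.sum_add_distrib, ← Finset.mul_sum]
  ring

lemma tendsto_sampleMean {x : ℕ → ℝ → ℝ} {y : ℝ → ℝ} {δ : ℝ} {n : ℕ}
    (h : ∀ k ≤ n, Tendsto (fun j => x j (k * δ)) atTop (𝓝 (y (k * δ)))) :
    Tendsto (fun j => sampleMean (x j) δ n) atTop (𝓝 (sampleMean y δ n)) := by
  unfold sampleMean
  exact (tendsto_finsetSum _ fun k hk => h k (Finset.mem_range.1 hk).le).div_const _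

lemma tendsto_aHat {x : ℕ → ℝ → ℝ} {y : ℝ → ℝ} {δ : ℝ} (hδ : 0 < δ) {n : ℕ} (l : ℕ)
    (h : ∀ k ≤ n, Tendsto (fun j => x j (k * δ)) atTop (𝓝 (y (k * δ)))) :
    Tendsto (fun j => aHat (x j) δ n (l * δ)) atTop (𝓝 (aHat y δ n (l * δ))) := by
  simp only [aHat_grid _ hδ]
  refine Tendsto.const_mul _ (tendsto_finsetSum _ fun i hi => ?_)
  have hi := Finset.mem_range.1 hi
  exact ((h i (by omega)).sub (tendsto_sampleMean h)).mul
    ((h (l + i + 1) (by omega)).sub (h (l + i) (by omega)))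

lemma abs_sampleMean_rpow_le (x : ℝ → ℝ) (δ : ℝ) {n : ℕ} (hn : 0 < n) {s : ℝ} (hs : 1 ≤ s) :
    |sampleMean x δ n| ^ s ≤ (∑ k ∈ Finset.range n, |x (k * δ)| ^ s) / n := by
  have hn' : (n : ℝ) ≠ 0 := by positivity
  have h1 := Real.rpow_arith_mean_le_arith_mean_rpow (Finset.range n) (fun _ => 1 / (n : ℝ))
    (fun k => |x (k * δ)|) (fun _ _ => by positivity) (by simp [hn']) (fun _ _ => abs_nonneg _) hs
  rw [← Finset.mul_sum, ← Finset.mul_sum] at h1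
  have h2 : |sampleMean x δ n| ≤ 1 / n * ∑ k ∈ Finset.range n, |x (k * δ)| := by
    rw [sampleMean, abs_div, abs_of_nonneg (Nat.cast_nonneg (α := ℝ) n), one_div_mul_eq_div]
    gcongr
    exact Finset.abs_sum_le_sum_abs _ _
  calc _ ≤ (1 / n * ∑ k ∈ Finset.range n, |x (k * δ)|) ^ s :=
        Real.rpow_le_rpow (abs_nonneg _) h2 (by linarith)
    _ ≤ _ := h1
    _ = _ := by ring

end Grid

section Truncated

/-- Constant in the moment bound for the estimator. -/
noncomputable def estimatorConst (K V κ r : ℝ) : ℝ :=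
  2 ^ (r - 1) * (quadConst K V κ r + (1 + 2 ^ (2 * r)) * ((1 + K) * V))

variable {Ω : Type*} [MeasurableSpace Ω] {P : Measure Ω} [IsProbabilityMeasure P]

/-- Moment bound for the estimator built on a path whose values on the grid are sums of cells. -/
lemma CellModel.moment_aHat {n : ℕ} {ξ : ℕ × ℕ → Ω → ℝ} {w : ℕ × ℕ → ℝ} {s K V : ℝ}
    (h : CellModel P n ξ w s K V) {κ δ r : ℝ} (hK : 0 ≤ K)
    (hV : 0 ≤ V) (hκ : 0 ≤ κ) (hδ : 0 < δ) (hT : 1 ≤ n * δ) (hr : 2 ≤ r) (hrs : 2 * r ≤ s)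
    {l : ℕ} (hl : l ≤ n) (Y : ℝ → Ω → ℝ)
    (hY : ∀ k ≤ n, ∀ᵐ ω ∂P, Y (k * δ) ω = cellSum n ξ (alive k) ω)
    (hlive : ∀ k ≤ n, ∑ c ∈ cells n (alive k), w c ≤ V)
    (hborn : ∀ k < n, ∑ c ∈ cells n (born k), w c ≤ κ * δ)
    (hdies : ∀ k < n, ∑ c ∈ cells n (dies k), w c ≤ κ * δ) :
    ∫⁻ ω, ENNReal.ofReal (|aHat (fun t => Y t ω) δ n (l * δ) - (1 / (n * δ)) *
      ∑ i ∈ Finset.range (n - l), ∑ c ∈ cells n (aliveDies i (l + i)), w c| ^ r) ∂P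
      ≤ ENNReal.ofReal (estimatorConst K V κ r * (n * δ) ^ (-(r / 2))) := by
  have hr0 : 0 < r := by linarith
  have hnpos : 0 < n := by
    rcases Nat.eq_zero_or_pos n with h0 | h0
    · subst h0; simp at hT; linarith
    · exact h0
  set T := (n : ℝ) * δ with hTdef
  have hT0 : 0 < T := by linarith
  obtain ⟨hqm, hq⟩ := h.moment_quadratic hK hV hκ hδ.le hT hr hrs le_rfl l hlive hborn hdies
  set Q : Ω → ℝ := fun ω => ∑ i ∈ Finset.range (n - l), (cellSum n ξ (alive i) ω *
      (cellSum n ξ (alive (l + i + 1)) ω - cellSum n ξ (alive (l + i)) ω)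
        + ∑ c ∈ cells n (aliveDies i (l + i)), w c) with hQ
  have hYall : ∀ᵐ ω ∂P, ∀ k ≤ n, Y (k * δ) ω = cellSum n ξ (alive k) ω := by
    refine ae_all_iff.2 fun k => ?_
    by_cases hk : k ≤ n
    · exact (hY k hk).mono fun ω h _ => h
    · exact ae_of_all _ fun ω h => absurd h hk
  set M : ℝ := (1 + K) * V with hM
  have hM0 : 0 ≤ M := by positivity
  have hi : ∀ k, Integrable (fun ω => |cellSum n ξ (alive k) ω| ^ (2 * r)) P := fun k =>
    integrable_abs_rpow (by linarith) (h.memLp_cellSum (alive k) hrs)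
  have hmom : ∀ k ≤ n, ∫ ω, |cellSum n ξ (alive k) ω| ^ (2 * r) ∂P ≤ M := fun k hk =>
    (h.moment_cellSum (alive k) (by linarith) hrs (hlive k hk)).trans (by
      rw [hM]; gcongr; exact hlive k hk)
  set c := (2 : ℝ) ^ (r - 1) with hc
  have hc0 : 0 < c := by positivity
  set d := (2 : ℝ) ^ (2 * r - 1) with hd
  have hd0 : 0 < d := by positivity
  let G : Ω → ℝ := fun ω => T ^ (-r) * (c *
    ((∑ k ∈ Finset.range n, |cellSum n ξ (alive k) ω| ^ (2 * r)) / n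
      + d * (|cellSum n ξ (alive n) ω| ^ (2 * r) + |cellSum n ξ (alive l) ω| ^ (2 * r))
      + |Q ω| ^ r))
  have iQ := integrable_abs_rpow hr0 hqm
  have i1 : Integrable (fun ω => (∑ k ∈ Finset.range n,
      |cellSum n ξ (alive k) ω| ^ (2 * r)) / n) P :=
    (integrable_finsetSum _ fun k _ => hi k).div_const _
  have i2 : Integrable (fun ω => d * (|cellSum n ξ (alive n) ω| ^ (2 * r)
      + |cellSum n ξ (alive l) ω| ^ (2 * r))) P := ((hi n).add (hi l)).const_mul d
  have i12 : Integrable (fun ω => (∑ k ∈ Finset.range n,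
      |cellSum n ξ (alive k) ω| ^ (2 * r)) / n + d * (|cellSum n ξ (alive n) ω| ^ (2 * r)
      + |cellSum n ξ (alive l) ω| ^ (2 * r))) P := i1.add i2
  have iG : Integrable G P := ((i12.add iQ).const_mul c).const_mul _
  have hGint : ∫ ω, G ω ∂P ≤ estimatorConst K V κ r * T ^ (-(r / 2)) := by
    have hval : ∫ ω, G ω ∂P = T ^ (-r) * (c *
        ((∑ k ∈ Finset.range n, ∫ ω, |cellSum n ξ (alive k) ω| ^ (2 * r) ∂P) / n
        + d * (∫ ω, |cellSum n ξ (alive n) ω| ^ (2 * r) ∂P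
          + ∫ ω, |cellSum n ξ (alive l) ω| ^ (2 * r) ∂P)
        + ∫ ω, |Q ω| ^ r ∂P)) := by
      simp only [G]
      rw [integral_const_mul, integral_const_mul, integral_add i12 iQ, integral_add i1 i2,
        integral_div, integral_finsetSum _ fun k _ => hi k, integral_const_mul,
        integral_add (hi n) (hi l)]
    have hmean : (∑ k ∈ Finset.range n, ∫ ω, |cellSum n ξ (alive k) ω| ^ (2 * r) ∂P) / n ≤ M := by
      rw [div_le_iff₀ (by positivity)]
      refine (Finset.sum_le_sum fun k hk => hmom k (Finset.mem_range.1 hk).le).trans ?_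
      simp [mul_comm]
    have hTT : T ^ (-r) * T ^ (r / 2) = T ^ (-(r / 2)) := by
      rw [← Real.rpow_add hT0]; congr 1; ring
    have hT1 : 1 ≤ T ^ (r / 2) := Real.one_le_rpow hT (by linarith)
    have h2d : (2 : ℝ) ^ (2 * r) = 2 * d := by
      rw [hd]
      conv_lhs => rw [show 2 * r = 1 + (2 * r - 1) by ring]
      rw [Real.rpow_add two_pos, Real.rpow_one]
    rw [hval]
    calc _ ≤ T ^ (-r) * (c * (M + d * (M + M) + quadConst K V κ r * T ^ (r / 2))) := by
          gcongr
          · exact hmom n le_rfl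
          · exact hmom l hl
      _ ≤ T ^ (-r) * (c * ((M + d * (M + M)) * T ^ (r / 2)
            + quadConst K V κ r * T ^ (r / 2))) := by
          gcongr
          exact le_mul_of_one_le_right (by positivity) hT1
      _ = estimatorConst K V κ r * (T ^ (-r) * T ^ (r / 2)) := by
          rw [estimatorConst, h2d, ← hc, ← hM]; ring
      _ = _ := by rw [hTT]
  have hbound : ∀ᵐ ω ∂P, |aHat (fun t => Y t ω) δ n (l * δ) - (1 / T) *
      ∑ i ∈ Finset.range (n - l), ∑ c ∈ cells n (aliveDies i (l + i)), w c| ^ r ≤ G ω := by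
    filter_upwards [hYall] with ω hω
    rw [hTdef, aHat_eq_quadratic _ hδ hl, ← hTdef]
    have hQe : ∑ i ∈ Finset.range (n - l), (Y (i * δ) ω *
        (Y ((l + i + 1 : ℕ) * δ) ω - Y ((l + i : ℕ) * δ) ω)
          + ∑ c ∈ cells n (aliveDies i (l + i)), w c) = Q ω := by
      rw [hQ]
      refine Finset.sum_congr rfl fun i hi => ?_
      have hi := Finset.mem_range.1 hi
      rw [hω i (by omega), hω (l + i + 1) (by omega), hω (l + i) (by omega)]
    rw [hQe, hω n le_rfl, hω l hl, abs_mul, Real.mul_rpow (abs_nonneg _) (abs_nonneg _)]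
    have e1 : |1 / T| ^ r = T ^ (-r) := by
      rw [abs_of_pos (by positivity), one_div, Real.inv_rpow hT0.le, Real.rpow_neg hT0.le]
    rw [e1]
    have e2 := rpow_add_le_two r (by linarith) (sampleMean (fun t => Y t ω) δ n *
      (cellSum n ξ (alive n) ω - cellSum n ξ (alive l) ω)) (-Q ω)
    rw [abs_neg, ← hc] at e2
    have e3 : |sampleMean (fun t => Y t ω) δ n *
        (cellSum n ξ (alive n) ω - cellSum n ξ (alive l) ω)| ^ r
        ≤ |sampleMean (fun t => Y t ω) δ n| ^ (2 * r)
          + |cellSum n ξ (alive n) ω - cellSum n ξ (alive l) ω| ^ (2 * r) := by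
      generalize sampleMean (fun t => Y t ω) δ n = x
      generalize cellSum n ξ (alive n) ω - cellSum n ξ (alive l) ω = y
      rw [abs_mul, Real.mul_rpow (abs_nonneg _) (abs_nonneg _), two_mul,
        Real.rpow_add_of_nonneg (abs_nonneg _) hr0.le hr0.le,
        Real.rpow_add_of_nonneg (abs_nonneg _) hr0.le hr0.le]
      nlinarith [sq_nonneg (|x| ^ r - |y| ^ r), Real.rpow_nonneg (abs_nonneg x) r,
        Real.rpow_nonneg (abs_nonneg y) r]
    have e4 := abs_sampleMean_rpow_le (fun t => Y t ω) δ hnpos (s := 2 * r) (by linarith)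
    have e5 : ∑ k ∈ Finset.range n, |Y (k * δ) ω| ^ (2 * r)
        = ∑ k ∈ Finset.range n, |cellSum n ξ (alive k) ω| ^ (2 * r) :=
      Finset.sum_congr rfl fun k hk => by rw [hω k (Finset.mem_range.1 hk).le]
    simp only [e5] at e4
    have e6 := rpow_add_le_two (2 * r) (by linarith) (cellSum n ξ (alive n) ω)
      (-cellSum n ξ (alive l) ω)
    rw [abs_neg, ← hd, ← sub_eq_add_neg] at e6
    simp only [G]
    gcongr
    refine e2.trans ?_
    gcongr
    exact e3.trans (add_le_add e4 e6)
  calc _ ≤ ∫⁻ ω, ENNReal.ofReal (G ω) ∂P :=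
        lintegral_mono_ae (hbound.mono fun ω h => ENNReal.ofReal_le_ofReal h)
    _ = ENNReal.ofReal (∫ ω, G ω ∂P) :=
        (ofReal_integral_eq_lintegral_ofReal iG
          (hbound.mono fun ω h => le_trans (by positivity) h)).symm
    _ ≤ _ := ENNReal.ofReal_le_ofReal hGint

end Truncated

end Trawl

namespace Trawl

section Limit

variable {Ω : Type*} [MeasurableSpace Ω] {P : Measure Ω}

lemma exists_common_subseq {ι : Type*} (f : ι → ℕ → Ω → ℝ) (g : ι → Ω → ℝ) (S : Finset ι)
    (h : ∀ i, TendstoInMeasure P (f i) atTop (g i)) :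
    ∃ ns : ℕ → ℕ, StrictMono ns ∧
      ∀ i ∈ S, ∀ᵐ ω ∂P, Tendsto (fun j => f i (ns j) ω) atTop (𝓝 (g i ω)) := by
  classical
  induction S using Finset.induction_on with
  | empty => exact ⟨id, strictMono_id, by simp⟩
  | insert i S _ ih =>
    obtain ⟨ns, hns, hS⟩ := ih
    obtain ⟨ms, hms, hi⟩ := ((h i).comp hns.tendsto_atTop).exists_seq_tendsto_ae
    refine ⟨ns ∘ ms, hns.comp hms, fun j hj => ?_⟩
    rcases Finset.mem_insert.1 hj with rfl | hj
    · exact hi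
    · exact (hS j hj).mono fun ω hω => hω.comp hms.tendsto_atTop

lemma lintegral_abs_rpow_le_of_tendsto {f : ℕ → Ω → ℝ} {g : Ω → ℝ} {r : ℝ} (hr : 0 ≤ r)
    (hf : ∀ j, AEMeasurable (f j) P) (h : ∀ᵐ ω ∂P, Tendsto (fun j => f j ω) atTop (𝓝 (g ω)))
    {C : ENNReal} (hC : ∀ j, ∫⁻ ω, ENNReal.ofReal (|f j ω| ^ r) ∂P ≤ C) :
    ∫⁻ ω, ENNReal.ofReal (|g ω| ^ r) ∂P ≤ C := by
  have hcont : Continuous fun x : ℝ => ENNReal.ofReal (|x| ^ r) :=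
    ENNReal.continuous_ofReal.comp (continuous_abs.rpow_const fun _ => Or.inr hr)
  calc ∫⁻ ω, ENNReal.ofReal (|g ω| ^ r) ∂P
      = ∫⁻ ω, liminf (fun j => ENNReal.ofReal (|f j ω| ^ r)) atTop ∂P :=
        lintegral_congr_ae (h.mono fun ω hω => ((hcont.tendsto _).comp hω).liminf_eq.symm)
    _ ≤ liminf (fun j => ∫⁻ ω, ENNReal.ofReal (|f j ω| ^ r) ∂P) atTop :=
        lintegral_liminf_le' fun j => hcont.measurable.comp_aemeasurable (hf j)
    _ ≤ C := liminf_le_of_le (by isBoundedDefault) fun b hb => by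
        obtain ⟨j, hj⟩ := hb.exists
        exact hj.trans (hC j)

/-- The volume of the part of the trawl sets at the times `iδ` and `(l + i)δ` that is lost
between `(l + i)δ` and `(l + i + 1)δ`. -/
noncomputable def lossVolume (a : ℝ → ℝ) (δ : ℝ) (l i : ℕ) : ℝ :=
  (volume ((trawlSetAt a (i * δ) ∩ trawlSetAt a ((l + i : ℕ) * δ)) \
    trawlSetAt a ((l + i + 1 : ℕ) * δ))).toReal

variable {a : ℝ → ℝ}

lemma inter_diff_inter_box (A B C : Set (ℝ × ℝ)) (m : ℕ) :
    ((A ∩ box m) ∩ (B ∩ box m)) \ (C ∩ box m) = ((A ∩ B) \ C) ∩ box m := by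
  ext x; simp only [mem_inter_iff, Set.mem_sdiff]; tauto

lemma diff_inter_box (A B : Set (ℝ × ℝ)) (m : ℕ) :
    (A ∩ box m) \ (B ∩ box m) ⊆ A \ B := by
  intro x; simp only [mem_inter_iff, Set.mem_sdiff]; tauto

variable [IsProbabilityMeasure P] {τ : Triplet} {L : Set (ℝ × ℝ) → Ω → ℝ}

/-- Moment bound for the estimator built on the centred Lévy basis, restricted to a box. -/
lemma moment_aHat_box (hL : IsLevyBasis P τ L) {seed : Measure ℝ}
    (hseed : τ.IsSeedLaw seed) (hvar : Var[id; seed] = 1) {s : ℝ}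
    (hmom2 : Integrable (fun x : ℝ => |x| ^ (2 : ℝ)) seed)
    (hmom : Integrable (fun x : ℝ => |x| ^ s) seed)
    (hc : Continuous a) (ha : Antitone a) (h0 : ∀ u, 0 ≤ a u) (hi : IntegrableOn a (Ici 0))
    {K : ℝ} (hK : 0 ≤ K) (hKV : ∀ B, MeasurableSet B → Bornology.IsBounded B →
      (volume B).toReal ≤ (tailMass a 0).toReal →
      ∫ ω, |hL.centred B ω| ^ s ∂P ≤ K * (volume B).toReal)
    {r : ℝ} (hr : 2 ≤ r) (hrs : 2 * r ≤ s) {δ : ℝ} (hδ : 0 < δ) {n : ℕ} (hT : 1 ≤ n * δ)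
    {l : ℕ} (hl : l ≤ n) (m : ℕ) :
    ∫⁻ ω, ENNReal.ofReal (|aHat (fun t => hL.centred (trawlSetAt a t ∩ box m) ω) δ n (l * δ)
      - (1 / (n * δ)) * ∑ i ∈ Finset.range (n - l),
        (volume (((trawlSetAt a (i * δ) ∩ trawlSetAt a ((l + i : ℕ) * δ)) \
          trawlSetAt a ((l + i + 1 : ℕ) * δ)) ∩ box m)).toReal| ^ r) ∂P
      ≤ ENNReal.ofReal
        (estimatorConst K (tailMass a 0).toReal (a 0) r * (n * δ) ^ (-(r / 2))) := by
  set E : ℕ → Set (ℝ × ℝ) := fun k => trawlSetAt a (k * δ) ∩ box m with hEdef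
  have hE : ∀ k, MeasurableSet (E k) := fun k =>
    (measurableSet_trawlSetAt hc _).inter (measurableSet_box m)
  have hEb : ∀ k, Bornology.IsBounded (E k) := fun k => (isBounded_box m).subset inter_subset_right
  have hint : ∀ i k j, i ≤ k → k ≤ j → E i ∩ E j ⊆ E k := by
    rintro i k j hik hkj x ⟨h1, h2⟩
    have hik' : (i : ℝ) ≤ k := by exact_mod_cast hik
    have hkj' : (k : ℝ) ≤ j := by exact_mod_cast hkj
    exact ⟨trawlSetAt_interval ha (by gcongr) (by gcongr) ⟨h1.1, h2.1⟩, h1.2⟩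
  have hmod := cellModel_cellSet (n := n) hL hseed hvar (by linarith) hmom2 hmom hKV hE hEb
  have hfin : tailMass a 0 ≠ ⊤ := (tailMass_lt_top hi le_rfl).ne
  have hsucc : ∀ k : ℕ, ((k + 1 : ℕ) : ℝ) * δ = k * δ + δ := fun k => by push_cast; ring
  have key := hmod.moment_aHat (κ := a 0) (r := r) hK ENNReal.toReal_nonneg (h0 0) hδ hT hr hrs hl
    (fun t => hL.centred (trawlSetAt a t ∩ box m)) (fun k hk => ?_) (fun k hk => ?_)
    (fun k hk => ?_) (fun k hk => ?_)
  · have e : ∀ i ∈ Finset.range (n - l),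
        ∑ c ∈ cells n (aliveDies i (l + i)), (volume (cellSet n E c)).toReal
        = (volume (((trawlSetAt a (i * δ) ∩ trawlSetAt a ((l + i : ℕ) * δ)) \
          trawlSetAt a ((l + i + 1 : ℕ) * δ)) ∩ box m)).toReal := fun i hi => by
      have hi := Finset.mem_range.1 hi
      rw [sum_volume_cellSet hE hEb, biUnion_aliveDies hint (by omega) (by omega), hEdef]
      simp only [inter_diff_inter_box]
    rw [Finset.sum_congr rfl e] at key
    exact key
  · have h1 := sum_centred_cellSet (n := n) hL hE hEb (cells n (alive k))
    rw [biUnion_alive hint hk] at h1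
    exact h1.mono fun ω h => h.symm
  · rw [sum_volume_cellSet hE hEb, biUnion_alive hint hk]
    refine ENNReal.toReal_mono hfin ?_
    rw [← volume_trawlSetAt hc (k * δ)]
    exact measure_mono inter_subset_left
  · rw [sum_volume_cellSet hE hEb]
    refine ENNReal.toReal_le_of_le_ofReal (by have := h0 0; positivity) ?_
    refine (measure_mono ((biUnion_born_subset hk).trans (diff_inter_box _ _ m))).trans ?_
    rw [hsucc]
    exact volume_trawl_gain_le ha hδ.le
  · rw [sum_volume_cellSet hE hEb]
    refine ENNReal.toReal_le_of_le_ofReal (by have := h0 0; positivity) ?_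
    refine (measure_mono ((biUnion_dies_subset hk).trans (diff_inter_box _ _ m))).trans ?_
    rw [hsucc]
    have := volume_trawl_loss_le hc ha h0 hi (le_refl (k * δ)) hδ.le
    rwa [inter_self, sub_self] at this

/-- Moment bound for the estimator. -/
theorem moment_aHat_trawl (hL : IsLevyBasis P τ L) {seed : Measure ℝ}
    (hseed : τ.IsSeedLaw seed) (hvar : Var[id; seed] = 1) {s : ℝ}
    (hmom2 : Integrable (fun x : ℝ => |x| ^ (2 : ℝ)) seed)
    (hmom : Integrable (fun x : ℝ => |x| ^ s) seed)
    (hc : Continuous a) (ha : Antitone a) (h0 : ∀ u, 0 ≤ a u) (hi : IntegrableOn a (Ici 0))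
    {X : ℝ → Ω → ℝ} (hX : IsTrawlProcess P L a X) {r : ℝ} (hr : 2 ≤ r) (hrs : 2 * r ≤ s) :
    ∃ C : ℝ, ∀ (δ : ℝ) (n l : ℕ), 0 < δ → 1 ≤ n * δ → l ≤ n →
      ∫⁻ ω, ENNReal.ofReal (|aHat (fun t => X t ω) δ n (l * δ)
        - (1 / (n * δ)) * ∑ i ∈ Finset.range (n - l), lossVolume a δ l i| ^ r) ∂P
        ≤ ENNReal.ofReal (C * (n * δ) ^ (-(r / 2))) := by
  obtain ⟨K, hK, hKV⟩ := hL.exists_moment_le hseed (show 2 ≤ s by linarith) hmom2 hmom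
    (tailMass a 0).toReal
  refine ⟨estimatorConst K (tailMass a 0).toReal (a 0) r, fun δ n l hδ hT hl => ?_⟩
  have hnpos : 0 < n := by
    rcases Nat.eq_zero_or_pos n with h | h
    · subst h; simp at hT; linarith
    · exact h
  have hfin : ∀ t, volume (trawlSetAt a t) ≠ ⊤ := fun t => by
    rw [volume_trawlSetAt hc]; exact (tailMass_lt_top hi le_rfl).ne
  obtain ⟨ns, hns, hconv⟩ := exists_common_subseq
    (fun (k : ℕ) (m : ℕ) => L (trawlSetAt a (k * δ) ∩ box m)) (fun k => X (k * δ))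
    (Finset.range (n + 1)) (fun k => hX (k * δ))
  have hvolconv : ∀ B : Set (ℝ × ℝ), volume B ≠ ⊤ →
      Tendsto (fun j => (volume (B ∩ box (ns j))).toReal) atTop (𝓝 (volume B).toReal) :=
    fun B hB => ((ENNReal.tendsto_toReal hB).comp (tendsto_volume_inter_box B)).comp
      hns.tendsto_atTop
  refine lintegral_abs_rpow_le_of_tendsto (by linarith) (fun j => ?_) ?_
    (fun j => moment_aHat_box hL hseed hvar hmom2 hmom hc ha h0 hi hK hKV hr hrs hδ hT hl (ns j))
  · have hmeas : ∀ t, Measurable fun ω => hL.centred (trawlSetAt a t ∩ box (ns j)) ω := fun t =>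
      hL.measurable_centred ((measurableSet_trawlSetAt hc t).inter (measurableSet_box _))
        ((isBounded_box _).subset inter_subset_right)
    refine (Measurable.sub_const ?_ _).aemeasurable
    simp only [aHat_grid _ hδ, sampleMean]
    refine Measurable.const_mul (Finset.measurable_fun_sum _ fun i _ => ?_) _
    exact ((hmeas _).sub ((Finset.measurable_fun_sum _ fun k _ => hmeas _).div_const _)).mul
      ((hmeas _).sub (hmeas _))
  · have hall : ∀ᵐ ω ∂P, ∀ k ≤ n, Tendsto
        (fun j => L (trawlSetAt a (k * δ) ∩ box (ns j)) ω) atTop (𝓝 (X (k * δ) ω)) := by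
      refine ae_all_iff.2 fun k => ?_
      by_cases hk : k ≤ n
      · exact (hconv k (Finset.mem_range.2 (by omega))).mono fun ω h _ => h
      · exact ae_of_all _ fun ω h => absurd h hk
    filter_upwards [hall] with ω hω
    rw [← aHat_sub_const (fun t => X t ω) ((tailMass a 0).toReal * hL.meanRate) δ hnpos]
    refine Tendsto.sub (tendsto_aHat hδ l fun k hk => ?_)
      (Tendsto.const_mul _ (tendsto_finsetSum _ fun i _ => ?_))
    · refine (hω k hk).sub (Tendsto.mul_const _ ?_)
      rw [← volume_trawlSetAt hc (k * δ)]
      exact hvolconv _ (hfin _)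
    · exact hvolconv _ (ne_top_of_le_ne_top (hfin (i * δ))
        (measure_mono (sdiff_subset.trans inter_subset_left)))

lemma lossVolume_le (hc : Continuous a) (ha : Antitone a) (h0 : ∀ u, 0 ≤ a u)
    (hi : IntegrableOn a (Ici 0)) {δ : ℝ} (hδ : 0 < δ) (l i : ℕ) :
    lossVolume a δ l i ≤ a (l * δ) * δ := by
  refine ENNReal.toReal_le_of_le_ofReal (by have := h0 (l * δ); positivity) ?_
  have h1 : ((l + i + 1 : ℕ) : ℝ) * δ = (l + i : ℕ) * δ + δ := by push_cast; ring
  have h2 : ((l + i : ℕ) : ℝ) * δ - i * δ = l * δ := by push_cast; ring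
  have hle : (i : ℝ) * δ ≤ (l + i : ℕ) * δ := by
    have : 0 ≤ (l : ℝ) * δ := by positivity
    linarith
  have := volume_trawl_loss_le hc ha h0 hi hle hδ.le
  rwa [← h1, h2] at this

lemma le_lossVolume (hc : Continuous a) (ha : Antitone a) (h0 : ∀ u, 0 ≤ a u)
    (hi : IntegrableOn a (Ici 0)) {δ : ℝ} (hδ : 0 < δ) (l i : ℕ) :
    a ((l + 1 : ℕ) * δ) * δ ≤ lossVolume a δ l i := by
  have h1 : ((l + i + 1 : ℕ) : ℝ) * δ = (l + i : ℕ) * δ + δ := by push_cast; ring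
  have h2 : ((l + i : ℕ) : ℝ) * δ - i * δ = l * δ := by push_cast; ring
  have h3 : ((l + 1 : ℕ) : ℝ) * δ = l * δ + δ := by push_cast; ring
  have hle : (i : ℝ) * δ ≤ (l + i : ℕ) * δ := by
    have : 0 ≤ (l : ℝ) * δ := by positivity
    linarith
  have := le_volume_trawl_loss hc ha h0 hi hle hδ.le
  rw [← h1, h2, ← h3] at this
  refine (ENNReal.ofReal_le_iff_le_toReal ?_).1 this
  refine ne_top_of_le_ne_top ?_ (measure_mono (sdiff_subset.trans inter_subset_left))
  rw [volume_trawlSetAt hc]; exact (tailMass_lt_top hi le_rfl).ne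

end Limit

end Trawl

namespace Trawl

/-! ### Test functions -/

section TestFunctions

variable {p q : ℝ} {g : ℝ → ℝ}

lemma TestClass.apply_zero (hg : TestClass 1 p q g) : g 0 = 0 := by
  simpa using hg.zero 0 one_pos

lemma TestClass.differentiable (hg : TestClass 1 p q g) : Differentiable ℝ g :=
  hg.contDiff.differentiable (by simp)

lemma TestClass.continuous_deriv (hg : TestClass 1 p q g) : Continuous (deriv g) := by
  have h := hg.contDiff
  simp only [Nat.cast_one] at h
  exact (contDiff_one_iff_deriv.1 h).2

lemma TestClass.exists_deriv_bound (hp : 0 < p) (hg : TestClass 1 p q g) :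
    ∃ C : ℝ, 0 ≤ C ∧ ∀ x, |deriv g x| ≤ C * (|x| ^ p + |x| ^ q) := by
  have h1 := hg.near_zero
  have h2 := hg.near_infty
  rw [iteratedDeriv_one] at h1 h2
  obtain ⟨C1, hC1, h1⟩ := h1.exists_nonneg
  obtain ⟨C2, hC2, h2⟩ := h2.exists_nonneg
  obtain ⟨ε, hε, h1⟩ := Metric.eventually_nhds_iff.1 h1.bound
  have h2' := h2.bound
  rw [Filter.eventually_iff, mem_cocompact] at h2'
  obtain ⟨S, hS, hS2⟩ := h2'
  obtain ⟨M, hM⟩ := hS.isBounded.subset_closedBall 0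
  obtain ⟨C3, hC3⟩ := (isCompact_closedBall (0 : ℝ) M).exists_bound_of_continuousOn
    hg.continuous_deriv.continuousOn
  have hεp : 0 < ε ^ p := by positivity
  have hC30 : 0 ≤ |C3| / ε ^ p := by positivity
  refine ⟨C1 + C2 + |C3| / ε ^ p, by positivity, fun x => ?_⟩
  have hxp : 0 ≤ |x| ^ p := by positivity
  have hxq : 0 ≤ |x| ^ q := by positivity
  by_cases hx : |x| < ε
  · have := h1 (y := x) (by simpa [Real.dist_eq] using hx)
    rw [Real.norm_eq_abs, Real.norm_of_nonneg hxp] at this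
    nlinarith [mul_nonneg hC1 hxq, mul_nonneg hC2 hxp, mul_nonneg hC2 hxq,
      mul_nonneg hC30 hxp, mul_nonneg hC30 hxq]
  · push Not at hx
    by_cases hxS : x ∈ S
    · have h3 := hC3 x (hM hxS)
      rw [Real.norm_eq_abs] at h3
      have h4 : ε ^ p ≤ |x| ^ p := Real.rpow_le_rpow hε.le hx hp.le
      have h5 : |C3| ≤ |C3| / ε ^ p * |x| ^ p := by
        rw [div_mul_eq_mul_div, le_div_iff₀ hεp]; gcongr
      nlinarith [mul_nonneg hC1 hxq, mul_nonneg hC2 hxp, mul_nonneg hC2 hxq,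
        mul_nonneg hC1 hxp, mul_nonneg hC30 hxq, le_abs_self C3]
    · have := hS2 hxS
      simp only [mem_ofPred_eq] at this
      rw [Real.norm_eq_abs, Real.norm_of_nonneg hxq] at this
      nlinarith [mul_nonneg hC1 hxq, mul_nonneg hC2 hxp, mul_nonneg hC1 hxp,
        mul_nonneg hC30 hxp, mul_nonneg hC30 hxq]

lemma add_rpow_le_two {s : ℝ} (hs : 1 ≤ s) {x y : ℝ} (hx : 0 ≤ x) (hy : 0 ≤ y) :
    (x + y) ^ s ≤ 2 ^ (s - 1) * (x ^ s + y ^ s) := by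
  have := rpow_add_le_two s hs x y
  rwa [abs_of_nonneg hx, abs_of_nonneg hy, abs_of_nonneg (by positivity)] at this

lemma TestClass.exists_sub_bound (hp : 1 < p) (hq : 1 < q) (hg : TestClass 1 p q g) :
    ∃ C : ℝ, 0 ≤ C ∧ ∀ x y, |g x - g y| ≤
      C * |x - y| * (|y| ^ p + |y| ^ q + |x - y| ^ p + |x - y| ^ q) := by
  obtain ⟨C, hC, hb⟩ := hg.exists_deriv_bound (by linarith)
  set D := (2 : ℝ) ^ (p - 1) + 2 ^ (q - 1) with hD
  have hD1 : 0 < (2 : ℝ) ^ (p - 1) := by positivity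
  have hD2 : 0 < (2 : ℝ) ^ (q - 1) := by positivity
  refine ⟨C * D, by positivity, fun x y => ?_⟩
  set M := |y| + |x - y| with hM
  have hMp := add_rpow_le_two hp.le (abs_nonneg y) (abs_nonneg (x - y))
  have hMq := add_rpow_le_two hq.le (abs_nonneg y) (abs_nonneg (x - y))
  rw [← hM] at hMp hMq
  have hmv := (convex_closedBall (0 : ℝ) M).norm_image_sub_le_of_norm_deriv_le (f := g)
    (C := C * (M ^ p + M ^ q)) (fun z _ => hg.differentiable z) (fun z hz => by
      rw [mem_closedBall_zero_iff, Real.norm_eq_abs] at hz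
      refine (hb z).trans ?_
      gcongr) (x := y) (y := x)
    (by rw [mem_closedBall_zero_iff, Real.norm_eq_abs, hM]; linarith [abs_nonneg (x - y)])
    (by
      rw [mem_closedBall_zero_iff, Real.norm_eq_abs, hM]
      have := abs_add_le y (x - y)
      rwa [add_sub_cancel] at this)
  rw [Real.norm_eq_abs, Real.norm_eq_abs] at hmv
  refine hmv.trans ?_
  have e1 : 0 ≤ |y| ^ p := by positivity
  have e2 : 0 ≤ |y| ^ q := by positivity
  have e3 : 0 ≤ |x - y| ^ p := by positivity
  have e4 : 0 ≤ |x - y| ^ q := by positivity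
  have h5 : M ^ p + M ^ q ≤ D * (|y| ^ p + |y| ^ q + |x - y| ^ p + |x - y| ^ q) := by
    rw [hD]
    nlinarith [mul_nonneg hD1.le e2, mul_nonneg hD1.le e4, mul_nonneg hD2.le e1,
      mul_nonneg hD2.le e3]
  calc C * (M ^ p + M ^ q) * |x - y|
      ≤ C * (D * (|y| ^ p + |y| ^ q + |x - y| ^ p + |x - y| ^ q)) * |x - y| := by gcongr
    _ = _ := by ring

lemma TestClass.exists_linear_bound (hp : 1 < p) (hq : 1 < q) (hg : TestClass 1 p q g) (M : ℝ) :
    ∃ C : ℝ, 0 ≤ C ∧ ∀ x, 0 ≤ x → x ≤ M → |g x| ≤ C * x := by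
  obtain ⟨C, hC, hb⟩ := hg.exists_sub_bound hp hq
  refine ⟨C * (|M| ^ p + |M| ^ q), by positivity, fun x hx hxM => ?_⟩
  have h := hb x 0
  rw [hg.apply_zero, sub_zero, sub_zero, abs_zero, Real.zero_rpow (by linarith),
    Real.zero_rpow (by linarith), abs_of_nonneg hx] at h
  have h1 : x ≤ |M| := hxM.trans (le_abs_self M)
  refine h.trans ?_
  calc C * x * (0 + 0 + x ^ p + x ^ q) = C * (x ^ p + x ^ q) * x := by ring
    _ ≤ _ := by gcongr

end TestFunctions

/-! ### Riemann sums -/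

section Riemann

lemma floor_eq_of_mem {δ : ℝ} (hδ : 0 < δ) {l : ℕ} {s : ℝ}
    (hs : s ∈ Ico (l * δ) ((l + 1 : ℕ) * δ)) : ⌊s / δ⌋₊ = l := by
  have hs0 : 0 ≤ s := le_trans (by positivity) hs.1
  rw [Nat.floor_eq_iff (by positivity), le_div_iff₀ hδ, div_lt_iff₀ hδ]
  have := hs.2
  push_cast at this
  exact ⟨hs.1, this⟩

lemma floor_mul_le {δ : ℝ} (hδ : 0 < δ) {s : ℝ} (hs : 0 ≤ s) : ⌊s / δ⌋₊ * δ ≤ s := by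
  rw [← le_div_iff₀ hδ]; exact Nat.floor_le (by positivity)

lemma sub_lt_floor_mul {δ : ℝ} (hδ : 0 < δ) (s : ℝ) : s - δ < ⌊s / δ⌋₊ * δ := by
  have := Nat.lt_floor_add_one (s / δ)
  rw [div_lt_iff₀ hδ] at this
  linarith

lemma riemann_sum_eq_integral (φ : ℕ → ℝ) {δ : ℝ} (hδ : 0 < δ) {k n : ℕ} (hkn : k ≤ n) :
    IntegrableOn (fun s : ℝ => φ ⌊s / δ⌋₊) (Ico (k * δ) (n * δ)) ∧
    ∫ s in Ico (k * δ) (n * δ), φ ⌊s / δ⌋₊ = δ * ∑ l ∈ Finset.Ico k n, φ l := by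
  induction n, hkn using Nat.le_induction with
  | base => simp
  | succ n hkn ih =>
    obtain ⟨ih1, ih2⟩ := ih
    have hk : (k : ℝ) * δ ≤ n * δ := by gcongr
    have hn : (n : ℝ) * δ ≤ (n + 1 : ℕ) * δ := by gcongr; simp
    have heq : EqOn (fun s : ℝ => φ ⌊s / δ⌋₊) (fun _ => φ n)
        (Ico (n * δ) ((n + 1 : ℕ) * δ)) := fun s hs => by
      simp only [floor_eq_of_mem hδ hs]
    have hi : IntegrableOn (fun s : ℝ => φ ⌊s / δ⌋₊) (Ico (n * δ) ((n + 1 : ℕ) * δ)) :=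
      (integrableOn_const (by simp)).congr_fun heq.symm measurableSet_Ico
    have hdis : Disjoint (Ico (k * δ) (n * δ)) (Ico (n * δ) ((n + 1 : ℕ) * δ)) :=
      Set.disjoint_left.2 fun x h1 h2 => absurd h1.2 (not_lt.2 h2.1)
    rw [← Ico_union_Ico_eq_Ico hk hn]
    refine ⟨ih1.union hi, ?_⟩
    rw [setIntegral_union hdis measurableSet_Ico ih1 hi, ih2, setIntegral_congr_fun
      measurableSet_Ico heq, setIntegral_const, Finset.sum_Ico_succ_top hkn]
    have hvol : volume.real (Ico ((n : ℝ) * δ) ((n + 1 : ℕ) * δ)) = δ := by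
      rw [Real.volume_real_Ico_of_le hn]; push_cast; ring
    rw [hvol, smul_eq_mul]
    ring

variable {a : ℝ → ℝ}

lemma integrableOn_shift (hc : Continuous a) (hi : IntegrableOn a (Ici 0)) :
    IntegrableOn (fun s => a (s - 1)) (Ici 0) := by
  have h1 : IntegrableOn (fun s => a (s - 1)) (Ici 1) := by
    have h := (measurePreserving_sub_right volume (1 : ℝ)).integrableOn_comp_preimage
      (MeasurableEquiv.subRight (1 : ℝ)).measurableEmbedding (f := a) (s := Ici 0)
    have e : (fun x : ℝ => x - 1) ⁻¹' Ici 0 = Ici 1 := by ext x; simp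
    rw [e] at h
    exact h.2 hi
  rw [← Icc_union_Ici_eq_Ici (zero_le_one (α := ℝ))]
  exact (Continuous.continuousOn (by fun_prop)).integrableOn_Icc.union h1

/-- Dominated convergence for Riemann sums whose terms are bounded by `a`. -/
lemma tendsto_riemann_sum (hc : Continuous a) (ha : Antitone a) (h0 : ∀ u, 0 ≤ a u)
    (hi : IntegrableOn a (Ici 0)) {Δ : ℕ → ℝ} (hΔpos : ∀ n, 0 < Δ n)
    (hΔ : Tendsto Δ atTop (𝓝 0)) (φ : ℕ → ℕ → ℝ) {D : ℝ} (hD : 0 ≤ D)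
    (hφ : ∀ n l, l < n → |φ n l| ≤ D * a (l * Δ n)) (F : ℝ → ℝ) (hFm : Measurable F)
    (hF : ∀ s, 0 ≤ s → |F s| ≤ D * a s)
    (hlim : ∀ s, 0 ≤ s → Tendsto
      (fun n : ℕ => (Iio ((n : ℝ) * Δ n)).indicator (fun s => φ n ⌊s / Δ n⌋₊) s) atTop (𝓝 (F s))) :
    Tendsto (fun n : ℕ => ∫ s in Ici 0,
      |(Iio ((n : ℝ) * Δ n)).indicator (fun s => φ n ⌊s / Δ n⌋₊) s - F s|) atTop (𝓝 0) := by
  have key := tendsto_integral_filter_of_dominated_convergence (μ := volume.restrict (Ici 0))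
    (l := atTop)
    (F := fun (n : ℕ) s => |(Iio ((n : ℝ) * Δ n)).indicator (fun s => φ n ⌊s / Δ n⌋₊) s - F s|)
    (f := fun _ => 0) (fun s => 2 * D * a (s - 1)) (Eventually.of_forall fun n => ?_) ?_
    ((integrableOn_shift hc hi).const_mul (2 * D)) ?_
  · simpa using key
  · have hm : Measurable fun s : ℝ => φ n ⌊s / Δ n⌋₊ :=
      (measurable_of_countable (φ n)).comp
        (Nat.measurable_floor.comp (measurable_id.div_const _))
    exact ((hm.indicator measurableSet_Iio).sub hFm).abs.aestronglyMeasurable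
  · filter_upwards [hΔ.eventually (eventually_lt_nhds one_pos)] with n hn
    refine (ae_restrict_iff' measurableSet_Ici).2 (ae_of_all _ fun s hs => ?_)
    have hs0 : 0 ≤ s := hs
    have h1 : |(Iio ((n : ℝ) * Δ n)).indicator (fun s => φ n ⌊s / Δ n⌋₊) s| ≤ D * a (s - 1) := by
      by_cases hsn : s ∈ Iio ((n : ℝ) * Δ n)
      · rw [indicator_of_mem hsn]
        have hlt : ⌊s / Δ n⌋₊ < n := by
          rw [Nat.floor_lt (div_nonneg hs0 (hΔpos n).le), div_lt_iff₀ (hΔpos n)]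
          exact hsn
        refine (hφ n _ hlt).trans ?_
        gcongr
        exact ha (by linarith [sub_lt_floor_mul (hΔpos n) s])
      · rw [indicator_of_notMem hsn, abs_zero]
        have := h0 (s - 1)
        positivity
    have h2 : |F s| ≤ D * a (s - 1) := (hF s hs0).trans (by gcongr; exact ha (by linarith))
    rw [Real.norm_eq_abs, abs_abs]
    refine (abs_sub _ _).trans ?_
    linarith
  · refine (ae_restrict_iff' measurableSet_Ici).2 (ae_of_all _ fun s hs => ?_)
    have := ((hlim s hs).sub_const (F s)).abs
    simpa using this

lemma indicator_riemann_integrableOn (φ : ℕ → ℝ) {δ : ℝ} (hδ : 0 < δ) (n : ℕ) :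
    IntegrableOn ((Iio ((n : ℝ) * δ)).indicator (fun s => φ ⌊s / δ⌋₊)) (Ici 0) := by
  have h := (riemann_sum_eq_integral φ hδ (Nat.zero_le n)).1
  rw [integrableOn_indicator_iff measurableSet_Iio]
  have e : Iio ((n : ℝ) * δ) ∩ Ici 0 = Ico ((0 : ℕ) * δ) (n * δ) := by
    ext x; simp [and_comm]
  rwa [e]

lemma indicator_riemann_integral (φ : ℕ → ℝ) {δ : ℝ} (hδ : 0 < δ) (n : ℕ) :
    ∫ s in Ici 0, (Iio ((n : ℝ) * δ)).indicator (fun s => φ ⌊s / δ⌋₊) s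
      = δ * ∑ l ∈ Finset.range n, φ l := by
  have h := (riemann_sum_eq_integral φ hδ (Nat.zero_le n)).2
  rw [setIntegral_indicator measurableSet_Iio]
  have e : Ici 0 ∩ Iio ((n : ℝ) * δ) = Ico ((0 : ℕ) * δ) (n * δ) := by
    ext x; simp
  rw [e, h, Finset.range_eq_Ico]

/-- A Riemann sum with pointwise vanishing terms, dominated by `a`, tends to zero. -/
lemma tendsto_riemann_sum_zero (hc : Continuous a) (ha : Antitone a) (h0 : ∀ u, 0 ≤ a u)
    (hi : IntegrableOn a (Ici 0)) {Δ : ℕ → ℝ} (hΔpos : ∀ n, 0 < Δ n)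
    (hΔ : Tendsto Δ atTop (𝓝 0)) (φ : ℕ → ℕ → ℝ) {D : ℝ} (hD : 0 ≤ D)
    (hφ0 : ∀ n l, 0 ≤ φ n l) (hφ : ∀ n l, l < n → φ n l ≤ D * a (l * Δ n))
    (hlim : ∀ s, 0 ≤ s → Tendsto (fun n => φ n ⌊s / Δ n⌋₊) atTop (𝓝 0)) :
    Tendsto (fun n => Δ n * ∑ l ∈ Finset.range n, φ n l) atTop (𝓝 0) := by
  have h := tendsto_riemann_sum hc ha h0 hi hΔpos hΔ φ hD
    (fun n l hl => by rw [abs_of_nonneg (hφ0 n l)]; exact hφ n l hl) (fun _ => 0)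
    measurable_const (fun s _ => by rw [abs_zero]; have := h0 s; positivity) (fun s hs => ?_)
  · refine h.congr fun n => ?_
    rw [← indicator_riemann_integral (φ n) (hΔpos n) n]
    refine integral_congr_ae (ae_of_all _ fun s => ?_)
    simp only [sub_zero]
    rw [abs_of_nonneg]
    exact indicator_nonneg (fun _ _ => hφ0 n _) s
  · refine squeeze_zero (fun n => indicator_nonneg (fun _ _ => hφ0 n _) s) (fun n => ?_)
      (hlim s hs)
    exact indicator_le_self' (fun _ _ => hφ0 n _) s

lemma floor_mul_tendsto {Δ : ℕ → ℝ} (hΔpos : ∀ n, 0 < Δ n) (hΔ : Tendsto Δ atTop (𝓝 0))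
    {s : ℝ} (hs : 0 ≤ s) : Tendsto (fun n => (⌊s / Δ n⌋₊ : ℝ) * Δ n) atTop (𝓝 s) := by
  refine tendsto_of_tendsto_of_tendsto_of_le_of_le (g := fun n => s - Δ n) (h := fun _ => s)
    ?_ tendsto_const_nhds (fun n => (sub_lt_floor_mul (hΔpos n) s).le)
    (fun n => floor_mul_le (hΔpos n) hs)
  simpa using hΔ.const_sub s

lemma riemann_sum_le (hc : Continuous a) (ha : Antitone a) (h0 : ∀ u, 0 ≤ a u)
    (hi : IntegrableOn a (Ici 0)) {δ : ℝ} (hδ : 0 < δ) (hδ1 : δ ≤ 1) (n : ℕ) :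
    δ * ∑ l ∈ Finset.range n, a (l * δ) ≤ ∫ s in Ici 0, a (s - 1) := by
  rw [← indicator_riemann_integral (fun l => a (l * δ)) hδ n]
  refine setIntegral_mono_on (indicator_riemann_integrableOn (fun l => a (l * δ)) hδ n) (integrableOn_shift hc hi)
    measurableSet_Ici fun s _ => ?_
  refine (indicator_le_self' (fun _ _ => h0 _) s).trans (ha ?_)
  linarith [sub_lt_floor_mul hδ s]

variable {p q : ℝ} {g : ℝ → ℝ}

lemma integrableOn_comp_trawl (hp : 1 < p) (hq : 1 < q) (hg : TestClass 1 p q g)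
    (hc : Continuous a) (ha : Antitone a) (h0 : ∀ u, 0 ≤ a u) (hi : IntegrableOn a (Ici 0)) :
    IntegrableOn (fun s => g (a s)) (Ici 0) := by
  obtain ⟨D, hD, hb⟩ := hg.exists_linear_bound hp hq (a 0)
  refine (hi.const_mul D).mono' ?_ ?_
  · exact (hg.differentiable.continuous.comp hc).aestronglyMeasurable
  · refine (ae_restrict_iff' measurableSet_Ici).2 (ae_of_all _ fun s hs => ?_)
    exact hb _ (h0 s) (ha hs)

/-- Uniform convergence of the Riemann sums of `g ∘ a` to its integral. -/
lemma eventually_riemann_close (hp : 1 < p) (hq : 1 < q) (hg : TestClass 1 p q g)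
    (hc : Continuous a) (ha : Antitone a) (h0 : ∀ u, 0 ≤ a u) (hi : IntegrableOn a (Ici 0))
    {Δ : ℕ → ℝ} (hΔpos : ∀ n, 0 < Δ n) (hΔ : Tendsto Δ atTop (𝓝 0))
    (hnΔ : Tendsto (fun n : ℕ => (n : ℝ) * Δ n) atTop atTop) (T : ℝ) {ε : ℝ} (hε : 0 < ε) :
    ∀ᶠ n in atTop, ∀ t ∈ Icc 0 T,
      |Δ n * ∑ l ∈ Finset.Ico ⌊t / Δ n⌋₊ n, g (a (l * Δ n)) - lambda g a t| < ε := by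
  obtain ⟨D, hD, hb⟩ := hg.exists_linear_bound hp hq (a 0)
  have hgc : Continuous fun s => g (a s) := hg.differentiable.continuous.comp hc
  have hga : ∀ s, 0 ≤ s → |g (a s)| ≤ D * a s := fun s hs => hb _ (h0 s) (ha hs)
  have hgi := integrableOn_comp_trawl hp hq hg hc ha h0 hi
  have hconv := tendsto_riemann_sum hc ha h0 hi hΔpos hΔ (fun n l => g (a (l * Δ n))) hD
    (fun n l _ => hga _ (mul_nonneg (Nat.cast_nonneg _) (hΔpos n).le)) (fun s => g (a s))
    hgc.measurable hga (fun s hs => by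
      have h1 := (hgc.tendsto s).comp (floor_mul_tendsto hΔpos hΔ hs)
      refine h1.congr' ?_
      filter_upwards [hnΔ.eventually_gt_atTop s] with n hn
      rw [indicator_of_mem (mem_Iio.2 hn)]
      rfl)
  have hbd : Tendsto (fun n => D * a 0 * Δ n) atTop (𝓝 0) := by simpa using hΔ.const_mul (D * a 0)
  filter_upwards [hnΔ.eventually_gt_atTop T, hconv.eventually (eventually_lt_nhds (half_pos hε)),
    hbd.eventually (eventually_lt_nhds (half_pos hε))] with n hnT hn1 hn2 t ht
  have hδ := hΔpos n
  set δ := Δ n with hδdef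
  set k := ⌊t / δ⌋₊ with hk
  have hkt : k * δ ≤ t := floor_mul_le hδ ht.1
  have htk : t - δ < k * δ := sub_lt_floor_mul hδ t
  have htn : t < n * δ := ht.2.trans_lt hnT
  have hkn : k ≤ n := by
    have h1 : (k : ℝ) * δ < n * δ := hkt.trans_lt htn
    exact_mod_cast (lt_of_mul_lt_mul_right h1 hδ.le).le
  set φ : ℕ → ℝ := fun l => g (a (l * δ)) with hφ
  obtain ⟨hI, hS⟩ := riemann_sum_eq_integral φ hδ hkn
  have hk0 : 0 ≤ (k : ℝ) * δ := by positivity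
  have hI1 : IntegrableOn (fun s : ℝ => φ ⌊s / δ⌋₊) (Ico (k * δ) t) :=
    hI.mono_set (Ico_subset_Ico_right htn.le)
  have hI2 : IntegrableOn (fun s : ℝ => φ ⌊s / δ⌋₊) (Ico t (n * δ)) :=
    hI.mono_set (Ico_subset_Ico_left hkt)
  have hsplit : ∫ s in Ico (k * δ) (n * δ), φ ⌊s / δ⌋₊
      = (∫ s in Ico (k * δ) t, φ ⌊s / δ⌋₊) + ∫ s in Ico t (n * δ), φ ⌊s / δ⌋₊ := by
    rw [← Ico_union_Ico_eq_Ico hkt htn.le, setIntegral_union (Set.disjoint_left.2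
      fun x h1 h2 => absurd h1.2 (not_lt.2 h2.1)) measurableSet_Ico hI1 hI2]
  have hfirst : |∫ s in Ico (k * δ) t, φ ⌊s / δ⌋₊| ≤ D * a 0 * δ := by
    have h1 := norm_setIntegral_le_of_norm_le_const (μ := volume) (s := Ico (k * δ) t)
      (f := fun s : ℝ => φ ⌊s / δ⌋₊) (C := D * a 0) (by simp) (fun s hs => by
        refine (hga _ (by positivity)).trans ?_
        gcongr
        exact ha (by positivity))
    rw [Real.volume_real_Ico_of_le hkt] at h1
    refine h1.trans ?_
    have : 0 ≤ D * a 0 := mul_nonneg hD (h0 0)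
    gcongr
    linarith
  have hind : ∫ s in Ico t (n * δ), φ ⌊s / δ⌋₊
      = ∫ s in Ici t, (Iio ((n : ℝ) * δ)).indicator (fun s => φ ⌊s / δ⌋₊) s := by
    rw [setIntegral_indicator measurableSet_Iio, Ici_inter_Iio]
  have hindI := indicator_riemann_integrableOn φ hδ n
  have hsub : Ici t ⊆ Ici 0 := Ici_subset_Ici.2 ht.1
  have hlam : lambda g a t = ∫ s in Ici t, g (a s) := by
    rw [lambda, integral_Ici_eq_integral_Ioi]
  have hsecond : |(∫ s in Ico t (n * δ), φ ⌊s / δ⌋₊) - lambda g a t| < ε / 2 := by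
    rw [hind, hlam, ← integral_sub (hindI.mono_set hsub) (hgi.mono_set hsub)]
    refine (abs_integral_le_integral_abs).trans_lt (lt_of_le_of_lt ?_ hn1)
    exact setIntegral_mono_set ((hindI.sub hgi).abs) (ae_of_all _ fun s => abs_nonneg _)
      hsub.eventuallyLE
  rw [← hS, hsplit, add_sub_assoc]
  refine (abs_add_le _ _).trans_lt ?_
  linarith

end Riemann

end Trawl

namespace Trawl

/-! ### Consistency of the functional estimator -/

section Consistency

lemma rpow_le_rpow_sub_one_mul {y M s : ℝ} (hy : 0 ≤ y) (hyM : y ≤ M) (hs : 1 ≤ s) :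
    y ^ s ≤ M ^ (s - 1) * y := by
  rcases hy.eq_or_lt with rfl | hy'
  · rw [Real.zero_rpow (by linarith), mul_zero]
  · have h : y ^ s = y ^ (s - 1) * y := by
      rw [← Real.rpow_add_one hy'.ne', sub_add_cancel]
    rw [h]
    gcongr

lemma le_add_inv_mul_sq {w η : ℝ} (hw : 0 < w) : η ≤ w + w⁻¹ * η ^ (2 : ℝ) := by
  rw [Real.rpow_two, inv_mul_eq_div]
  have h : η * w ≤ w * w + η ^ 2 := by nlinarith [sq_nonneg (η - w), sq_nonneg η, sq_nonneg w]
  have h2 : w + η ^ 2 / w = (w * w + η ^ 2) / w := by field_simp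
  rw [h2, le_div_iff₀ hw]
  exact h

lemma TestClass.exists_error_bound {p q : ℝ} {g : ℝ → ℝ} (hp : 1 < p) (hq : 1 < q)
    (hg : TestClass 1 p q g) {M : ℝ} (hM : 0 ≤ M) :
    ∃ K : ℝ, 0 ≤ K ∧ ∀ x b y w, 0 ≤ y → y ≤ M → |b - y| ≤ M → 0 < w →
      |g x - g y| ≤ K * (y * (w + w⁻¹ * |x - b| ^ (2 : ℝ)) + |b - y|
        + |x - b| ^ (p + 1) + |x - b| ^ (q + 1)) := by
  obtain ⟨C, hC, hb⟩ := hg.exists_sub_bound hp hq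
  set A := M ^ (p - 1) + M ^ (q - 1) with hA
  have hA0 : 0 ≤ A := by positivity
  refine ⟨C * (A + A * M + 2 ^ p * (1 + M ^ p) + 2 ^ q * (1 + M ^ q)), by positivity,
    fun x b y w hy hyM hβM hw => ?_⟩
  set η := |x - b| with hη
  set β := |b - y| with hβ
  have hη0 : 0 ≤ η := abs_nonneg _
  have hβ0 : 0 ≤ β := abs_nonneg _
  have he : |x - y| ≤ η + β := abs_sub_le x b y
  have he0 : 0 ≤ |x - y| := abs_nonneg _
  have hpow : ∀ s : ℝ, 1 < s →
      |x - y| * |x - y| ^ s ≤ 2 ^ s * (1 + M ^ s) * (η ^ (s + 1) + β) := fun s hs => by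
    calc |x - y| * |x - y| ^ s = |x - y| ^ (s + 1) := by
          rw [Real.rpow_add_one' he0 (by linarith), mul_comm]
      _ ≤ (η + β) ^ (s + 1) := by gcongr
      _ ≤ 2 ^ (s + 1 - 1) * (η ^ (s + 1) + β ^ (s + 1)) :=
          add_rpow_le_two (by linarith) hη0 hβ0
      _ ≤ 2 ^ (s + 1 - 1) * (η ^ (s + 1) + M ^ (s + 1 - 1) * β) := by
          gcongr
          exact rpow_le_rpow_sub_one_mul hβ0 hβM (by linarith)
      _ ≤ 2 ^ s * (1 + M ^ s) * (η ^ (s + 1) + β) := by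
          rw [add_sub_cancel_right, mul_assoc]
          have h1 : 0 ≤ M ^ s * η ^ (s + 1) := by positivity
          gcongr
          nlinarith
  set u := y * (w + w⁻¹ * η ^ (2 : ℝ)) with hu
  have hu0 : 0 ≤ u := by positivity
  have hlin : |x - y| * (|y| ^ p + |y| ^ q) ≤ A * (u + M * β) := by
    rw [abs_of_nonneg hy]
    have h1 : y ^ p + y ^ q ≤ A * y := by
      rw [hA, add_mul]
      exact add_le_add (rpow_le_rpow_sub_one_mul hy hyM hp.le)
        (rpow_le_rpow_sub_one_mul hy hyM hq.le)
    have h2 : η ≤ w + w⁻¹ * η ^ (2 : ℝ) := le_add_inv_mul_sq hw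
    calc |x - y| * (y ^ p + y ^ q) ≤ (η + β) * (A * y) := by gcongr
      _ = A * (y * η + y * β) := by ring
      _ ≤ A * (u + M * β) := by rw [hu]; gcongr
  have hP := hpow p hp
  have hQ := hpow q hq
  have hP0 : 0 ≤ η ^ (p + 1) := by positivity
  have hQ0 : 0 ≤ η ^ (q + 1) := by positivity
  set S := u + β + η ^ (p + 1) + η ^ (q + 1) with hS
  calc |g x - g y|
      ≤ C * (|x - y| * (|y| ^ p + |y| ^ q) + |x - y| * |x - y| ^ p + |x - y| * |x - y| ^ q) :=
        (hb x y).trans_eq (by ring)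
    _ ≤ C * (A * (u + M * β) + 2 ^ p * (1 + M ^ p) * (η ^ (p + 1) + β)
          + 2 ^ q * (1 + M ^ q) * (η ^ (q + 1) + β)) := by gcongr
    _ ≤ C * (A * (S + M * S) + 2 ^ p * (1 + M ^ p) * S + 2 ^ q * (1 + M ^ q) * S) := by
        gcongr <;> linarith
    _ = _ := by ring

variable {a : ℝ → ℝ}

/-- The centring of `â(lδ)`. -/
noncomputable def aHatCentre (a : ℝ → ℝ) (δ : ℝ) (n l : ℕ) : ℝ :=
  (1 / (n * δ)) * ∑ i ∈ Finset.range (n - l), lossVolume a δ l i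

lemma aHatCentre_nonneg {δ : ℝ} (hδ : 0 < δ) (n l : ℕ) : 0 ≤ aHatCentre a δ n l :=
  mul_nonneg (by positivity) (Finset.sum_nonneg fun _ _ => ENNReal.toReal_nonneg)

lemma aHatCentre_le (hc : Continuous a) (ha : Antitone a) (h0 : ∀ u, 0 ≤ a u)
    (hi : IntegrableOn a (Ici 0)) {δ : ℝ} (hδ : 0 < δ) {n l : ℕ} (hl : l < n) :
    aHatCentre a δ n l ≤ a (l * δ) := by
  have hn : (0 : ℝ) < n := by exact_mod_cast (Nat.zero_le l).trans_lt hl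
  have hsum : ∑ i ∈ Finset.range (n - l), lossVolume a δ l i ≤ (n - l : ℕ) * (a (l * δ) * δ) := by
    refine (Finset.sum_le_card_nsmul _ _ _ fun i _ => lossVolume_le hc ha h0 hi hδ l i).trans_eq ?_
    rw [Finset.card_range, nsmul_eq_mul]
  have hnl : ((n - l : ℕ) : ℝ) ≤ n := by exact_mod_cast Nat.sub_le n l
  rw [aHatCentre, one_div, inv_mul_le_iff₀ (by positivity)]
  have := h0 (l * δ)
  calc _ ≤ _ := hsum
    _ ≤ n * (a (l * δ) * δ) := by gcongr
    _ = _ := by ring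

lemma le_aHatCentre (hc : Continuous a) (ha : Antitone a) (h0 : ∀ u, 0 ≤ a u)
    (hi : IntegrableOn a (Ici 0)) {δ : ℝ} (hδ : 0 < δ) {n l : ℕ} (hl : l < n) :
    (1 - l / n) * a ((l + 1 : ℕ) * δ) ≤ aHatCentre a δ n l := by
  have hn : (0 : ℝ) < n := by exact_mod_cast (Nat.zero_le l).trans_lt hl
  have hsum : (n - l : ℕ) * (a ((l + 1 : ℕ) * δ) * δ)
      ≤ ∑ i ∈ Finset.range (n - l), lossVolume a δ l i := by
    refine le_trans ?_
      (Finset.card_nsmul_le_sum _ _ _ fun i _ => le_lossVolume hc ha h0 hi hδ l i)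
    rw [Finset.card_range, nsmul_eq_mul]
  rw [aHatCentre, one_div, le_inv_mul_iff₀ (by positivity)]
  refine le_trans (le_of_eq ?_) hsum
  rw [Nat.cast_sub hl.le]
  field_simp

lemma abs_aHatCentre_sub_le (hc : Continuous a) (ha : Antitone a) (h0 : ∀ u, 0 ≤ a u)
    (hi : IntegrableOn a (Ici 0)) {δ : ℝ} (hδ : 0 < δ) {n l : ℕ} (hl : l < n) :
    |aHatCentre a δ n l - a (l * δ)| ≤ a (l * δ) := by
  rw [abs_sub_comm, abs_of_nonneg (sub_nonneg.2 (aHatCentre_le hc ha h0 hi hδ hl))]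
  linarith [aHatCentre_nonneg (a := a) hδ n l]

lemma tendsto_bias (hc : Continuous a) (ha : Antitone a) (h0 : ∀ u, 0 ≤ a u)
    (hi : IntegrableOn a (Ici 0)) {Δ : ℕ → ℝ} (hΔpos : ∀ n, 0 < Δ n)
    (hΔ : Tendsto Δ atTop (𝓝 0)) (hnΔ : Tendsto (fun n : ℕ => (n : ℝ) * Δ n) atTop atTop) :
    Tendsto (fun n => Δ n * ∑ l ∈ Finset.range n, |aHatCentre a (Δ n) n l - a (l * Δ n)|)
      atTop (𝓝 0) := by
  refine tendsto_riemann_sum_zero hc ha h0 hi hΔpos hΔ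
    (fun n l => |aHatCentre a (Δ n) n l - a (l * Δ n)|) zero_le_one (fun n l => abs_nonneg _)
    (fun n l hl => by
      rw [one_mul]; exact abs_aHatCentre_sub_le hc ha h0 hi (hΔpos n) hl) fun s hs => ?_
  have hfl := floor_mul_tendsto hΔpos hΔ hs
  have h1 : Tendsto (fun n => a (⌊s / Δ n⌋₊ * Δ n)) atTop (𝓝 (a s)) := (hc.tendsto s).comp hfl
  have h2 : Tendsto (fun n => a ((⌊s / Δ n⌋₊ + 1 : ℕ) * Δ n)) atTop (𝓝 (a s)) := by
    refine (hc.tendsto s).comp ?_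
    have := hfl.add hΔ
    rw [add_zero] at this
    refine this.congr fun n => ?_
    push_cast; ring
  have h3 : Tendsto (fun n : ℕ => (⌊s / Δ n⌋₊ : ℝ) / n) atTop (𝓝 0) := by
    refine (hfl.div_atTop hnΔ).congr fun n => ?_
    rw [mul_div_mul_right _ _ (hΔpos n).ne']
  have h4 := h1.sub ((h3.const_sub 1).mul h2)
  rw [sub_zero, one_mul, sub_self] at h4
  refine squeeze_zero' (Eventually.of_forall fun n => abs_nonneg _) ?_ h4
  filter_upwards [hnΔ.eventually_gt_atTop s] with n hn
  have hlt : ⌊s / Δ n⌋₊ < n := by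
    rw [Nat.floor_lt (div_nonneg hs (hΔpos n).le), div_lt_iff₀ (hΔpos n)]
    exact hn
  rw [abs_sub_comm, abs_of_nonneg (sub_nonneg.2 (aHatCentre_le hc ha h0 hi (hΔpos n) hlt))]
  linarith [le_aHatCentre hc ha h0 hi (hΔpos n) hlt]

variable {Ω : Type*} [MeasurableSpace Ω] {P : Measure Ω}

lemma integrable_and_integral_le_of_lintegral_le {f : Ω → ℝ} (hf : AEMeasurable f P)
    (hf0 : ∀ ω, 0 ≤ f ω) {c : ℝ} (hc : 0 ≤ c)
    (h : ∫⁻ ω, ENNReal.ofReal (f ω) ∂P ≤ ENNReal.ofReal c) :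
    Integrable f P ∧ ∫ ω, f ω ∂P ≤ c := by
  constructor
  · refine ⟨hf.aestronglyMeasurable, ?_⟩
    rw [hasFiniteIntegral_iff_ofReal (ae_of_all _ hf0)]
    exact h.trans_lt ENNReal.ofReal_lt_top
  · rw [integral_eq_lintegral_of_nonneg_ae (ae_of_all _ hf0) hf.aestronglyMeasurable]
    exact ENNReal.toReal_le_of_le_ofReal hc h

variable {τ : Triplet} {L : Set (ℝ × ℝ) → Ω → ℝ} {X : ℝ → Ω → ℝ}

lemma IsTrawlProcess.aemeasurable (hL : IsLevyBasis P τ L) (hc : Continuous a)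
    (hX : IsTrawlProcess P L a X) (t : ℝ) : AEMeasurable (X t) P :=
  TendstoInMeasure.aemeasurable (fun m => (hL.measurable _
    ((measurableSet_trawlSetAt hc t).inter (measurableSet_box m))
    ((isBounded_box m).subset inter_subset_right)).aemeasurable) (hX t)

lemma aemeasurable_aHat (hX : ∀ t, AEMeasurable (X t) P) (δ : ℝ) (n : ℕ) (t : ℝ) :
    AEMeasurable (fun ω => aHat (fun s => X s ω) δ n t) P := by
  simp only [aHat, sampleMean]
  refine AEMeasurable.const_mul (Finset.aemeasurable_fun_sum _ fun i _ => ?_) _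
  exact ((hX _).sub ((Finset.aemeasurable_fun_sum _ fun k _ => hX _).div_const _)).mul
    ((hX _).sub (hX _))

end Consistency

end Trawl

namespace Trawl

section Main

variable {a : ℝ → ℝ} {Ω : Type*} [MeasurableSpace Ω] {P : Measure Ω} [IsProbabilityMeasure P]
  {τ : Triplet} {L : Set (ℝ × ℝ) → Ω → ℝ} {X : ℝ → Ω → ℝ}

lemma integral_aHat_sub_centre_le (hL : IsLevyBasis P τ L) {seed : Measure ℝ}
    (hseed : τ.IsSeedLaw seed) (hvar : Var[id; seed] = 1) {s : ℝ}
    (hmom2 : Integrable (fun x : ℝ => |x| ^ (2 : ℝ)) seed)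
    (hmom : Integrable (fun x : ℝ => |x| ^ s) seed)
    (hc : Continuous a) (ha : Antitone a) (h0 : ∀ u, 0 ≤ a u) (hi : IntegrableOn a (Ici 0))
    (hX : IsTrawlProcess P L a X) {r : ℝ} (hr : 2 ≤ r) (hrs : 2 * r ≤ s) :
    ∃ C : ℝ, ∀ (δ : ℝ) (n l : ℕ), 0 < δ → 1 ≤ n * δ → l ≤ n →
      Integrable (fun ω => |aHat (fun t => X t ω) δ n (l * δ) - aHatCentre a δ n l| ^ r) P ∧
      ∫ ω, |aHat (fun t => X t ω) δ n (l * δ) - aHatCentre a δ n l| ^ r ∂P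
        ≤ C * (n * δ) ^ (-(r / 2)) := by
  obtain ⟨C, hC⟩ := moment_aHat_trawl hL hseed hvar hmom2 hmom hc ha h0 hi hX hr hrs
  refine ⟨max C 0, fun δ n l hδ hT hl => ?_⟩
  have hT0 : 0 ≤ (n * δ : ℝ) := by positivity
  refine integrable_and_integral_le_of_lintegral_le ?_ (fun ω => by positivity) (by positivity)
    ((hC δ n l hδ hT hl).trans (ENNReal.ofReal_le_ofReal (by gcongr; exact le_max_left _ _)))
  have hm : Measurable (fun x : ℝ => |x| ^ r) := by fun_prop
  exact hm.comp_aemeasurable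
    ((aemeasurable_aHat (fun t => hX.aemeasurable hL hc t) δ n _).sub_const _)

lemma tendsto_rpow_of_neg {T : ℕ → ℝ} (hT : Tendsto T atTop atTop) {e : ℝ} (he : e < 0) :
    Tendsto (fun n => T n ^ e) atTop (𝓝 0) := by
  have := (tendsto_rpow_neg_atTop (y := -e) (by linarith)).comp hT
  simpa [Function.comp_def] using this

/-- The Riemann sum of the errors is bounded by a random variable whose mean tends to zero. -/
lemma exists_error_dominator (hL : IsLevyBasis P τ L) {seed : Measure ℝ}
    (hseed : τ.IsSeedLaw seed) (hvar : Var[id; seed] = 1)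
    (hc : Continuous a) (ha : Antitone a) (h0 : ∀ u, 0 ≤ a u) (hi : IntegrableOn a (Ici 0))
    (hX : IsTrawlProcess P L a X) {Δ : ℕ → ℝ} (hΔpos : ∀ n, 0 < Δ n)
    (hΔ : Tendsto Δ atTop (𝓝 0)) (hnΔ : Tendsto (fun n : ℕ => (n : ℝ) * Δ n) atTop atTop)
    {p q : ℝ} (hp : 1 < p) (hq : 1 < q)
    (hmoment : Integrable (fun x : ℝ => |x| ^ (2 * (max q p + 1))) seed)
    {g : ℝ → ℝ} (hg : TestClass 1 p q g) :
    ∃ (G : ℕ → Ω → ℝ) (c : ℕ → ℝ), Tendsto c atTop (𝓝 0) ∧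
      (∀ n, 0 < n → ∀ ω, Δ n * ∑ l ∈ Finset.range n,
        |g (aHat (fun t => X t ω) (Δ n) n (l * Δ n)) - g (a (l * Δ n))| ≤ G n ω) ∧
      ∀ᶠ n in atTop, Integrable (G n) P ∧ ∫ ω, G n ω ∂P ≤ c n := by
  have := hseed.1
  have hqm := le_max_left q p
  have hpm := le_max_right q p
  have hmom2 : Integrable (fun x : ℝ => |x| ^ (2 : ℝ)) seed := by
    have hm : Measurable (fun x : ℝ => |x| ^ (2 : ℝ)) := by fun_prop
    refine ((integrable_const (1 : ℝ)).add hmoment).mono' hm.aestronglyMeasurable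
      (ae_of_all _ fun x => ?_)
    rw [Real.norm_of_nonneg (by positivity), Pi.add_apply]
    have hx : 0 ≤ |x| ^ (2 * (max q p + 1)) := by positivity
    rcases le_total |x| 1 with h | h
    · have := Real.rpow_le_one (abs_nonneg x) h (z := 2) (by norm_num)
      linarith
    · have := Real.rpow_le_rpow_of_exponent_le h (show (2 : ℝ) ≤ 2 * (max q p + 1) by linarith)
      linarith
  obtain ⟨K, hK, hbound⟩ := hg.exists_error_bound hp hq (h0 0)
  obtain ⟨C2, h2⟩ := integral_aHat_sub_centre_le hL hseed hvar hmom2 hmoment hc ha h0 hi hX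
    (r := 2) le_rfl (by linarith)
  obtain ⟨Cp, hCp⟩ := integral_aHat_sub_centre_le hL hseed hvar hmom2 hmoment hc ha h0 hi hX
    (r := p + 1) (by linarith) (by linarith)
  obtain ⟨Cq, hCq⟩ := integral_aHat_sub_centre_le hL hseed hvar hmom2 hmoment hc ha h0 hi hX
    (r := q + 1) (by linarith) (by linarith)
  set T : ℕ → ℝ := fun n => n * Δ n with hT
  set w : ℕ → ℝ := fun n => T n ^ (-(1 / 2) : ℝ) with hw
  set η : ℕ → ℕ → Ω → ℝ := fun n l ω =>
    |aHat (fun t => X t ω) (Δ n) n (l * Δ n) - aHatCentre a (Δ n) n l| with hη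
  set β : ℕ → ℕ → ℝ := fun n l => |aHatCentre a (Δ n) n l - a (l * Δ n)| with hβ
  set I := ∫ s in Ici 0, a (s - 1) with hI
  refine ⟨fun n ω => Δ n * ∑ l ∈ Finset.range n, K * (a (l * Δ n) *
      (w n + (w n)⁻¹ * η n l ω ^ (2 : ℝ)) + β n l + η n l ω ^ (p + 1) + η n l ω ^ (q + 1)),
    fun n => K * ((1 + |C2|) * w n * I + Δ n * ∑ l ∈ Finset.range n, β n l
      + Cp * T n ^ (1 - (p + 1) / 2) + Cq * T n ^ (1 - (q + 1) / 2)), ?_, fun n hn ω => ?_, ?_⟩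
  · have t1 : Tendsto w atTop (𝓝 0) := tendsto_rpow_of_neg hnΔ (by norm_num)
    have t2 := tendsto_bias hc ha h0 hi hΔpos hΔ hnΔ
    have t3 : Tendsto (fun n => T n ^ (1 - (p + 1) / 2)) atTop (𝓝 0) :=
      tendsto_rpow_of_neg hnΔ (by linarith)
    have t4 : Tendsto (fun n => T n ^ (1 - (q + 1) / 2)) atTop (𝓝 0) :=
      tendsto_rpow_of_neg hnΔ (by linarith)
    have := (((((t1.const_mul (1 + |C2|)).mul_const I).add t2).add (t3.const_mul Cp)).add
      (t4.const_mul Cq)).const_mul K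
    simpa using this
  · have hn' : (0 : ℝ) < n := by exact_mod_cast hn
    have hwn : 0 < w n := Real.rpow_pos_of_pos (mul_pos hn' (hΔpos n)) _
    refine mul_le_mul_of_nonneg_left (Finset.sum_le_sum fun l hl => ?_) (hΔpos n).le
    have hl0 : 0 ≤ (l : ℝ) * Δ n := mul_nonneg (Nat.cast_nonneg _) (hΔpos n).le
    exact hbound _ _ _ _ (h0 _) (ha hl0) ((abs_aHatCentre_sub_le hc ha h0 hi (hΔpos n)
      (Finset.mem_range.1 hl)).trans (ha hl0)) hwn
  · filter_upwards [hnΔ.eventually_ge_atTop 1, hΔ.eventually (eventually_le_nhds one_pos)]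
      with n hn1 hn2
    have hδ := hΔpos n
    have hT0 : 0 < T n := one_pos.trans_le hn1
    have hwn : 0 < w n := Real.rpow_pos_of_pos hT0 _
    have i2 : ∀ l ∈ Finset.range n, _ := fun l hl => h2 (Δ n) n l hδ hn1 (Finset.mem_range.1 hl).le
    have ip : ∀ l ∈ Finset.range n, _ := fun l hl => hCp (Δ n) n l hδ hn1 (Finset.mem_range.1 hl).le
    have iq : ∀ l ∈ Finset.range n, _ := fun l hl => hCq (Δ n) n l hδ hn1 (Finset.mem_range.1 hl).le
    have j1 : ∀ l ∈ Finset.range n, Integrable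
        (fun ω => a (l * Δ n) * (w n + (w n)⁻¹ * η n l ω ^ (2 : ℝ))) P := fun l hl =>
      ((integrable_const _).add ((i2 l hl).1.const_mul _)).const_mul _
    have j2 : ∀ l ∈ Finset.range n, Integrable
        (fun ω => a (l * Δ n) * (w n + (w n)⁻¹ * η n l ω ^ (2 : ℝ)) + β n l) P := fun l hl =>
      (j1 l hl).add (integrable_const _)
    have j3 : ∀ l ∈ Finset.range n, Integrable
        (fun ω => a (l * Δ n) * (w n + (w n)⁻¹ * η n l ω ^ (2 : ℝ)) + β n l
          + η n l ω ^ (p + 1)) P := fun l hl => (j2 l hl).add (ip l hl).1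
    have j4 : ∀ l ∈ Finset.range n, Integrable
        (fun ω => a (l * Δ n) * (w n + (w n)⁻¹ * η n l ω ^ (2 : ℝ)) + β n l
          + η n l ω ^ (p + 1) + η n l ω ^ (q + 1)) P := fun l hl => (j3 l hl).add (iq l hl).1
    refine ⟨(integrable_finsetSum _ fun l hl => (j4 l hl).const_mul K).const_mul _, ?_⟩
    rw [integral_const_mul, integral_finsetSum _ fun l hl => (j4 l hl).const_mul K]
    have hww : (w n)⁻¹ * (C2 * T n ^ (-((2 : ℝ) / 2))) ≤ |C2| * w n := by
      have e : (w n)⁻¹ * T n ^ (-((2 : ℝ) / 2)) = w n := by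
        simp only [hw]
        rw [← Real.rpow_neg hT0.le, ← Real.rpow_add hT0]
        norm_num
      calc (w n)⁻¹ * (C2 * T n ^ (-((2 : ℝ) / 2)))
          = C2 * ((w n)⁻¹ * T n ^ (-((2 : ℝ) / 2))) := by ring
        _ ≤ |C2| * w n := by rw [e]; gcongr; exact le_abs_self C2
    have hterm : ∀ l ∈ Finset.range n,
        ∫ ω, K * (a (l * Δ n) * (w n + (w n)⁻¹ * η n l ω ^ (2 : ℝ)) + β n l
          + η n l ω ^ (p + 1) + η n l ω ^ (q + 1)) ∂P
        ≤ K * (a (l * Δ n) * ((1 + |C2|) * w n) + β n l + Cp * T n ^ (-((p + 1) / 2))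
          + Cq * T n ^ (-((q + 1) / 2))) := fun l hl => by
      have e : ∫ ω, a (l * Δ n) * (w n + (w n)⁻¹ * η n l ω ^ (2 : ℝ)) ∂P
          ≤ a (l * Δ n) * ((1 + |C2|) * w n) := by
        rw [integral_const_mul, integral_add (integrable_const _) ((i2 l hl).1.const_mul _),
          integral_const_mul, integral_const, probReal_univ, one_smul]
        refine mul_le_mul_of_nonneg_left ?_ (h0 _)
        have h5 := mul_le_mul_of_nonneg_left (i2 l hl).2 (inv_pos.2 hwn).le
        have h6 := h5.trans hww
        linarith
      rw [integral_const_mul, integral_add (j3 l hl) (iq l hl).1,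
        integral_add (j2 l hl) (ip l hl).1, integral_add (j1 l hl) (integrable_const _),
        integral_const, probReal_univ, one_smul]
      have := (ip l hl).2
      have := (iq l hl).2
      gcongr
    refine (mul_le_mul_of_nonneg_left (Finset.sum_le_sum hterm) hδ.le).trans ?_
    have hpow : ∀ e : ℝ, Δ n * (n * T n ^ (-e)) = T n ^ (1 - e) := fun e => by
      rw [sub_eq_add_neg, Real.rpow_add hT0, Real.rpow_one]
      simp only [hT]; ring
    have hsum : Δ n * ∑ l ∈ Finset.range n, a (l * Δ n) ≤ I :=
      riemann_sum_le hc ha h0 hi hδ hn2 n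
    calc _ = K * ((1 + |C2|) * w n * (Δ n * ∑ l ∈ Finset.range n, a (l * Δ n))
          + Δ n * ∑ l ∈ Finset.range n, β n l
          + Cp * (Δ n * (n * T n ^ (-((p + 1) / 2))))
          + Cq * (Δ n * (n * T n ^ (-((q + 1) / 2))))) := by
          rw [← Finset.mul_sum, Finset.sum_add_distrib, Finset.sum_add_distrib,
            Finset.sum_add_distrib, ← Finset.sum_mul, Finset.sum_const, Finset.sum_const,
            Finset.card_range, nsmul_eq_mul, nsmul_eq_mul]
          ring
      _ ≤ _ := by
          rw [hpow, hpow]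
          gcongr

lemma tendstoUCP_lambdaHat (hL : IsLevyBasis P τ L) {seed : Measure ℝ}
    (hseed : τ.IsSeedLaw seed) (hvar : Var[id; seed] = 1)
    (hc : Continuous a) (ha : Antitone a) (h0 : ∀ u, 0 ≤ a u) (hi : IntegrableOn a (Ici 0))
    (hX : IsTrawlProcess P L a X) {Δ : ℕ → ℝ} (hΔpos : ∀ n, 0 < Δ n)
    (hΔ : Tendsto Δ atTop (𝓝 0)) (hnΔ : Tendsto (fun n : ℕ => (n : ℝ) * Δ n) atTop atTop)
    {p q : ℝ} (hp : 1 < p) (hq : 1 < q)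
    (hmoment : Integrable (fun x : ℝ => |x| ^ (2 * (max q p + 1))) seed)
    {g : ℝ → ℝ} (hg : TestClass 1 p q g) :
    TendstoUCP P (fun n t ω => lambdaHat g (fun s => X s ω) (Δ n) n t)
      (fun t _ => lambda g a t) := by
  intro T _ ε hε
  obtain ⟨G, c, hclim, hG, hGi⟩ := exists_error_dominator hL hseed hvar hc ha h0 hi hX hΔpos hΔ hnΔ
    hp hq hmoment hg
  have hlim : Tendsto (fun n => ENNReal.ofReal (c n / (ε / 2))) atTop (𝓝 0) := by
    have := ENNReal.tendsto_ofReal (hclim.div_const (ε / 2))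
    simpa using this
  refine tendsto_of_tendsto_of_tendsto_of_le_of_le' tendsto_const_nhds hlim
    (Eventually.of_forall fun _ => zero_le) ?_
  filter_upwards [hGi, eventually_gt_atTop 0,
    eventually_riemann_close hp hq hg hc ha h0 hi hΔpos hΔ hnΔ T (half_pos hε)]
    with n ⟨hint, hle⟩ hn hclose
  have hG0 : ∀ ω, 0 ≤ G n ω := fun ω => le_trans (mul_nonneg (hΔpos n).le
    (Finset.sum_nonneg fun _ _ => abs_nonneg _)) (hG n hn ω)
  have hmarkov := mul_meas_ge_le_integral_of_nonneg (ae_of_all P hG0) hint (ε / 2)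
  have hsub : {ω | ∃ t ∈ Icc 0 T, ε < |lambdaHat g (fun s => X s ω) (Δ n) n t - lambda g a t|}
      ⊆ {ω | ε / 2 ≤ G n ω} := by
    rintro ω ⟨t, ht, hlt⟩
    have h1 := hclose t ht
    have h2 : |lambdaHat g (fun s => X s ω) (Δ n) n t
        - Δ n * ∑ l ∈ Finset.Ico ⌊t / Δ n⌋₊ n, g (a (l * Δ n))| ≤ G n ω := by
      refine le_trans ?_ (hG n hn ω)
      rw [lambdaHat, ← mul_sub, ← Finset.sum_sub_distrib, abs_mul, abs_of_pos (hΔpos n)]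
      refine mul_le_mul_of_nonneg_left ((Finset.abs_sum_le_sum_abs _ _).trans ?_) (hΔpos n).le
      refine Finset.sum_le_sum_of_subset_of_nonneg (fun l hl => ?_) fun _ _ _ => abs_nonneg _
      exact Finset.mem_range.2 (Finset.mem_Ico.1 hl).2
    have h3 := abs_sub_le (lambdaHat g (fun s => X s ω) (Δ n) n t)
      (Δ n * ∑ l ∈ Finset.Ico ⌊t / Δ n⌋₊ n, g (a (l * Δ n))) (lambda g a t)
    simp only [mem_ofPred_eq]
    linarith
  refine (measure_mono hsub).trans ?_
  rw [← ofReal_measureReal]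
  refine ENNReal.ofReal_le_ofReal ?_
  rw [le_div_iff₀' (half_pos hε)]
  exact hmarkov.trans hle

end Main

/-! ### Extension of the trawl function to the whole line -/

section Extension

variable {a : ℝ → ℝ}

lemma IsTrawlFunction.continuous_extend (ha : IsTrawlFunction a) :
    Continuous fun u => a (max u 0) :=
  ha.continuous.comp_continuous (by fun_prop) fun _ => mem_Ici.2 (le_max_right _ _)

lemma IsTrawlFunction.antitone_extend (ha : IsTrawlFunction a) :
    Antitone fun u => a (max u 0) := fun _ _ h =>
  ha.antitone (mem_Ici.2 (le_max_right _ _)) (mem_Ici.2 (le_max_right _ _)) (max_le_max_right 0 h)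

lemma trawlSetAt_extend (a : ℝ → ℝ) (t : ℝ) :
    trawlSetAt (fun u => a (max u 0)) t = trawlSetAt a t := by
  ext x
  simp only [trawlSetAt, trawlSet, mem_ofPred_eq]
  refine and_congr_right fun h => ?_
  rw [max_eq_left (neg_nonneg.2 h)]

end Extension

end Trawl

theorem theorem2 {Ω : Type*} [MeasurableSpace Ω] (P : Measure Ω) [IsProbabilityMeasure P]
    (τ : Trawl.Triplet) (L : Set (ℝ × ℝ) → Ω → ℝ) (hL : Trawl.IsLevyBasis P τ L)
    (seed : Measure ℝ) (hseed : τ.IsSeedLaw seed) (hvar : Var[id; seed] = 1)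
    (a : ℝ → ℝ) (ha : Trawl.IsTrawlFunction a)
    (X : ℝ → Ω → ℝ) (hX : Trawl.IsTrawlProcess P L a X)
    (Δ : ℕ → ℝ) (hΔpos : ∀ n, 0 < Δ n) (hΔ : Tendsto Δ atTop (𝓝 0))
    (hnΔ : Tendsto (fun n : ℕ => (n : ℝ) * Δ n) atTop atTop)
    (p q : ℝ) (hp : 1 < p) (hq : 1 < q)
    (hmoment : Integrable (fun x : ℝ => |x| ^ (2 * (max q p + 1))) seed)
    (g : ℝ → ℝ) (hg : Trawl.TestClass 1 p q g) :
    IntegrableOn (fun s => g (a s)) (Ici 0) ∧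
    Trawl.TendstoUCP P
      (fun n t ω => Trawl.lambdaHat g (fun s => X s ω) (Δ n) n t)
      (fun t _ => Trawl.lambda g a t) := by
  have heq : ∀ u, 0 ≤ u → a (max u 0) = a u := fun u hu => by rw [max_eq_left hu]
  have hc := ha.continuous_extend
  have han := ha.antitone_extend
  have h0 : ∀ u, 0 ≤ a (max u 0) := fun u => ha.nonneg _ (le_max_right _ _)
  have hi : IntegrableOn (fun u => a (max u 0)) (Ici 0) :=
    ha.integrable.congr_fun (fun u hu => (heq u hu).symm) measurableSet_Ici
  have hX' : Trawl.IsTrawlProcess P L (fun u => a (max u 0)) X := fun t => by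
    rw [Trawl.trawlSetAt_extend]; exact hX t
  refine ⟨(Trawl.integrableOn_comp_trawl hp hq hg hc han h0 hi).congr_fun
    (fun u hu => by simp only [heq u hu]) measurableSet_Ici, fun T hT ε hε => ?_⟩
  refine (Trawl.tendstoUCP_lambdaHat hL hseed hvar hc han h0 hi hX' hΔpos hΔ hnΔ hp hq hmoment hg
    T hT ε hε).congr fun n => ?_
  congr 1
  ext ω
  simp only [mem_ofPred_eq]
  refine exists_congr fun t => and_congr_right fun ht => ?_
  have hlam : Trawl.lambda g (fun u => a (max u 0)) t = Trawl.lambda g a t :=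
    setIntegral_congr_fun measurableSet_Ioi fun u hu => by
      simp only [heq u (ht.1.trans (le_of_lt hu))]
  rw [hlam]
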